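/- **Theorem (correctness of SILVAN).** Let $G=(V,E)$ be a finite unweighted directed graph with $|V|\ge 2$ (an undirected graph is regarded as a symmetric directed one). Let $\Pi_{st}$ be the set of shortest paths from $s$ to $t$, $\sigma_{st}=|\Pi_{st}|$, $\sigma_{st}(v)=|\{\pi\in\Pi_{st}: v\in\pi\}|$, and $$b(v)=\frac1{|V|(|V|-1)}\sum_{s\ne t,\ s\neq v\neq t}\frac{\sigma_{st}(v)}{\sigma_{st}}\qquad(0/0:=0).$$ A function $\tilde b:V\to\mathbb R$ is an *$\varepsilon$-approximation* if $|b(v)-\tilde b(v)|\le\varepsilon$ for all $v\in V$. *Sampling.* Fix a real $\alpha\ge1$. A random bag $\tau$ is obtained by drawing a uniformly random ordered pair $(s,t)$ of distinct nodes and then $\lceil\alpha\sigma_{st}\rceil$ independent uniformly random elements of $\Pi_{st}$ (with replacement). Let $f_v(\tau)\in[0,1]$ be the fraction of the paths in $\tau$ having $v$ as an internal node ($0$ if $\tau$ is empty). For a sample $S=(\tau_1,\dots,\tau_m)$, a matrix $\sigma\in\{-1,1\}^{c\times m}$, a set $A\subseteq V$ and $L>0$ put $\tilde b_S(v)=\frac1m\sum_k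 f_v(\tau_k)$, $w_A(S)=\sup_{v\in A}\frac1m\sum_k f_v(\tau_k)^2$, $\hat R_A(S,\sigma)=\frac1c\sum_{x=1}^c\sup_{v\in A}\frac1m\sum_k\sigma_{x,k}f_v(\tau_k)$ (suprema over $\emptyset$ and square roots of negative numbers are read as $0$), and $$\nu_A=w_A+\tfrac Lm+\sqrt{(\tfrac Lm)^2+\tfrac{2w_AL}m},\quad \tilde R_A=\hat R_A+\sqrt{\tfrac{4w_AL}{cm}},\quad R_A=\tilde R_A+\tfrac Lm+\sqrt{(\tfrac Lm)^2+\tfrac{2L\tilde R_A}m},$$ $$\varepsilon_A(S,\sigma,L)=2R_A+\sqrt{\tfrac{2L(\nu_A+4R_A)}m}+\tfrac L{3m}.$$ *Input.* Integers $c,m'\ge1$, reals $\varepsilon,\delta\in(0,1)$, an upper bound $D$ on the number of nodes of every shortest path of $G$, and $\delta_\rho,\delta_\nu,\delta_m>0$ with $\delta_\rho+\delta_\nu+\delta_m\le\delta/2$. *First phase.* Draw an i.i.d. sample $S'$ of $m'$ bags. From $S'$ compute, by arbitrary rules, a partition $V=V_1\cup\dots\cup V_t$ into $t$ (possibly empty)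 subsets and a schedule $m_0=0$, $1\le m_1\le m_2\le\cdots$ of integers tending to infinity. Compute $\hat m$ as follows. Let $\tilde\rho=\sum_v\tilde b_{S'}(v)$ and let $\rho$ be one of $$\tilde\rho+\sqrt{\tfrac53\Big(\tfrac{D\ln(1/\delta_\rho)}{m'}\Big)^2+\tfrac{2D\tilde\rho\ln(1/\delta_\rho)}{m'}}+\tfrac{4D\ln(1/\delta_\rho)}{3m'},$$ $$\tilde\rho+\sqrt{\tfrac{2\Lambda\ln(2/\delta_\rho)}{m'}}+\tfrac{7D\ln(2/\delta_\rho)}{3(m'-1)}\quad(\text{only if }m'\ge2),$$ where $\Lambda=\frac1{m'(m'-1)}\sum_{i<j}\big(\sum_vf_v(\tau'_i)-\sum_vf_v(\tau'_j)\big)^2$ and $S'=(\tau'_1,\dots,\tau'_{m'})$. Let $\hat\nu=\min\{\frac14,\nu_V\}$, with $\nu_V$ computed from $S'$ with $L=\ln(1/\delta_\nu)$. With $g(x)=x(1-x)$ and $h(x)=(1+x)\ln(1+x)-x$, let $\hat x=\min\{\hat x_1,\hat x_2\}$, where $\hat x_2=\frac12-\sqrt{\frac14-\hat\nu}$ and $$\hat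 x_1=\inf\Big\{x:\tfrac12-\sqrt{\tfrac\varepsilon3-\tfrac{\varepsilon^2}9}\le x\le\tfrac12,\ g(x)h\big(\tfrac{\varepsilon}{g(x)}\big)\le2\varepsilon^2\Big\}.$$ Then $\hat m$ is the least integer $m\ge1$ with $$m\ge\sup_{0<x\le\hat x}\frac{\ln\big(2\rho/(x\delta_m)\big)}{g(x)\,h(\varepsilon/g(x))}.$$ *Second phase.* Set $i=0$ and $\varepsilon_j=1$ for $j=1,\dots,t$. Until either $\varepsilon_j\le\varepsilon$ for all $j$ or $m_i\ge\hat m$: increase $i$ by one, draw $m_i-m_{i-1}$ further independent bags (independent also of $S'$), so that the second-phase sample $S_i$ has $m_i$ bags, add $m_i-m_{i-1}$ columns of independent uniform signs to the $c$-row matrix $\sigma$, and set $\varepsilon_j=\varepsilon_{V_j}\big(S_i,\sigma,\ln(2^{i+1}\cdot5t/\delta)\big)$ for all $j$. When the loop ends, return $\tilde b=\tilde b_{S_i}$. *Claim.* With probability at least $1-\delta$ over all the random draws, the algorithm terminates and its output $\tilde b$ is an $\varepsilon$-approximation of the betweenness centralities of $G$. -/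

import Mathlib

open MeasureTheory ProbabilityTheory

namespace Silvan

noncomputable section

/-! ### Graphs, shortest paths and betweenness centrality -/

/-- `p` is the list of nodes of a (directed) walk from `s` to `t` in `G`. -/
def IsWalk {V : Type*} (G : Digraph V) (s t : V) (p : List V) : Prop :=
  p.head? = some s ∧ p.getLast? = some t ∧ p.IsChain G.Adj

/-- `p` is a shortest path from `s` to `t`: a walk with the fewest nodes. -/
def IsShortestPath {V : Type*} (G : Digraph V) (s t : V) (p : List V) : Prop :=
  IsWalk G s t p ∧ ∀ q : List V, IsWalk G s t q → p.length ≤ q.length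

theorem finite_isShortestPath {V : Type*} [Finite V] (G : Digraph V) (s t : V) :
    {p : List V | IsShortestPath G s t p}.Finite := by
  by_cases h : ∃ p, IsShortestPath G s t p
  · obtain ⟨p, hp⟩ := h
    refine (List.finite_length_eq V p.length).subset ?_
    intro q hq
    exact le_antisymm (hq.2 p hp.1) (hp.2 q hq.1)
  · refine Set.Finite.subset Set.finite_empty ?_
    intro q hq
    exact absurd ⟨q, hq⟩ h

/-- The set `Π_st` of all shortest paths from `s` to `t`; it is empty if `t` is not reachable
from `s`. -/
def shortestPaths {V : Type*} [Finite V] (G : Digraph V) (s t : V) : Finset (List V) :=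
  (finite_isShortestPath G s t).toFinset

/-- The number `σ_st` of shortest paths from `s` to `t`. -/
def numSP {V : Type*} [Finite V] (G : Digraph V) (s t : V) : ℕ := (shortestPaths G s t).card

/-- The number `σ_st(v)` of shortest paths from `s` to `t` that contain `v`. -/
def numSPThrough {V : Type*} [Finite V] [DecidableEq V] (G : Digraph V) (s t v : V) : ℕ :=
  ((shortestPaths G s t).filter (fun p => v ∈ p)).card

/-- The normalized betweenness centrality `b(v)`. A pair `(s, t)` such that `t` is not reachable
from `s` contributes `0 / 0 = 0`. -/
def betweenness {V : Type*} [Fintype V] [DecidableEq V] (G : Digraph V) (v : V) : ℝ :=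
  1 / ((Fintype.card V : ℝ) * ((Fintype.card V : ℝ) - 1)) *
    ∑ s : V, ∑ t : V,
      if s ≠ t ∧ s ≠ v ∧ v ≠ t then (numSPThrough G s t v : ℝ) / (numSP G s t : ℝ) else 0

/-- The vertex diameter: the maximum number of nodes in any shortest path of `G`. -/
def vertexDiameter {V : Type*} [Fintype V] (G : Digraph V) : ℕ :=
  Finset.univ.sup fun s : V => Finset.univ.sup fun t : V =>
    (shortestPaths G s t).sup List.length

/-- `bt` is an `ε`-approximation of the betweenness centralities of all the nodes of `G`. -/
def IsApprox {V : Type*} [Fintype V] [DecidableEq V] (G : Digraph V) (ε : ℝ) (bt : V → ℝ) : Prop :=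
  ∀ v : V, |betweenness G v - bt v| ≤ ε

/-! ### Sampling bags of shortest paths -/

/-- The number `⌈α σ_st⌉` of shortest paths that are drawn for the pair `(s, t)`. -/
def bagSize {V : Type*} [Finite V] (G : Digraph V) (α : ℝ) (s t : V) : ℕ := ⌈α * numSP G s t⌉₊

/-- A bag of shortest paths: a pair of distinct nodes `s, t` and a list of `⌈α σ_st⌉`
(not necessarily distinct) shortest paths from `s` to `t`. -/
def Bag {V : Type*} [Finite V] (G : Digraph V) (α : ℝ) : Type _ :=
  Σ p : {p : V × V // p.1 ≠ p.2},
    Fin (bagSize G α p.1.1 p.1.2) → {π : List V // π ∈ shortestPaths G p.1.1 p.1.2}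

instance instMeasurableSpaceBag {V : Type*} [Finite V] (G : Digraph V) (α : ℝ) :
    MeasurableSpace (Bag G α) := ⊤

instance instNonemptyPair {V : Type*} [Nontrivial V] : Nonempty {p : V × V // p.1 ≠ p.2} := by
  obtain ⟨x, y, h⟩ := exists_pair_ne V
  exact ⟨⟨(x, y), h⟩⟩

instance instNonemptyDraw {V : Type*} [Finite V] (G : Digraph V) (α : ℝ) (s t : V) :
    Nonempty (Fin (bagSize G α s t) → {π : List V // π ∈ shortestPaths G s t}) := by
  rcases (shortestPaths G s t).eq_empty_or_nonempty with h | ⟨π, hπ⟩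
  · have h0 : bagSize G α s t = 0 := by simp [bagSize, numSP, h]
    exact ⟨fun i => absurd i.2 (by simp [h0])⟩
  · exact ⟨fun _ => ⟨π, hπ⟩⟩

/-- The law of one sampled bag: a uniformly random pair of distinct nodes `(s, t)`, then
`⌈α σ_st⌉` independent uniformly random elements of `Π_st` (i.e. a uniformly random tuple). -/
def bagPMF {V : Type*} [Fintype V] [DecidableEq V] [Nontrivial V] (G : Digraph V) (α : ℝ) :
    PMF (Bag G α) :=
  (PMF.uniformOfFintype {p : V × V // p.1 ≠ p.2}).bind fun p =>
    (PMF.uniformOfFintype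
      (Fin (bagSize G α p.1.1 p.1.2) → {π : List V // π ∈ shortestPaths G p.1.1 p.1.2})).map
        fun d => (⟨p, d⟩ : Bag G α)

/-- The law of one sampled bag, as a measure. -/
def bagMeasure {V : Type*} [Fintype V] [DecidableEq V] [Nontrivial V] (G : Digraph V) (α : ℝ) :
    Measure (Bag G α) := (bagPMF G α).toMeasure

instance instIsProbabilityMeasureBag {V : Type*} [Fintype V] [DecidableEq V] [Nontrivial V]
    (G : Digraph V) (α : ℝ) : IsProbabilityMeasure (bagMeasure G α) :=
  PMF.toMeasure.isProbabilityMeasure _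

/-- `f_v(τ)`: the fraction of the paths of the bag `τ` that have `v` as an internal node
(it is `0` for an empty bag). -/
def pathFrac {V : Type*} [Finite V] [DecidableEq V] {G : Digraph V} {α : ℝ} (v : V)
    (τ : Bag G α) : ℝ :=
  1 / (bagSize G α τ.1.1.1 τ.1.1.2 : ℝ) *
    ∑ i, if v ∈ (τ.2 i).1 ∧ v ≠ τ.1.1.1 ∧ v ≠ τ.1.1.2 then (1 : ℝ) else 0

/-! ### Empirical quantities and the non-uniform deviation bounds

A set `A : Set V` of nodes stands for the set of functions `{f_v : v ∈ A}`. -/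

/-- The estimate `b̃(v)`: the average of `f_v` over the sample `S`. -/
def estimate {V : Type*} [Finite V] [DecidableEq V] {G : Digraph V} {α : ℝ} {m : ℕ}
    (S : Fin m → Bag G α) (v : V) : ℝ :=
  1 / (m : ℝ) * ∑ k, pathFrac v (S k)

/-- The empirical wimpy variance of `{f_v : v ∈ A}` on `S`. -/
def wimpy {V : Type*} [Finite V] [DecidableEq V] {G : Digraph V} {α : ℝ} {m : ℕ}
    (S : Fin m → Bag G α) (A : Set V) : ℝ :=
  ⨆ v : A, 1 / (m : ℝ) * ∑ k, (pathFrac (v : V) (S k)) ^ 2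

/-- The sign in `{-1, 1}` encoded by a Boolean. -/
def sign (b : Bool) : ℝ := if b then 1 else -1

/-- The `c`-samples Monte Carlo empirical Rademacher average of `{f_v : v ∈ A}` on `S`, for the
`c × m` sign matrix `σ`. -/
def mcera {V : Type*} [Finite V] [DecidableEq V] {G : Digraph V} {α : ℝ} {c m : ℕ}
    (S : Fin m → Bag G α) (σ : Fin c → Fin m → Bool) (A : Set V) : ℝ :=
  1 / (c : ℝ) * ∑ x, ⨆ v : A, 1 / (m : ℝ) * ∑ k, sign (σ x k) * pathFrac (v : V) (S k)

/-- The upper bound on the maximum variance of `{f_v : v ∈ A}` computed from `S`; `L` is the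
logarithm of the inverse confidence. -/
def varBound {V : Type*} [Finite V] [DecidableEq V] {G : Digraph V} {α : ℝ} {m : ℕ}
    (S : Fin m → Bag G α) (A : Set V) (L : ℝ) : ℝ :=
  wimpy S A + L / m + √((L / m) ^ 2 + 2 * wimpy S A * L / m)

/-- The quantity `R̃`. -/
def radTilde {V : Type*} [Finite V] [DecidableEq V] {G : Digraph V} {α : ℝ} {c m : ℕ}
    (S : Fin m → Bag G α) (σ : Fin c → Fin m → Bool) (A : Set V) (L : ℝ) : ℝ :=
  mcera S σ A + √(4 * wimpy S A * L / (c * m))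

/-- The quantity `R`. -/
def radBound {V : Type*} [Finite V] [DecidableEq V] {G : Digraph V} {α : ℝ} {c m : ℕ}
    (S : Fin m → Bag G α) (σ : Fin c → Fin m → Bool) (A : Set V) (L : ℝ) : ℝ :=
  radTilde S σ A L + L / m + √((L / m) ^ 2 + 2 * L * radTilde S σ A L / m)

/-- The bound `ε_A` on the supremum deviation of `{f_v : v ∈ A}` on `S`. -/
def epsBound {V : Type*} [Finite V] [DecidableEq V] {G : Digraph V} {α : ℝ} {c m : ℕ}
    (S : Fin m → Bag G α) (σ : Fin c → Fin m → Bool) (A : Set V) (L : ℝ) : ℝ :=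
  2 * radBound S σ A L + √(2 * L * (varBound S A L + 4 * radBound S σ A L) / m) + L / (3 * m)

/-! ### The sufficient number of samples -/

/-- The two available upper confidence bounds for `∑ v, b(v)`. -/
inductive RhoMethod where
  | bernstein
  | empiricalBernstein

/-- `ρ̃`: the sum of the estimates of all nodes. -/
def rhoTilde {V : Type*} [Fintype V] [DecidableEq V] {G : Digraph V} {α : ℝ} {m : ℕ}
    (S : Fin m → Bag G α) : ℝ := ∑ v, estimate S v

/-- The sample variance `Λ(S)` of `∑ v, f_v`. -/
def lambdaVar {V : Type*} [Fintype V] [DecidableEq V] {G : Digraph V} {α : ℝ} {m : ℕ}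
    (S : Fin m → Bag G α) : ℝ :=
  1 / ((m : ℝ) * ((m : ℝ) - 1)) *
    ∑ i, ∑ j, if i < j then (∑ v, pathFrac v (S i) - ∑ v, pathFrac v (S j)) ^ 2 else 0

/-- The upper confidence bound `ρ` for `∑ v, b(v)` computed from `S` at confidence `1 - η`, given
an upper bound `D` to the vertex diameter. -/
def rhoBound {V : Type*} [Fintype V] [DecidableEq V] {G : Digraph V} {α : ℝ} {m : ℕ}
    (S : Fin m → Bag G α) (D : ℕ) (η : ℝ) : RhoMethod → ℝ
  | .bernstein =>
      rhoTilde S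
        + √(5 / 3 * (D * Real.log (1 / η) / m) ^ 2 + 2 * D * rhoTilde S * Real.log (1 / η) / m)
        + 4 * D * Real.log (1 / η) / (3 * m)
  | .empiricalBernstein =>
      rhoTilde S + √(2 * lambdaVar S * Real.log (2 / η) / m)
        + 7 * D * Real.log (2 / η) / (3 * ((m : ℝ) - 1))

/-- `g(x) = x (1 - x)`. -/
def gFun (x : ℝ) : ℝ := x * (1 - x)

/-- `h(x) = (1 + x) ln (1 + x) - x`. -/
def hFun (x : ℝ) : ℝ := (1 + x) * Real.log (1 + x) - x

/-- The point `x̂₁`. -/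
def xHat1 (ε : ℝ) : ℝ :=
  sInf {x : ℝ | 1 / 2 - √(ε / 3 - ε ^ 2 / 9) ≤ x ∧ x ≤ 1 / 2 ∧
    gFun x * hFun (ε / gFun x) ≤ 2 * ε ^ 2}

/-- The point `x̂₂`. -/
def xHat2 (ν : ℝ) : ℝ := 1 / 2 - √(1 / 4 - ν)

/-- The smallest sample size `m ≥ 1` that is at least
`sup {ln (2ρ / (x η)) / (g(x) h(ε / g(x))) : 0 < x ≤ min x̂₁ x̂₂}`. -/
def sampleBound (ε η ν ρ : ℝ) : ℕ :=
  max 1 ⌈sSup ((fun x : ℝ => Real.log (2 * ρ / (x * η)) / (gFun x * hFun (ε / gFun x))) ''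
    Set.Ioc 0 (min (xHat1 ε) (xHat2 ν)))⌉₊

/-- The number `m̂` of sufficient samples computed from the first sample `S'`, with the confidence
split into `δρ` (upper bound for `∑ v, b(v)`), `δν` (upper bound for the maximum variance, which
never exceeds `1/4`) and `δm` (deviation of a sample of size `m̂`). -/
def sufficientSamples {V : Type*} [Fintype V] [DecidableEq V] {G : Digraph V} {α : ℝ} {m' : ℕ}
    (S' : Fin m' → Bag G α) (D : ℕ) (meth : RhoMethod) (ε δρ δν δm : ℝ) : ℕ :=
  sampleBound ε δm (min (1 / 4) (varBound S' Set.univ (Real.log (1 / δν)))) (rhoBound S' D δρ meth)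

/-! ### The algorithm -/

/-- A partition of the nodes (equivalently of the functions `f_v`) into `t` subsets: node `v`
belongs to the subset with index `part v`. -/
structure Peeling (V : Type*) where
  t : ℕ
  part : V → Fin t

/-- A sampling schedule: `m_0 = 0` and sample sizes `1 ≤ m_1 ≤ m_2 ≤ ⋯` that tend to infinity. -/
def IsSchedule (ms : ℕ → ℕ) : Prop :=
  ms 0 = 0 ∧ 1 ≤ ms 1 ∧ Monotone ms ∧ Filter.Tendsto ms Filter.atTop Filter.atTop

/-- The value of `ε_{F_j}` after iteration `i` (initially `1`). The bags drawn in the second phase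
are `τ 0, τ 1, …`, the columns of the sign matrix are `σ (·, 0), σ (·, 1), …`, and the first `ms i`
of them have been drawn by the end of iteration `i`. -/
def epsAt {V : Type*} [Finite V] [DecidableEq V] {G : Digraph V} {α : ℝ} {c : ℕ} (δ : ℝ)
    (P : Peeling V) (ms : ℕ → ℕ) (τ : ℕ → Bag G α) (σ : Fin c × ℕ → Bool) (i : ℕ) (j : Fin P.t) :
    ℝ :=
  if i = 0 then 1
  else epsBound (fun k : Fin (ms i) => τ k) (fun x (k : Fin (ms i)) => σ (x, k))
    {v | P.part v = j} (Real.log (2 ^ (i + 1) * 5 * P.t / δ))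

/-- The stopping condition, evaluated after iteration `i`. -/
def StopCond {V : Type*} [Finite V] [DecidableEq V] {G : Digraph V} {α : ℝ} {c : ℕ} (ε δ : ℝ)
    (P : Peeling V) (mHat : ℕ) (ms : ℕ → ℕ) (τ : ℕ → Bag G α) (σ : Fin c × ℕ → Bool) (i : ℕ) :
    Prop :=
  (∀ j : Fin P.t, epsAt δ P ms τ σ i j ≤ ε) ∨ mHat ≤ ms i

open Classical in
/-- The second phase: iterate until the stopping condition holds for the first time and return
the estimates computed in that iteration; the result is `none` if the loop never ends. -/
def secondPhase {V : Type*} [Finite V] [DecidableEq V] {G : Digraph V} {α : ℝ} {c : ℕ} (ε δ : ℝ)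
    (P : Peeling V) (mHat : ℕ) (ms : ℕ → ℕ) (τ : ℕ → Bag G α) (σ : Fin c × ℕ → Bool) :
    Option (V → ℝ) :=
  if h : ∃ i, StopCond ε δ P mHat ms τ σ i then
    some (estimate (fun k : Fin (ms (Nat.find h)) => τ k))
  else none

/-- All the randomness of a run: the first sample `S'`, the stream of bags of the second phase and
the stream of columns of the sign matrix. -/
abbrev Run {V : Type*} [Finite V] (G : Digraph V) (α : ℝ) (c m' : ℕ) : Type _ :=
  (Fin m' → Bag G α) × (ℕ → Bag G α) × (Fin c × ℕ → Bool)

/-- The uniform law on the two signs. -/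
def signMeasure : Measure Bool := (PMF.uniformOfFintype Bool).toMeasure

instance instIsProbabilityMeasureSign : IsProbabilityMeasure signMeasure :=
  PMF.toMeasure.isProbabilityMeasure _

/-- The law of the randomness of a run: all the bags are i.i.d., all the signs are i.i.d. and
uniform, and `S'`, the second stream of bags and the signs are independent. -/
def runMeasure {V : Type*} [Fintype V] [DecidableEq V] [Nontrivial V] (G : Digraph V) (α : ℝ)
    (c m' : ℕ) : Measure (Run G α c m') :=
  (Measure.pi fun _ : Fin m' => bagMeasure G α).prod
    ((Measure.infinitePi fun _ : ℕ => bagMeasure G α).prod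
      (Measure.infinitePi fun _ : Fin c × ℕ => signMeasure))

/-- The output of the algorithm. The partition `peel S'` and the schedule `sched S'` are computed
from the first sample `S'`. -/
def silvan {V : Type*} [Fintype V] [DecidableEq V] {G : Digraph V} {α : ℝ} {c m' : ℕ}
    (ε δ : ℝ) (D : ℕ) (meth : RhoMethod) (δρ δν δm : ℝ)
    (peel : (Fin m' → Bag G α) → Peeling V) (sched : (Fin m' → Bag G α) → ℕ → ℕ)
    (ω : Run G α c m') : Option (V → ℝ) :=
  secondPhase ε δ (peel ω.1) (sufficientSamples ω.1 D meth ε δρ δν δm) (sched ω.1) ω.2.1 ω.2.2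

end

end Silvan

namespace Silvan

noncomputable section

/-! ### Expectations over finite probability spaces -/

/-! The algorithm never needs a uniform statement over all sample sizes at once. The number `m̂`,
the partition and the schedule are functions of `S'`, which is independent of the second phase, so
conditionally on `S'` they are constants, and so is the first index `i*` with `m_{i*} ≥ m̂`. The
loop stops at `i*` at the latest. If it stops earlier, every `ε_j` is at most `ε`, and the deviation
bounds of that iteration give the claim; if it stops at `i*`, what is needed is that one sample of
the fixed size `m_{i*} ≥ m̂` is accurate. The failures to be added up are `δρ + δν` (`ρ` or `ν̂` is
too small), `δm` (the sample of size `m_{i*}` deviates) and `∑_{i ≥ 1} δ / 2^(i+1) = δ / 2` (some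
iteration has an invalid bound).

The bounds `ε_A` (`pr_devSum_lt_le`) combine symmetrization with Bousquet's inequality for the
supremum deviation, both for `f` and for `-f`. The unknown variance and Rademacher complexity that
appear there are replaced by empirical upper bounds. Squared sums and empirical Rademacher averages
are self-bounding, which gives `varBound` and the step from the empirical to the expected Rademacher
average. The Monte Carlo average over `c` rows of signs is compared with its mean through a convex
transport inequality on the cube.

Self-bounding functions and Bousquet's inequality are both treated by the entropy method:
subadditivity of the entropy (`entropy_le`) gives a differential inequality for the logarithm of the
moment generating function, and `nonpos_of_deriv_mul_le` integrates it.

For `m̂` (`pr_exists_abs_sub_gt_le`), node `v` receives the failure budget `b(v) δm / ρ`, and these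
sum to at most `δm` because `∑ b(v) ≤ ρ`. A node with small `b(v)` has variance at most `b(v) (1 -
b(v))`, so Bennett's inequality meets its budget. All nodes beyond `x̂` have at least the budget of
`x̂`, which Hoeffding's inequality (at `x̂₁`) or Bennett's inequality with the variance bound `ν̂`
(at `x̂₂`) meets.

A bag takes finitely many values, so all concentration is done with finite sums (`expect`, `pr`). It
is transferred to the infinite product measure by outer-measure inequalities on finite windows of
the streams; hence no measurability of the rules or of the final event is used. -/

/-- A probability weight on a finite type. -/
structure IsWeight {Ω : Type*} [Fintype Ω] (p : Ω → ℝ) : Prop where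
  nonneg : ∀ a, 0 ≤ p a
  sum_eq_one : ∑ a, p a = 1

/-- The expectation of `F` under the weight `p`. -/
def expect {Ω : Type*} [Fintype Ω] (p F : Ω → ℝ) : ℝ := ∑ a, p a * F a

open Classical in
/-- The probability of `A` under the weight `p`. -/
def pr {Ω : Type*} [Fintype Ω] (p : Ω → ℝ) (A : Ω → Prop) : ℝ :=
  expect p fun a => if A a then 1 else 0

/-- The weight of independent coordinates. -/
def piWeight {Ω : Type*} (p : Ω → ℝ) (n : ℕ) (x : Fin n → Ω) : ℝ := ∏ i, p (x i)

section expect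

variable {Ω Ω' : Type*} [Fintype Ω] [Fintype Ω'] {p : Ω → ℝ} {F F' : Ω → ℝ}

theorem IsWeight.nonempty (hp : IsWeight p) : Nonempty Ω := by
  by_contra h
  rw [not_nonempty_iff] at h
  simpa using hp.sum_eq_one

theorem expect_mono (hp : IsWeight p) (h : ∀ a, F a ≤ F' a) : expect p F ≤ expect p F' :=
  Finset.sum_le_sum fun a _ => mul_le_mul_of_nonneg_left (h a) (hp.nonneg a)

theorem expect_add : expect p (fun a => F a + F' a) = expect p F + expect p F' := by
  simp [expect, mul_add, Finset.sum_add_distrib]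

theorem expect_sub : expect p (fun a => F a - F' a) = expect p F - expect p F' := by
  simp [expect, mul_sub, Finset.sum_sub_distrib]

theorem expect_neg : expect p (fun a => -F a) = -expect p F := by
  simp [expect]

theorem expect_const_mul (c : ℝ) : expect p (fun a => c * F a) = c * expect p F := by
  simp only [expect, Finset.mul_sum]
  exact Finset.sum_congr rfl fun a _ => by ring

theorem expect_mul_const (c : ℝ) : expect p (fun a => F a * c) = expect p F * c := by
  simp only [expect, Finset.sum_mul]
  exact Finset.sum_congr rfl fun a _ => by ring

theorem expect_const (hp : IsWeight p) (c : ℝ) : expect p (fun _ => c) = c := by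
  rw [expect, ← Finset.sum_mul, hp.sum_eq_one, one_mul]

theorem expect_sum {ι : Type*} (s : Finset ι) (f : ι → Ω → ℝ) :
    expect p (fun a => ∑ i ∈ s, f i a) = ∑ i ∈ s, expect p (f i) := by
  simp only [expect, Finset.mul_sum]
  exact Finset.sum_comm

theorem expect_comm {q : Ω' → ℝ} (f : Ω → Ω' → ℝ) :
    expect p (fun a => expect q (f a)) = expect q fun b => expect p fun a => f a b := by
  simp only [expect, Finset.mul_sum]
  rw [Finset.sum_comm]
  exact Finset.sum_congr rfl fun _ _ => Finset.sum_congr rfl fun _ _ => by ring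

theorem expect_nonneg (hp : IsWeight p) (h : ∀ a, 0 ≤ F a) : 0 ≤ expect p F :=
  Finset.sum_nonneg fun a _ => mul_nonneg (hp.nonneg a) (h a)

theorem expect_pos (hp : IsWeight p) (h : ∀ a, 0 < F a) : 0 < expect p F := by
  refine lt_of_le_of_ne (expect_nonneg hp fun a => (h a).le) fun h0 => ?_
  have h1 := (Finset.sum_eq_zero_iff_of_nonneg
    fun a _ => mul_nonneg (hp.nonneg a) (h a).le).1 h0.symm
  have h2 : ∑ a, p a = 0 := Finset.sum_eq_zero fun a ha =>
    (mul_eq_zero.1 (h1 a ha)).resolve_right (h a).ne'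
  rw [hp.sum_eq_one] at h2
  exact one_ne_zero h2

theorem expect_eq_zero_of_forall_ne (h : ∀ a, p a ≠ 0 → F a = 0) : expect p F = 0 :=
  Finset.sum_eq_zero fun a _ => by
    by_cases ha : p a = 0
    · simp [ha]
    · simp [h a ha]

theorem eq_zero_of_expect_eq_zero (hp : IsWeight p) (hF : ∀ a, 0 ≤ F a) (h : expect p F = 0)
    (a : Ω) (ha : p a ≠ 0) : F a = 0 := by
  have h1 := (Finset.sum_eq_zero_iff_of_nonneg
    fun a _ => mul_nonneg (hp.nonneg a) (hF a)).1 h a (Finset.mem_univ a)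
  exact (mul_eq_zero.1 h1).resolve_left ha

theorem ciSup_expect_le {ι : Type*} [Finite ι] [Nonempty ι] (hp : IsWeight p)
    (f : ι → Ω → ℝ) : ⨆ v, expect p (f v) ≤ expect p fun a => ⨆ v, f v a :=
  ciSup_le fun v => expect_mono hp fun a => le_ciSup (Set.finite_range fun v => f v a).bddAbove v

theorem pr_mono (hp : IsWeight p) {A B : Ω → Prop} (h : ∀ a, A a → B a) : pr p A ≤ pr p B :=
  expect_mono hp fun a => by
    by_cases hA : A a
    · simp [hA, h a hA]
    · by_cases hB : B a <;> simp [hA, hB]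

theorem pr_eq_zero (A : Ω → Prop) (h : ∀ a, p a ≠ 0 → ¬ A a) : pr p A = 0 :=
  expect_eq_zero_of_forall_ne fun a ha => by simp [h a ha]

theorem pr_or_le (hp : IsWeight p) (A B : Ω → Prop) :
    pr p (fun a => A a ∨ B a) ≤ pr p A + pr p B := by
  rw [pr, pr, pr, ← expect_add]
  exact expect_mono hp fun a => by by_cases hA : A a <;> by_cases hB : B a <;> simp [hA, hB]

theorem pr_exists_le {ι : Type*} [Fintype ι] (hp : IsWeight p) (A : ι → Ω → Prop) :
    pr p (fun a => ∃ i, A i a) ≤ ∑ i, pr p (A i) := by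
  classical
  simp only [pr]
  rw [← expect_sum]
  refine expect_mono hp fun a => ?_
  by_cases h : ∃ i, A i a
  · obtain ⟨i, hi⟩ := h
    rw [if_pos ⟨i, hi⟩]
    calc (1 : ℝ) = if A i a then 1 else 0 := by simp [hi]
      _ ≤ _ := Finset.single_le_sum (f := fun i => if A i a then (1 : ℝ) else 0)
          (fun i _ => by split_ifs <;> norm_num) (Finset.mem_univ i)
  · rw [if_neg h]
    exact Finset.sum_nonneg fun i _ => by split_ifs <;> norm_num

theorem pr_le_expect (hp : IsWeight p) {A : Ω → Prop} (hF : ∀ a, 0 ≤ F a) (h : ∀ a, A a → 1 ≤ F a) :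
    pr p A ≤ expect p F :=
  expect_mono hp fun a => by
    by_cases hA : A a
    · simpa [hA] using h a hA
    · simpa [hA] using hF a

/-- The exponential Markov inequality. -/
theorem pr_le_exp (hp : IsWeight p) {A : Ω → Prop} {B : ℝ}
    (hB : expect p (fun a => Real.exp (F a)) ≤ Real.exp B) (t : ℝ) (h : ∀ a, A a → t ≤ F a) :
    pr p A ≤ Real.exp (B - t) := by
  calc pr p A ≤ expect p fun a => Real.exp (-t) * Real.exp (F a) := by
        refine pr_le_expect hp (fun a => by positivity) fun a ha => ?_
        rw [← Real.exp_add]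
        exact Real.one_le_exp (by linarith [h a ha])
    _ = Real.exp (-t) * expect p fun a => Real.exp (F a) := expect_const_mul _
    _ ≤ Real.exp (-t) * Real.exp B := mul_le_mul_of_nonneg_left hB (Real.exp_pos _).le
    _ = _ := by rw [← Real.exp_add]; congr 1; ring

theorem hasDerivAt_expect_exp (p F : Ω → ℝ) (s : ℝ) :
    HasDerivAt (fun s => expect p fun a => Real.exp (s * F a))
      (expect p fun a => F a * Real.exp (s * F a)) s := by
  unfold expect
  refine HasDerivAt.fun_sum fun a _ => ?_
  have h1 : HasDerivAt (fun s : ℝ => Real.exp (s * F a)) (Real.exp (s * F a) * F a) s := by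
    have := ((hasDerivAt_id s).mul_const (F a)).exp
    simpa using this
  have h2 := h1.const_mul (p a)
  exact h2.congr_deriv (by ring)

/-! ### Product weights -/

theorem IsWeight.piWeight (hp : IsWeight p) (n : ℕ) : IsWeight (piWeight p n) where
  nonneg x := Finset.prod_nonneg fun i _ => hp.nonneg _
  sum_eq_one := by
    classical
    have h := (Finset.prod_univ_sum (fun _ : Fin n => (Finset.univ : Finset Ω))
      (fun _ a => p a)).symm
    simp only [Fintype.piFinset_univ] at h
    simpa [Silvan.piWeight, hp.sum_eq_one] using h

theorem expect_piWeight_prod (n : ℕ) (φ : Ω → ℝ) :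
    expect (piWeight p n) (fun x => ∏ i, φ (x i)) = (expect p φ) ^ n := by
  classical
  have h := (Finset.prod_univ_sum (fun _ : Fin n => (Finset.univ : Finset Ω))
    (fun _ a => p a * φ a)).symm
  simp only [Fintype.piFinset_univ] at h
  simpa [expect, piWeight, Finset.prod_mul_distrib] using h

theorem expect_piWeight_insertNth {n : ℕ} (k : Fin (n + 1)) (f : (Fin (n + 1) → Ω) → ℝ) :
    expect (piWeight p (n + 1)) f =
      expect p fun a => expect (piWeight p n) fun x => f (k.insertNth a x) := by
  unfold expect
  rw [← (Fin.insertNthEquiv (fun _ => Ω) k).sum_comp, Fintype.sum_prod_type]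
  refine Finset.sum_congr rfl fun a _ => ?_
  rw [Finset.mul_sum]
  refine Finset.sum_congr rfl fun x _ => ?_
  simp [piWeight, Fin.prod_univ_succAbove _ k, Fin.insertNthEquiv, mul_assoc]

theorem expect_piWeight_cons {n : ℕ} (f : (Fin (n + 1) → Ω) → ℝ) :
    expect (piWeight p (n + 1)) f =
      expect p fun a => expect (piWeight p n) fun x => f (Fin.cons a x) := by
  rw [expect_piWeight_insertNth 0]
  simp

theorem expect_piWeight_zero (f : (Fin 0 → Ω) → ℝ) : expect (piWeight p 0) f = f default := by
  simp [expect, piWeight]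

/-- Averaging over one coordinate does not change the expectation. -/
theorem expect_piWeight_update (hp : IsWeight p) {n : ℕ} (k : Fin n) (f : (Fin n → Ω) → ℝ) :
    expect (piWeight p n) f =
      expect (piWeight p n) fun x => expect p fun a => f (Function.update x k a) := by
  obtain ⟨n, rfl⟩ : ∃ n', n = n' + 1 := ⟨n - 1, by have := k.2; omega⟩
  rw [expect_piWeight_insertNth k f,
    expect_piWeight_insertNth k (fun x => expect p fun a => f (Function.update x k a))]
  simp only [Fin.update_insertNth]
  rw [expect_const hp, expect_comm]

theorem expect_piWeight_apply (hp : IsWeight p) {n : ℕ} (k : Fin n) (φ : Ω → ℝ) :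
    expect (piWeight p n) (fun x => φ (x k)) = expect p φ := by
  rw [expect_piWeight_update hp k]
  simp only [Function.update_self]
  exact expect_const (hp.piWeight n) _

theorem expect_piWeight_apply_mul_apply (hp : IsWeight p) {n : ℕ} {j k : Fin n} (h : j ≠ k)
    (φ χ : Ω → ℝ) :
    expect (piWeight p n) (fun x => φ (x j) * χ (x k)) = expect p φ * expect p χ := by
  rw [expect_piWeight_update hp k]
  simp only [Function.update_self, Function.update_of_ne h, expect_const_mul]
  rw [expect_mul_const, expect_piWeight_apply hp]

theorem expect_piWeight_sum_apply (hp : IsWeight p) (n : ℕ) (φ : Ω → ℝ) :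
    expect (piWeight p n) (fun x => ∑ k, φ (x k)) = n * expect p φ := by
  rw [expect_sum]
  simp [expect_piWeight_apply hp]

/-- The weight of an independent pair. -/
def prodWeight (p : Ω → ℝ) (q : Ω' → ℝ) (x : Ω × Ω') : ℝ := p x.1 * q x.2

theorem expect_prodWeight (q : Ω' → ℝ) (f : Ω × Ω' → ℝ) :
    expect (prodWeight p q) f = expect p fun a => expect q fun b => f (a, b) := by
  unfold expect prodWeight
  rw [Fintype.sum_prod_type]
  simp [Finset.mul_sum, mul_assoc]

theorem IsWeight.prodWeight (hp : IsWeight p) {q : Ω' → ℝ} (hq : IsWeight q) :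
    IsWeight (prodWeight p q) where
  nonneg x := mul_nonneg (hp.nonneg _) (hq.nonneg _)
  sum_eq_one := by
    have := expect_prodWeight (p := p) q fun _ => 1
    rw [expect_const hq, expect_const hp] at this
    simpa [expect] using this

end expect

/-- A comparison principle for differential inequalities of the form `H' y ≤ H y'`. -/
theorem nonpos_of_deriv_mul_le {H H' y y' : ℝ → ℝ} {b : ℝ}
    (hH : ∀ s, 0 ≤ s → HasDerivAt H (H' s) s) (hy : ∀ s, 0 ≤ s → HasDerivAt y (y' s) s)
    (hH0 : H 0 = 0) (hH'0 : H' 0 ≤ 0) (hy0 : y 0 = 0) (hy'0 : 0 < y' 0)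
    (hypos : ∀ s, 0 < s → s ≤ b → 0 < y s)
    (hle : ∀ s, 0 < s → s ≤ b → H' s * y s ≤ H s * y' s) {s : ℝ} (hs0 : 0 < s) (hsb : s ≤ b) :
    H s ≤ 0 := by
  -- `hle` says that `H / y` has a nonpositive derivative. Its limit at `0` from the right is `H' 0
  -- / y' 0 ≤ 0`, so it is nonpositive throughout.
  have hanti : AntitoneOn (fun s => H s / y s) (Set.Ioc 0 b) := by
    have hd : ∀ s ∈ Set.Ioc 0 b,
        HasDerivAt (fun s => H s / y s) ((H' s * y s - H s * y' s) / y s ^ 2) s := fun s hs =>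
      (hH s hs.1.le).fun_div (hy s hs.1.le) (hypos s hs.1 hs.2).ne'
    refine antitoneOn_of_deriv_nonpos (convex_Ioc 0 b)
      (fun s hs => (hd s hs).continuousAt.continuousWithinAt)
      (fun s hs => (hd s (interior_subset hs)).differentiableAt.differentiableWithinAt)
      fun s hs => ?_
    have hs' := interior_subset hs
    rw [(hd s hs').deriv]
    exact div_nonpos_of_nonpos_of_nonneg (by linarith [hle s hs'.1 hs'.2]) (sq_nonneg _)
  have hlim : Filter.Tendsto (fun t => H t / y t) (nhdsWithin 0 (Set.Ioi 0))
      (nhds (H' 0 / y' 0)) := by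
    have h1 := (hasDerivAt_iff_tendsto_slope_zero.1 (hH 0 le_rfl)).mono_left
      (nhdsWithin_mono 0 (fun x (hx : 0 < x) => hx.ne'))
    have h2 := (hasDerivAt_iff_tendsto_slope_zero.1 (hy 0 le_rfl)).mono_left
      (nhdsWithin_mono 0 (fun x (hx : 0 < x) => hx.ne'))
    refine (h1.div h2 hy'0.ne').congr' ?_
    filter_upwards [self_mem_nhdsWithin] with t ht
    have ht' : t ≠ 0 := ne_of_gt ht
    simp only [hH0, hy0, zero_add, sub_zero, smul_eq_mul, Pi.div_apply]
    rw [mul_div_mul_left _ _ (inv_ne_zero ht')]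
  have h3 : H s / y s ≤ H' 0 / y' 0 := by
    refine ge_of_tendsto hlim ?_
    filter_upwards [Ioo_mem_nhdsGT hs0] with t ht
    exact hanti ⟨ht.1, ht.2.le.trans hsb⟩ ⟨hs0, hsb⟩ ht.2.le
  have h4 : H s / y s ≤ 0 := h3.trans (div_nonpos_of_nonpos_of_nonneg hH'0 hy'0.le)
  have hy := hypos s hs0 hsb
  by_contra hcon
  push Not at hcon
  exact absurd h4 (not_le.2 (div_pos hcon hy))


/-! ### The modified logarithmic Sobolev inequality -/

/-- This is `log z ≤ z - 1` at `z = u * w / f`. It is the duality between entropy and exponential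
that frees the entropy bound from conditional expectations. -/
theorem mul_log_le_mul_log_div {f u w : ℝ} (hf : 0 < f) (hu : 0 < u) (hw : 0 < w) :
    f * Real.log w ≤ f * Real.log (f / u) - f + u * w := by
  have h := Real.log_le_sub_one_of_pos (div_pos (mul_pos hu hw) hf)
  rw [Real.log_div (mul_pos hu hw).ne' hf.ne', Real.log_mul hu.ne' hw.ne'] at h
  rw [Real.log_div hf.ne' hu.ne']
  have h2 := mul_le_mul_of_nonneg_left h hf.le
  have h3 : f * (u * w / f - 1) = u * w - f := by field_simp
  rw [h3] at h2
  linarith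

/-- Subadditivity of the entropy in variational form: the functions `u k` do not depend on the
`k`-th coordinate. -/
theorem entropy_le {Ω : Type*} [Fintype Ω] {p : Ω → ℝ} (hp : IsWeight p) :
    ∀ (n : ℕ) (f : (Fin n → Ω) → ℝ) (u : Fin n → (Fin n → Ω) → ℝ),
      (∀ x, 0 < f x) → (∀ k x, 0 < u k x) →
      (∀ k x a, u k (Function.update x k a) = u k x) →
      expect (piWeight p n) (fun x => f x * Real.log (f x)) -
          expect (piWeight p n) f * Real.log (expect (piWeight p n) f) ≤
        ∑ k, expect (piWeight p n) fun x => f x * Real.log (f x / u k x) - f x + u k x := by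
  intro n
  induction n with
  | zero => intro f u _ _ _; simp [expect_piWeight_zero]
  | succ n ih =>
    intro f u hf hu hind
    obtain ⟨a₀⟩ := hp.nonempty
    have hpn := hp.piWeight n
    set F : Ω → ℝ := fun a => expect (piWeight p n) fun y => f (Fin.cons a y) with hF
    have hFpos : ∀ a, 0 < F a := fun a => expect_pos hpn fun y => hf _
    have hEf : expect (piWeight p (n + 1)) f = expect p F := expect_piWeight_cons f
    have hEpos : 0 < expect p F := expect_pos hp hFpos
    rw [hEf, expect_piWeight_cons]
    have h1 : ∀ a, expect (piWeight p n) (fun y => f (Fin.cons a y) * Real.log (f (Fin.cons a y))) -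
        F a * Real.log (F a) ≤ ∑ k : Fin n, expect (piWeight p n) fun y =>
          f (Fin.cons a y) * Real.log (f (Fin.cons a y) / u k.succ (Fin.cons a y)) -
            f (Fin.cons a y) + u k.succ (Fin.cons a y) := by
      intro a
      refine ih (fun y => f (Fin.cons a y)) (fun k y => u k.succ (Fin.cons a y))
        (fun y => hf _) (fun k y => hu _ _) fun k y b => ?_
      have := hind k.succ (Fin.cons a y) b
      rwa [← Fin.cons_update] at this
    have h2 := expect_mono hp h1
    rw [expect_sub, expect_sum] at h2
    have hu0 : ∀ a y, u 0 (Fin.cons a y : Fin (n + 1) → Ω) = u 0 (Fin.cons a₀ y) := by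
      intro a y
      have := hind 0 (Fin.cons a₀ y) a
      rwa [Fin.update_cons_zero] at this
    -- Chain rule: the entropy of `f` is the mean entropy of its slices, handled by induction, plus
    -- the entropy of the slice means `F`.
    have h3 : expect p (fun a => F a * Real.log (F a)) - expect p F * Real.log (expect p F) =
        expect p fun a => expect (piWeight p n) fun y =>
          f (Fin.cons a y) * Real.log (F a / expect p F) := by
      simp only [expect_mul_const]
      rw [← expect_mul_const, ← expect_sub]
      congr 1
      funext a
      rw [Real.log_div (hFpos a).ne' hEpos.ne']
      simp only [hF]
      ring
    have h4 : expect p (fun a => expect (piWeight p n) fun y =>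
          f (Fin.cons a y) * Real.log (F a / expect p F)) ≤
        expect p fun a => expect (piWeight p n) fun y =>
          (f (Fin.cons a y) * Real.log (f (Fin.cons a y) / u 0 (Fin.cons a y)) - f (Fin.cons a y) +
            u 0 (Fin.cons a₀ y) * (F a / expect p F)) := by
      refine expect_mono hp fun a => expect_mono hpn fun y => ?_
      rw [← hu0 a y]
      exact mul_log_le_mul_log_div (hf _) (hu _ _) (div_pos (hFpos a) hEpos)
    -- Since `u 0` ignores the first coordinate, the factor `F a / expect p F` averages to `1` and
    -- disappears.
    have h5 : expect p (fun a => expect (piWeight p n) fun y =>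
          (f (Fin.cons a y) * Real.log (f (Fin.cons a y) / u 0 (Fin.cons a y)) - f (Fin.cons a y) +
            u 0 (Fin.cons a₀ y) * (F a / expect p F))) =
        expect (piWeight p (n + 1)) fun x => f x * Real.log (f x / u 0 x) - f x + u 0 x := by
      rw [expect_piWeight_cons]
      simp only [expect_add, hu0]
      congr 1
      simp only [expect_mul_const]
      rw [expect_const hp]
      simp only [div_eq_mul_inv, ← mul_assoc]
      rw [expect_mul_const, expect_const_mul, mul_assoc, mul_inv_cancel₀ hEpos.ne', mul_one]
    rw [Fin.sum_univ_succ]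
    have h6 : ∑ k : Fin n, expect (piWeight p (n + 1)) (fun x =>
        f x * Real.log (f x / u k.succ x) - f x + u k.succ x) =
        ∑ k : Fin n, expect p fun a => expect (piWeight p n) fun y =>
          f (Fin.cons a y) * Real.log (f (Fin.cons a y) / u k.succ (Fin.cons a y)) -
            f (Fin.cons a y) + u k.succ (Fin.cons a y) :=
      Finset.sum_congr rfl fun k _ => expect_piWeight_cons _
    rw [h6, ← h5]
    linarith

/-- The modified logarithmic Sobolev inequality for `exp (s Z)`. -/
theorem entropy_exp_le {Ω : Type*} [Fintype Ω] {p : Ω → ℝ} (hp : IsWeight p) {n : ℕ}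
    (Z : (Fin n → Ω) → ℝ) (Zk : Fin n → (Fin n → Ω) → ℝ)
    (hind : ∀ k x a, Zk k (Function.update x k a) = Zk k x) (s : ℝ) :
    s * expect (piWeight p n) (fun x => Z x * Real.exp (s * Z x)) -
        expect (piWeight p n) (fun x => Real.exp (s * Z x)) *
          Real.log (expect (piWeight p n) fun x => Real.exp (s * Z x)) ≤
      ∑ k, expect (piWeight p n) fun x =>
        Real.exp (s * Z x) * (Real.exp (-(s * (Z x - Zk k x))) - 1 + s * (Z x - Zk k x)) := by
  have h := entropy_le hp n (fun x => Real.exp (s * Z x)) (fun k x => Real.exp (s * Zk k x))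
    (fun x => Real.exp_pos _) (fun k x => Real.exp_pos _) (fun k x a => by rw [hind])
  have h1 : ∀ x, Real.exp (s * Z x) * Real.log (Real.exp (s * Z x)) =
      s * (Z x * Real.exp (s * Z x)) := fun x => by rw [Real.log_exp]; ring
  have h2 : ∀ k x, Real.exp (s * Z x) * Real.log (Real.exp (s * Z x) / Real.exp (s * Zk k x)) -
      Real.exp (s * Z x) + Real.exp (s * Zk k x) =
      Real.exp (s * Z x) * (Real.exp (-(s * (Z x - Zk k x))) - 1 + s * (Z x - Zk k x)) := by
    intro k x
    have h3 : Real.exp (s * Zk k x) = Real.exp (s * Z x) * Real.exp (-(s * (Z x - Zk k x))) := by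
      rw [← Real.exp_add]; congr 1; ring
    rw [← Real.exp_sub, Real.log_exp, h3]
    ring
  simp only [h1, h2, expect_const_mul] at h
  exact h


/-! ### Lower tails of self-bounding functions -/

theorem nonneg_of_hasDerivAt_nonneg {f f' : ℝ → ℝ} (h0 : f 0 = 0)
    (hd : ∀ x, HasDerivAt f (f' x) x) (hf' : ∀ x, 0 < x → 0 ≤ f' x) {x : ℝ} (hx : 0 ≤ x) :
    0 ≤ f x := by
  have hm : MonotoneOn f (Set.Ici 0) :=
    monotoneOn_of_deriv_nonneg (convex_Ici 0)
      (fun y _ => (hd y).continuousAt.continuousWithinAt)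
      (fun y _ => (hd y).differentiableAt.differentiableWithinAt)
      fun y hy => by rw [interior_Ici] at hy; rw [(hd y).deriv]; exact hf' y hy
  rw [← h0]
  exact hm Set.self_mem_Ici hx hx

/-- Differentiating in `s` reduces the claim to `exp (s u) ≤ u exp s + (1 - u)`, which is convexity
of `exp`. -/
theorem exp_mul_sub_le {s : ℝ} (hs : 0 ≤ s) {u : ℝ} (hu0 : 0 ≤ u) (hu1 : u ≤ 1) :
    Real.exp (s * u) - 1 - s * u ≤ u ^ 2 * (Real.exp s - 1 - s) := by
  have h := nonneg_of_hasDerivAt_nonneg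
    (f := fun s => u ^ 2 * (Real.exp s - 1 - s) - (Real.exp (s * u) - 1 - s * u))
    (f' := fun s => u ^ 2 * (Real.exp s - 1) - (Real.exp (s * u) * u - u)) (by simp)
    (fun x => by
      have h1 : HasDerivAt (fun s : ℝ => Real.exp (s * u)) (Real.exp (x * u) * u) x := by
        simpa using ((hasDerivAt_id x).mul_const u).exp
      have h2 := ((((Real.hasDerivAt_exp x).sub_const 1).sub (hasDerivAt_id x)).const_mul (u ^ 2)).fun_sub
        ((h1.sub_const 1).fun_sub ((hasDerivAt_id x).mul_const u))
      simpa using h2)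
    (fun x hx => by
      have h1 := convexOn_exp.2 (Set.mem_univ x) (Set.mem_univ 0) hu0 (by linarith : 0 ≤ 1 - u)
        (by ring)
      simp only [smul_eq_mul, mul_zero, add_zero, Real.exp_zero, mul_one] at h1
      rw [mul_comm u x] at h1
      nlinarith [mul_le_mul_of_nonneg_left h1 hu0])
    hs
  linarith

/-- The difference of the two sides has derivative `s (exp s - 1) ≥ 0`. This is what makes `s - a s²
/ 2` an admissible comparison function for self-bounding functions. -/
theorem one_sub_mul_exp_sub_le {s : ℝ} (hs : 0 ≤ s) :
    (1 - s) * (Real.exp s - 1 - s) ≤ s ^ 2 / 2 := by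
  have h := nonneg_of_hasDerivAt_nonneg
    (f := fun s => s ^ 2 / 2 - (1 - s) * (Real.exp s - 1 - s))
    (f' := fun s => s - (-(Real.exp s - 1 - s) + (1 - s) * (Real.exp s - 1))) (by simp)
    (fun x => by
      have h1 := ((Real.hasDerivAt_exp x).sub_const 1).sub (hasDerivAt_id x)
      have h2 := (((hasDerivAt_id x).pow 2).div_const 2).sub
        (((hasDerivAt_id x).const_sub 1).mul h1)
      refine (h2.congr_deriv ?_)
      simp)
    (fun x hx => by
      have h1 := Real.add_one_le_exp x
      have h2 := Real.add_one_le_exp (-x)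
      nlinarith [mul_nonneg hx.le (by linarith : 0 ≤ Real.exp x - 1)])
    hs
  linarith

section selfBounding

variable {Ω : Type*} [Fintype Ω] {p : Ω → ℝ} {n : ℕ} {Z : (Fin n → Ω) → ℝ}
  {Zk : Fin n → (Fin n → Ω) → ℝ} {a : ℝ}

/-- Herbst's argument for `-Z`: the entropy inequality and `hsum` give `(s + a (exp s - 1 - s)) M' ≤
M log M` for the moment generating function `M`. Multiplying by `1 - a s ≥ 0` and using `M' ≤ 0`
puts it in the form of the comparison principle with `y = s - a s² / 2`. -/
theorem expect_exp_neg_le_of_selfBounding (hp : IsWeight p)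
    (hind : ∀ k x a, Zk k (Function.update x k a) = Zk k x)
    (hZ : ∀ x, 0 ≤ Z x) (h0 : ∀ k x, 0 ≤ Z x - Zk k x) (h1 : ∀ k x, Z x - Zk k x ≤ 1)
    (ha : 1 ≤ a) (hsum : ∀ x, ∑ k, (Z x - Zk k x) ^ 2 ≤ a * Z x) {s : ℝ} (hs : 0 < s)
    (hsa : s * a ≤ 1) :
    expect (piWeight p n) (fun x => Real.exp (s * -Z x)) ≤
      Real.exp (-(s - a * s ^ 2 / 2) * expect (piWeight p n) Z) := by
  have hpn := hp.piWeight n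
  set M : ℝ → ℝ := fun s => expect (piWeight p n) fun x => Real.exp (s * -Z x) with hM
  set M' : ℝ → ℝ := fun s => expect (piWeight p n) fun x => -Z x * Real.exp (s * -Z x) with hM'
  set μ := expect (piWeight p n) Z with hμ
  have hMpos : ∀ s, 0 < M s := fun s => expect_pos hpn fun x => Real.exp_pos _
  have hMd : ∀ s, HasDerivAt M (M' s) s := fun s => hasDerivAt_expect_exp _ _ s
  have hM0 : M 0 = 1 := by simp [hM, expect_const hpn]
  have hM'0 : M' 0 = -μ := by simp [hM', expect_neg, hμ]
  have hM'neg : ∀ s, M' s ≤ 0 := fun s => by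
    have : 0 ≤ expect (piWeight p n) fun x => Z x * Real.exp (s * -Z x) :=
      expect_nonneg hpn fun x => mul_nonneg (hZ x) (Real.exp_pos _).le
    simp only [hM', neg_mul, expect_neg]
    simpa using this
  have hent : ∀ t, 0 < t → (t + a * (Real.exp t - 1 - t)) * M' t ≤ M t * Real.log (M t) := by
    intro t ht
    have h := entropy_exp_le hp (fun x => -Z x) (fun k x => -Zk k x)
      (fun k x b => by rw [hind]) t
    have hb : ∑ k, expect (piWeight p n) (fun x => Real.exp (t * -Z x) *
          (Real.exp (-(t * (-Z x - -Zk k x))) - 1 + t * (-Z x - -Zk k x))) ≤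
        -(a * (Real.exp t - 1 - t) * M' t) := by
      rw [← expect_sum]
      have : -(a * (Real.exp t - 1 - t) * M' t) = expect (piWeight p n) fun x =>
          a * (Real.exp t - 1 - t) * (Z x * Real.exp (t * -Z x)) := by
        rw [expect_const_mul]
        simp only [hM', neg_mul, expect_neg]
        ring
      rw [this]
      refine expect_mono hpn fun x => ?_
      have h3 : 0 ≤ Real.exp t - 1 - t := by linarith [Real.add_one_le_exp t]
      calc ∑ k, Real.exp (t * -Z x) *
            (Real.exp (-(t * (-Z x - -Zk k x))) - 1 + t * (-Z x - -Zk k x))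
          ≤ ∑ k, Real.exp (t * -Z x) * ((Z x - Zk k x) ^ 2 * (Real.exp t - 1 - t)) := by
            refine Finset.sum_le_sum fun k _ =>
              mul_le_mul_of_nonneg_left ?_ (Real.exp_pos _).le
            have := exp_mul_sub_le ht.le (h0 k x) (h1 k x)
            rw [show -(t * (-Z x - -Zk k x)) = t * (Z x - Zk k x) by ring]
            linarith
        _ = Real.exp (t * -Z x) * ((Real.exp t - 1 - t) * ∑ k, (Z x - Zk k x) ^ 2) := by
            rw [Finset.mul_sum, Finset.mul_sum]
            exact Finset.sum_congr rfl fun k _ => by ring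
        _ ≤ Real.exp (t * -Z x) * ((Real.exp t - 1 - t) * (a * Z x)) :=
            mul_le_mul_of_nonneg_left (mul_le_mul_of_nonneg_left (hsum x) h3) (Real.exp_pos _).le
        _ = _ := by ring
    have h4 : t * M' t - M t * Real.log (M t) ≤ -(a * (Real.exp t - 1 - t) * M' t) := h.trans hb
    linarith
  have hcmp := nonpos_of_deriv_mul_le (H := fun s => Real.log (M s) + (s - a * s ^ 2 / 2) * μ)
    (H' := fun s => M' s / M s + (1 - a * s) * μ) (y := fun s => s - a * s ^ 2 / 2)
    (y' := fun s => 1 - a * s) (b := s)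
    (fun s _ => by
      have h2 : HasDerivAt (fun s : ℝ => s - a * s ^ 2 / 2) (1 - a * s) s := by
        have := (hasDerivAt_id s).sub ((((hasDerivAt_id s).pow 2).const_mul a).div_const 2)
        refine this.congr_deriv ?_
        simp
        ring
      exact ((hMd s).log (hMpos s).ne').add (h2.mul_const μ))
    (fun s _ => by
      have := (hasDerivAt_id s).sub ((((hasDerivAt_id s).pow 2).const_mul a).div_const 2)
      refine this.congr_deriv ?_
      simp
      ring)
    (by simp [hM0]) (by simp [hM0, hM'0]) (by simp) (by simp)
    (fun t ht hts => by
      have : t * a ≤ 1 := (mul_le_mul_of_nonneg_right hts (by linarith)).trans hsa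
      nlinarith)
    (fun t ht hts => by
      have hta : t * a ≤ 1 := (mul_le_mul_of_nonneg_right hts (by linarith)).trans hsa
      have h5 := hent t ht
      have h6 : (t + a * (Real.exp t - 1 - t)) * (M' t / M t) ≤ Real.log (M t) := by
        rw [← mul_div_assoc, div_le_iff₀ (hMpos t)]
        linarith
      have h7 : M' t / M t ≤ 0 := div_nonpos_of_nonpos_of_nonneg (hM'neg t) (hMpos t).le
      have h8 : (1 - a * t) * (a * (Real.exp t - 1 - t)) ≤ a * t ^ 2 / 2 := by
        have h9 := one_sub_mul_exp_sub_le ht.le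
        have h3 : 0 ≤ Real.exp t - 1 - t := by linarith [Real.add_one_le_exp t]
        have h10 : (1 - a * t) * (Real.exp t - 1 - t) ≤ t ^ 2 / 2 := by
          refine le_trans (mul_le_mul_of_nonneg_right ?_ h3) h9
          nlinarith
        nlinarith
      have h11 : 0 ≤ 1 - a * t := by linarith
      have h12 := mul_le_mul_of_nonneg_left h6 h11
      have h13 : (M' t / M t) * ((t - a * t ^ 2 / 2) -
          (1 - a * t) * (t + a * (Real.exp t - 1 - t))) ≤ 0 :=
        mul_nonpos_of_nonpos_of_nonneg h7 (by nlinarith)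
      nlinarith)
    hs le_rfl
  have h14 : Real.log (M s) ≤ -(s - a * s ^ 2 / 2) * μ := by
    linarith
  exact (Real.log_le_iff_le_exp (hMpos s)).1 h14

/-- Squaring `μ - z ≤ √(2 l μ)` and solving the quadratic in `μ`. The shape of `varBound` and
`radBound` comes from here. -/
theorem le_add_sqrt_of_sub_sqrt_le {μ z l : ℝ} (hl : 0 ≤ l)
    (h : μ - √(2 * l * μ) ≤ z) : μ ≤ z + l + √(l ^ 2 + 2 * l * z) := by
  by_contra hcon
  push Not at hcon
  have h1 : 0 ≤ √(l ^ 2 + 2 * l * z) := Real.sqrt_nonneg _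
  have h2 : √(l ^ 2 + 2 * l * z) < μ - z - l := by linarith
  have h3 := (Real.sqrt_lt' (by linarith)).1 h2
  have h4 : μ - z ≤ √(2 * l * μ) := by linarith
  have h5 := (Real.le_sqrt' (by linarith)).1 h4
  nlinarith

/-- The lower tail of a self-bounding function. -/
theorem pr_lt_sub_sqrt_le_of_selfBounding (hp : IsWeight p)
    (hind : ∀ k x a, Zk k (Function.update x k a) = Zk k x)
    (hZ : ∀ x, 0 ≤ Z x) (h0 : ∀ k x, 0 ≤ Z x - Zk k x) (h1 : ∀ k x, Z x - Zk k x ≤ 1)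
    (ha : 1 ≤ a) (hsum : ∀ x, ∑ k, (Z x - Zk k x) ^ 2 ≤ a * Z x) {L : ℝ} (hL : 0 < L) :
    pr (piWeight p n) (fun x => Z x < expect (piWeight p n) Z -
      √(2 * (a * L) * expect (piWeight p n) Z)) ≤ Real.exp (-L) := by
  have hpn := hp.piWeight n
  set μ := expect (piWeight p n) Z with hμ
  have hμ0 : 0 ≤ μ := expect_nonneg hpn hZ
  by_cases hc : 2 * (a * L) ≤ μ
  · have haL : 0 < a * L := by positivity
    have hμpos : 0 < μ := by linarith
    -- The minimizer of the Chernoff exponent. The case assumption `2 a L ≤ μ` is exactly the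
    -- constraint `s * a ≤ 1`.
    set s := √(2 * L / (a * μ)) with hs
    have hs0 : 0 < s := Real.sqrt_pos.2 (by positivity)
    have hs2 : s ^ 2 = 2 * L / (a * μ) := Real.sq_sqrt (by positivity)
    have hsa : s * a ≤ 1 := by
      rw [← abs_of_pos (by positivity : 0 < s * a), ← sq_le_one_iff_abs_le_one, mul_pow, hs2,
        div_mul_eq_mul_div, div_le_one (by positivity)]
      nlinarith
    have hsq : √(2 * (a * L) * μ) = s * (a * μ) := by
      rw [Real.sqrt_eq_iff_mul_self_eq (by positivity) (by positivity)]
      have : s * (a * μ) * (s * (a * μ)) = s ^ 2 * (a * μ) ^ 2 := by ring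
      rw [this, hs2]
      field_simp
    have hmgf := expect_exp_neg_le_of_selfBounding hp hind hZ h0 h1 ha hsum hs0 hsa
    rw [hsq]
    refine (pr_le_exp hpn hmgf (-(s * (μ - s * (a * μ)))) fun x hx => ?_).trans_eq ?_
    · have := mul_le_mul_of_nonneg_left hx.le hs0.le
      linarith
    · congr 1
      rw [← hμ]
      have : -(s - a * s ^ 2 / 2) * μ - -(s * (μ - s * (a * μ))) = - (s ^ 2 * (a * μ) / 2) := by ring
      rw [this, hs2]
      field_simp
  -- Here the threshold is nonpositive, so a nonnegative `Z` cannot be below it.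
  · push Not at hc
    rw [pr_eq_zero]
    · positivity
    · intro x _ hx
      have h2 : μ ≤ √(2 * (a * L) * μ) := by
        apply Real.le_sqrt_of_sq_le
        nlinarith
      linarith [hZ x]

/-- An upper confidence bound for the expectation of a self-bounding function. -/
theorem pr_add_sqrt_lt_le_of_selfBounding (hp : IsWeight p)
    (hind : ∀ k x a, Zk k (Function.update x k a) = Zk k x)
    (hZ : ∀ x, 0 ≤ Z x) (h0 : ∀ k x, 0 ≤ Z x - Zk k x) (h1 : ∀ k x, Z x - Zk k x ≤ 1)
    (ha : 1 ≤ a) (hsum : ∀ x, ∑ k, (Z x - Zk k x) ^ 2 ≤ a * Z x) {L : ℝ} (hL : 0 < L) :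
    pr (piWeight p n) (fun x => Z x + a * L + √((a * L) ^ 2 + 2 * (a * L) * Z x) <
      expect (piWeight p n) Z) ≤ Real.exp (-L) := by
  refine (pr_mono (hp.piWeight n) fun x hx => ?_).trans
    (pr_lt_sub_sqrt_le_of_selfBounding hp hind hZ h0 h1 ha hsum hL)
  by_contra hcon
  push Not at hcon
  have := le_add_sqrt_of_sub_sqrt_le (by positivity) hcon
  linarith

end selfBounding

/-- An upper confidence bound for the mean of a `[0, 1]`-valued function. -/
theorem pr_sum_add_sqrt_lt_le {Ω : Type*} [Fintype Ω] {p : Ω → ℝ} (hp : IsWeight p) (n : ℕ)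
    {g : Ω → ℝ} (hg0 : ∀ a, 0 ≤ g a) (hg1 : ∀ a, g a ≤ 1) {L : ℝ} (hL : 0 < L) :
    pr (piWeight p n) (fun x => ∑ k, g (x k) + L + √(L ^ 2 + 2 * L * ∑ k, g (x k)) <
      n * expect p g) ≤ Real.exp (-L) := by
  -- Deleting a term lowers the sum by `g (x k) ∈ [0, 1]`, whose square is at most itself; hence `a
  -- = 1`.
  have h := pr_add_sqrt_lt_le_of_selfBounding (n := n) (Z := fun x => ∑ k, g (x k))
    (Zk := fun k x => ∑ i ∈ Finset.univ.erase k, g (x i)) (a := 1) hp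
    (fun k x b => Finset.sum_congr rfl fun i hi => by
      rw [Function.update_of_ne (Finset.ne_of_mem_erase hi)])
    (fun x => Finset.sum_nonneg fun k _ => hg0 _)
    (fun k x => by rw [Finset.sum_erase_eq_sub (Finset.mem_univ k)]; simpa using hg0 _)
    (fun k x => by rw [Finset.sum_erase_eq_sub (Finset.mem_univ k)]; simpa using hg1 _)
    le_rfl
    (fun x => by
      rw [one_mul]
      refine Finset.sum_le_sum fun k _ => ?_
      rw [Finset.sum_erase_eq_sub (Finset.mem_univ k)]
      nlinarith [hg0 (x k), hg1 (x k)]) hL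
  simpa only [one_mul, expect_piWeight_sum_apply hp] using h


/-! ### Bousquet's inequality for the supremum of an empirical process -/

/-- The difference is an exponential times a quadratic plus a quadratic; it is shown nonnegative by
integrating three times from `0`. It gives the sign of a second derivative at `0` in
`exp_mul_sub_le_bousquet`. -/
theorem sq_mul_le_bousquet {l : ℝ} (hl : 0 ≤ l) :
    l ^ 2 * (2 * Real.exp l - 1) ≤ 2 * (1 + 2 * l) * (l * Real.exp l - Real.exp l + 1) := by
  have hd : ∀ (a b c d e g : ℝ) (x : ℝ), HasDerivAt
      (fun x : ℝ => Real.exp x * (a * x ^ 2 + b * x + c) + (d * x ^ 2 + e * x + g))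
      (Real.exp x * (a * x ^ 2 + (b + 2 * a) * x + (c + b)) + (0 * x ^ 2 + 2 * d * x + e)) x := by
    intro a b c d e g x
    have hq : ∀ a b c : ℝ, HasDerivAt (fun x : ℝ => a * x ^ 2 + b * x + c) (2 * a * x + b) x := by
      intro a b c
      have := ((((hasDerivAt_id x).fun_pow 2).const_mul a).fun_add
        ((hasDerivAt_id x).const_mul b)).add_const c
      refine this.congr_deriv ?_
      simp
      ring
    refine (((Real.hasDerivAt_exp x).fun_mul (hq a b c)).fun_add (hq d e g)).congr_deriv ?_
    ring
  have h3 : ∀ x : ℝ, 0 < x → 0 ≤ Real.exp x * (2 * x ^ 2 + (6 + 2 * 2) * x + (-2 + 6)) +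
      (0 * x ^ 2 + 2 * 0 * x + 0) := fun x hx => by
    have := Real.exp_pos x
    rw [show (0 * x ^ 2 + 2 * 0 * x + 0 : ℝ) = 0 by ring, add_zero]
    exact mul_nonneg this.le (by nlinarith)
  have h2 : ∀ x : ℝ, 0 ≤ x → 0 ≤ Real.exp x * (2 * x ^ 2 + 6 * x + -2) +
      (0 * x ^ 2 + 0 * x + 2) := fun x hx =>
    nonneg_of_hasDerivAt_nonneg (by simp) (hd 2 6 (-2) 0 0 2) h3 hx
  have h1 : ∀ x : ℝ, 0 ≤ x → 0 ≤ Real.exp x * (2 * x ^ 2 + 2 * x + -4) +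
      (0 * x ^ 2 + 2 * x + 4) := fun x hx =>
    nonneg_of_hasDerivAt_nonneg (by simp) (hd 2 2 (-4) 0 2 4)
      (fun y hy => (h2 y hy.le).trans_eq (by ring)) hx
  have h0 : 0 ≤ Real.exp l * (2 * l ^ 2 + (-2) * l + -2) + (1 * l ^ 2 + 4 * l + 2) :=
    nonneg_of_hasDerivAt_nonneg (by simp) (hd 2 (-2) (-2) 1 4 2)
      (fun y hy => (h1 y hy.le).trans_eq (by ring)) hl
  nlinarith

/-- The left side is the entropy integrand divided by `exp (l Zk)`, with `v = Z - Zk`. The constant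
is chosen for equality at `v = 1`. The difference `D` vanishes to first order at `0`, and `D'' = exp
(l w) q w` with `q` decreasing and `q 0 ≥ 0`. So `D` is convex on the negative axis, while on `[0,
1]` it can pass only from convex to concave, and `D 1 = 0`. -/
theorem exp_mul_sub_le_bousquet {l v : ℝ} (hl : 0 < l) (hv : v ≤ 1) :
    1 - Real.exp (l * v) + l * v * Real.exp (l * v) ≤
      (l * Real.exp l - Real.exp l + 1) / (2 * Real.exp l - 1) *
        (2 * v * Real.exp (l * v) + v ^ 2 - 2 * v) := by
  have hE : l + 1 ≤ Real.exp l := Real.add_one_le_exp l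
  have hden : 0 < 2 * Real.exp l - 1 := by linarith
  set c := (l * Real.exp l - Real.exp l + 1) / (2 * Real.exp l - 1) with hc
  have hc' : c * (2 * Real.exp l - 1) = l * Real.exp l - Real.exp l + 1 :=
    div_mul_cancel₀ _ hden.ne'
  have hc0 : 0 ≤ c := by
    refine div_nonneg ?_ hden.le
    have := one_sub_mul_exp_sub_le hl.le
    have h2 := Real.add_one_le_exp (-l)
    have h3 : Real.exp l * Real.exp (-l) = 1 := by rw [← Real.exp_add]; simp
    nlinarith [Real.exp_pos l]
  have hc1 : 0 ≤ l - 2 * c := by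
    by_contra h
    push Not at h
    nlinarith
  have hq0 : 0 ≤ (4 * l * c - l ^ 2) + 2 * c := by
    have h := sq_mul_le_bousquet hl.le
    rw [← hc'] at h
    have : l ^ 2 * (2 * Real.exp l - 1) ≤ (2 * (1 + 2 * l) * c) * (2 * Real.exp l - 1) := by
      linarith
    have := le_of_mul_le_mul_right this hden
    linarith
  let q : ℝ → ℝ := fun w => (4 * l * c - l ^ 2) - l ^ 2 * (l - 2 * c) * w + 2 * c * Real.exp (-(l * w))
  have hqanti : Antitone q := by
    intro w w' hw
    have h1 : Real.exp (-(l * w')) ≤ Real.exp (-(l * w)) :=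
      Real.exp_le_exp.2 (by nlinarith)
    have h2 : l ^ 2 * (l - 2 * c) * w ≤ l ^ 2 * (l - 2 * c) * w' :=
      mul_le_mul_of_nonneg_left hw (by positivity)
    have h3 : 2 * c * Real.exp (-(l * w')) ≤ 2 * c * Real.exp (-(l * w)) :=
      mul_le_mul_of_nonneg_left h1 (by positivity)
    simp only [q]
    linarith
  let D : ℝ → ℝ := fun w => c * (2 * w * Real.exp (l * w) + w ^ 2 - 2 * w) -
    (1 - Real.exp (l * w) + l * w * Real.exp (l * w))
  let D1 : ℝ → ℝ := fun w => c * (2 * Real.exp (l * w) + 2 * l * w * Real.exp (l * w) + 2 * w - 2) -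
    l ^ 2 * w * Real.exp (l * w)
  let D2 : ℝ → ℝ := fun w => Real.exp (l * w) * q w
  have hexp : ∀ w, HasDerivAt (fun w : ℝ => Real.exp (l * w)) (l * Real.exp (l * w)) w := by
    intro w
    have := ((hasDerivAt_id w).const_mul l).exp
    refine this.congr_deriv ?_
    simp
    ring
  have hD : ∀ w, HasDerivAt D (D1 w) w := by
    intro w
    have hid := hasDerivAt_id w
    have hwe := hid.fun_mul (hexp w)
    have h1 := (((hwe.const_mul 2).fun_add (hid.fun_pow 2)).fun_sub (hid.const_mul 2)).const_mul c
    have h2 := ((hexp w).const_sub 1).fun_add (hwe.const_mul l)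
    have h3 := h1.fun_sub h2
    refine (h3.congr_deriv ?_).congr_of_eventuallyEq (Filter.Eventually.of_forall fun w => ?_)
    · simp [D1]
      ring
    · simp [D]
      ring
  have hD1 : ∀ w, HasDerivAt D1 (D2 w) w := by
    intro w
    have hid := hasDerivAt_id w
    have hwe := hid.fun_mul (hexp w)
    have h1 := (((((hexp w).const_mul 2).fun_add (hwe.const_mul (2 * l))).fun_add
      (hid.const_mul 2)).sub_const 2).const_mul c
    have h3 := h1.fun_sub (hwe.const_mul (l ^ 2))
    refine (h3.congr_deriv ?_).congr_of_eventuallyEq (Filter.Eventually.of_forall fun w => ?_)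
    · have : Real.exp (l * w) * Real.exp (-(l * w)) = 1 := by rw [← Real.exp_add]; simp
      simp [D2, q]
      linear_combination -2 * c * this
    · simp [D1]
      ring
  have hD0 : D 0 = 0 := by simp [D]
  have hD10 : D1 0 = 0 := by simp [D1]
  have hDone : D 1 = 0 := by
    simp only [D, mul_one]
    linear_combination hc'
  suffices h : 0 ≤ D v by
    simp only [D] at h
    linarith
  rcases le_or_gt v 0 with hv0 | hv0
  · have hD1mono : MonotoneOn D1 (Set.Iic 0) :=
      monotoneOn_of_deriv_nonneg (convex_Iic 0)
        (fun y _ => (hD1 y).continuousAt.continuousWithinAt)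
        (fun y _ => (hD1 y).differentiableAt.differentiableWithinAt)
        fun y hy => by
          rw [interior_Iic] at hy
          rw [(hD1 y).deriv]
          refine mul_nonneg (Real.exp_pos _).le ?_
          refine le_trans ?_ (hqanti (le_of_lt hy))
          simpa [q] using hq0
    have hDanti : AntitoneOn D (Set.Iic 0) :=
      antitoneOn_of_deriv_nonpos (convex_Iic 0)
        (fun y _ => (hD y).continuousAt.continuousWithinAt)
        (fun y _ => (hD y).differentiableAt.differentiableWithinAt)
        fun y hy => by
          rw [interior_Iic] at hy
          rw [(hD y).deriv, ← hD10]
          exact hD1mono (Set.Iio_subset_Iic_self hy) Set.self_mem_Iic (le_of_lt hy)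
    rw [← hD0]
    exact hDanti hv0 Set.self_mem_Iic hv0
  -- A negative value of `D` forces `D' < 0` at some `ξ < v` and `q < 0` before `ξ`. From then on
  -- `D'` decreases and stays negative, so `D` could not climb back to `0` at `1`.
  · by_contra hneg
    push Not at hneg
    have hv1 : v < 1 := lt_of_le_of_ne hv fun h => by rw [h, hDone] at hneg; exact lt_irrefl _ hneg
    obtain ⟨ξ, hξ, hξe⟩ := exists_hasDerivAt_eq_slope D D1 hv0
      (fun y _ => (hD y).continuousAt.continuousWithinAt) (fun y _ => hD y)
    have hξneg : D1 ξ < 0 := by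
      rw [hξe, hD0, sub_zero, sub_zero]
      exact div_neg_of_neg_of_pos hneg hv0
    obtain ⟨η, hη, hηe⟩ := exists_hasDerivAt_eq_slope D1 D2 hξ.1
      (fun y _ => (hD1 y).continuousAt.continuousWithinAt) (fun y _ => hD1 y)
    have hηneg : q η < 0 := by
      have : D2 η < 0 := by
        rw [hηe, hD10, sub_zero, sub_zero]
        exact div_neg_of_neg_of_pos hξneg hξ.1
      exact neg_of_mul_neg_right this (Real.exp_pos _).le
    obtain ⟨ζ, hζ, hζe⟩ := exists_hasDerivAt_eq_slope D D1 hv1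
      (fun y _ => (hD y).continuousAt.continuousWithinAt) (fun y _ => hD y)
    have hD1anti : AntitoneOn D1 (Set.Ici η) :=
      antitoneOn_of_deriv_nonpos (convex_Ici η)
        (fun y _ => (hD1 y).continuousAt.continuousWithinAt)
        (fun y _ => (hD1 y).differentiableAt.differentiableWithinAt)
        fun y hy => by
          rw [interior_Ici] at hy
          rw [(hD1 y).deriv]
          exact mul_nonpos_of_nonneg_of_nonpos (Real.exp_pos _).le
            ((hqanti (le_of_lt hy)).trans hηneg.le)
    have h1 : D1 ζ ≤ D1 ξ := hD1anti hη.2.le (hη.2.trans (hξ.2.trans hζ.1)).le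
      (hξ.2.trans hζ.1).le
    rw [hζe, hDone, zero_sub] at h1
    have h2 : 0 < -D v / (1 - v) := div_pos (by linarith) (by linarith)
    linarith

/-- For `l < 3` this reads `exp l - 1 - l ≤ l² / (2 (1 - l / 3))`, the classical estimate behind
Bernstein's form of the tail. -/
theorem exp_sub_mul_le {l : ℝ} (hl : 0 ≤ l) :
    (Real.exp l - 1 - l) * (6 - 2 * l) ≤ 3 * l ^ 2 := by
  have hd : ∀ x, HasDerivAt (fun x : ℝ => 3 * x ^ 2 - (Real.exp x - 1 - x) * (6 - 2 * x))
      (2 * x + 4 - 4 * Real.exp x + 2 * x * Real.exp x) x := by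
    intro x
    have hid := hasDerivAt_id x
    have h := ((hid.fun_pow 2).const_mul 3).fun_sub
      ((((Real.hasDerivAt_exp x).sub_const 1).fun_sub hid).fun_mul ((hid.const_mul 2).const_sub 6))
    refine h.congr_deriv ?_
    simp
    ring
  have hd2 : ∀ x, HasDerivAt (fun x : ℝ => 2 * x + 4 - 4 * Real.exp x + 2 * x * Real.exp x)
      (2 - 2 * Real.exp x + 2 * x * Real.exp x) x := by
    intro x
    have hid := hasDerivAt_id x
    have h := (((hid.const_mul 2).add_const 4).fun_sub ((Real.hasDerivAt_exp x).const_mul 4)).fun_add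
      ((hid.const_mul 2).fun_mul (Real.hasDerivAt_exp x))
    refine h.congr_deriv ?_
    simp
    ring
  have h := nonneg_of_hasDerivAt_nonneg (by simp) hd (fun x hx =>
    nonneg_of_hasDerivAt_nonneg (by simp) hd2 (fun y hy => by
      have h2 := Real.add_one_le_exp (-y)
      have h3 : Real.exp y * Real.exp (-y) = 1 := by rw [← Real.exp_add]; simp
      nlinarith [Real.exp_pos y]) hx.le) hl
  linarith

/-- The exponent in Bennett's inequality is at least the exponent in Bernstein's inequality. -/
theorem exists_bernstein_exponent {v L : ℝ} (hv : 0 ≤ v) (hL : 0 < L) :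
    ∃ l : ℝ, 0 < l ∧ v * (Real.exp l - 1 - l) - l * (√(2 * v * L) + L / 3) ≤ -L := by
  rcases hv.eq_or_lt with rfl | hv
  · refine ⟨3, by norm_num, ?_⟩
    simp
    linarith
  · set r := √(2 * L / v) with hr
    have hr0 : 0 < r := Real.sqrt_pos.2 (by positivity)
    have hr2 : r ^ 2 = 2 * L / v := Real.sq_sqrt (by positivity)
    have hL' : L = v * r ^ 2 / 2 := by rw [hr2]; field_simp
    have hs : √(2 * v * L) = v * r := by
      rw [Real.sqrt_eq_iff_mul_self_eq (by positivity) (by positivity), hL']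
      ring
    -- With this choice `l² / (2 (1 - l / 3)) = l r / 2`, so the bound on `exp l - 1 - l` becomes
    -- linear in `l`.
    refine ⟨r / (1 + r / 3), by positivity, ?_⟩
    set l := r / (1 + r / 3) with hl
    have hl0 : 0 < l := by positivity
    have hlr : l * (1 + r / 3) = r := div_mul_cancel₀ _ (by positivity)
    have h1 := exp_sub_mul_le hl0.le
    have h2 : Real.exp l - 1 - l ≤ l * r / 2 := by
      have h3 : 6 - 2 * l = 6 / (1 + r / 3) := by
        rw [hl]; field_simp; ring
      have h4 : 3 * l ^ 2 = l * r / 2 * (6 - 2 * l) := by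
        rw [h3, hl]; field_simp; ring
      rw [h4] at h1
      exact le_of_mul_le_mul_right h1 (by rw [h3]; positivity)
    rw [hs]
    have h5 : l * (v * r + L / 3) = l * (v * r / 2) + v * r ^ 2 / 2 := by
      rw [hL']
      linear_combination (v * r / 2) * hlr
    rw [h5]
    nlinarith [mul_le_mul_of_nonneg_left h2 hv.le]

section bousquet

variable {Ω : Type*} [Fintype Ω] {p : Ω → ℝ} {ι : Type*} [Finite ι] [Nonempty ι]
  {X : ι → Ω → ℝ} {ν : ℝ}

theorem expect_iSup_sum_nonneg (hp : IsWeight p) (n : ℕ) (h0 : ∀ v, expect p (X v) = 0) :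
    0 ≤ expect (piWeight p n) fun x => ⨆ v, ∑ k, X v (x k) := by
  have h := ciSup_expect_le (hp.piWeight n) fun v (x : Fin n → Ω) => ∑ k, X v (x k)
  simpa [expect_piWeight_sum_apply hp, h0] using h

/-- **Bousquet's inequality**, exponential form. -/
theorem expect_exp_iSup_le (hp : IsWeight p) (n : ℕ) (h0 : ∀ v, expect p (X v) = 0)
    (h1 : ∀ v a, X v a ≤ 1) (hν : ∀ v, expect p (fun a => X v a ^ 2) ≤ ν) {l : ℝ} (hl : 0 < l) :
    expect (piWeight p n) (fun x => Real.exp (l * ⨆ v, ∑ k, X v (x k))) ≤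
      Real.exp (l * expect (piWeight p n) (fun x => ⨆ v, ∑ k, X v (x k)) +
        (n * ν + 2 * expect (piWeight p n) (fun x => ⨆ v, ∑ k, X v (x k))) *
          (Real.exp l - 1 - l)) := by
  have hpn := hp.piWeight n
  set Z : (Fin n → Ω) → ℝ := fun x => ⨆ v, ∑ k, X v (x k) with hZ
  set μ := expect (piWeight p n) Z with hμ
  let Zk : Fin n → (Fin n → Ω) → ℝ := fun k x => ⨆ v, ∑ i ∈ Finset.univ.erase k, X v (x i)
  have hbdd : ∀ g : ι → ℝ, BddAbove (Set.range g) := fun g => (Set.finite_range g).bddAbove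
  choose sel hsel using fun g : ι → ℝ => exists_eq_ciSup_of_finite (f := g)
  -- The maximizer of the sum without the `k`-th term does not depend on `x k`. Given the other
  -- coordinates, `Y k` is therefore one fixed centred function evaluated at `x k`, with second
  -- moment at most `ν`.
  let Y : Fin n → (Fin n → Ω) → ℝ := fun k x =>
    X (sel fun v => ∑ i ∈ Finset.univ.erase k, X v (x i)) (x k)
  have herase : ∀ k (x : Fin n → Ω) a v, ∑ i ∈ Finset.univ.erase k, X v (Function.update x k a i) =
      ∑ i ∈ Finset.univ.erase k, X v (x i) := fun k x a v =>
    Finset.sum_congr rfl fun i hi => by rw [Function.update_of_ne (Finset.ne_of_mem_erase hi)]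
  have hind : ∀ k x a, Zk k (Function.update x k a) = Zk k x := by
    intro k x a
    simp only [Zk, herase]
  have hYle : ∀ k x, Y k x ≤ Z x - Zk k x := by
    intro k x
    have h2 := hsel fun v => ∑ i ∈ Finset.univ.erase k, X v (x i)
    have h3 := le_ciSup (hbdd fun v => ∑ k, X v (x k))
      (sel fun v => ∑ i ∈ Finset.univ.erase k, X v (x i))
    rw [← Finset.sum_erase_add _ _ (Finset.mem_univ k)] at h3
    have h4 : Zk k x = ∑ i ∈ Finset.univ.erase k,
      X (sel fun v => ∑ i ∈ Finset.univ.erase k, X v (x i)) (x i) := h2.symm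
    simp only [Y, hZ]
    linarith
  have hVle : ∀ x, ∃ v, Z x = ∑ k, X v (x k) ∧ ∀ k, Z x - Zk k x ≤ X v (x k) := by
    intro x
    refine ⟨sel fun v => ∑ k, X v (x k), (hsel fun v => ∑ k, X v (x k)).symm, fun k => ?_⟩
    have h2 := hsel fun v => ∑ k, X v (x k)
    simp only at h2
    rw [← Finset.sum_erase_add _ _ (Finset.mem_univ k)] at h2
    have h3 := le_ciSup (hbdd fun v => ∑ i ∈ Finset.univ.erase k, X v (x i))
      (sel fun v => ∑ k, X v (x k))
    simp only [hZ, Zk]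
    linarith
  have hVone : ∀ k x, Z x - Zk k x ≤ 1 := by
    intro k x
    obtain ⟨v, -, hv⟩ := hVle x
    exact (hv k).trans (h1 _ _)
  have hVsum : ∀ x, ∑ k, (Z x - Zk k x) ≤ Z x := by
    intro x
    obtain ⟨v, hv, hv'⟩ := hVle x
    exact (Finset.sum_le_sum fun k _ => hv' k).trans_eq hv.symm
  have hEY : ∀ k (l : ℝ), expect (piWeight p n) (fun x => Real.exp (l * Zk k x) * Y k x) = 0 := by
    intro k l
    rw [expect_piWeight_update hp k]
    simp only [hind, Y, herase, Function.update_self, expect_const_mul, h0, mul_zero]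
    exact expect_const hpn 0
  have hEY2 : ∀ k (l : ℝ), expect (piWeight p n) (fun x => Real.exp (l * Zk k x) * Y k x ^ 2) ≤
      ν * expect (piWeight p n) (fun x => Real.exp (l * Zk k x)) := by
    intro k l
    rw [expect_piWeight_update hp k, ← expect_const_mul]
    refine expect_mono hpn fun x => ?_
    simp only [hind, Y, herase, Function.update_self, expect_const_mul]
    rw [mul_comm]
    exact mul_le_mul_of_nonneg_right (hν _) (Real.exp_pos _).le
  have hν0 : 0 ≤ ν := by
    obtain ⟨v⟩ := ‹Nonempty ι›
    exact (expect_nonneg hp fun a => sq_nonneg _).trans (hν v)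
  -- Adding the mean-zero term `l * exp (l Zk) * Y k` costs nothing, and `1 + l Y k ≤ 1 + l (Z - Zk)
  -- ≤ exp (l (Z - Zk))`.
  have hEZk : ∀ k (l : ℝ), 0 < l → expect (piWeight p n) (fun x => Real.exp (l * Zk k x)) ≤
      expect (piWeight p n) (fun x => Real.exp (l * Z x)) := by
    intro k l hl
    have h2 : expect (piWeight p n) (fun x => Real.exp (l * Zk k x)) =
        expect (piWeight p n) (fun x => Real.exp (l * Zk k x) + l * (Real.exp (l * Zk k x) * Y k x)) := by
      rw [expect_add, expect_const_mul, hEY, mul_zero, add_zero]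
    rw [h2]
    refine expect_mono hpn fun x => ?_
    have h3 : Real.exp (l * Z x) = Real.exp (l * Zk k x) * Real.exp (l * (Z x - Zk k x)) := by
      rw [← Real.exp_add]; congr 1; ring
    rw [h3]
    have h4 := Real.add_one_le_exp (l * (Z x - Zk k x))
    have h5 := mul_le_mul_of_nonneg_left (hYle k x) hl.le
    nlinarith [Real.exp_pos (l * Zk k x)]
  set M : ℝ → ℝ := fun s => expect (piWeight p n) fun x => Real.exp (s * Z x) with hM
  set M' : ℝ → ℝ := fun s => expect (piWeight p n) fun x => Z x * Real.exp (s * Z x) with hM'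
  have hMpos : ∀ s, 0 < M s := fun s => expect_pos hpn fun x => Real.exp_pos _
  have hMd : ∀ s, HasDerivAt M (M' s) s := fun s => hasDerivAt_expect_exp _ _ s
  have hM0 : M 0 = 1 := by simp [hM, expect_const hpn]
  have hM'0 : M' 0 = μ := by simp [hM', hμ]
  have hent : ∀ t, 0 < t → t * M' t - M t * Real.log (M t) ≤
      (t * Real.exp t - Real.exp t + 1) / (2 * Real.exp t - 1) * (2 * M' t + n * ν * M t) := by
    intro t ht
    have h := entropy_exp_le hp Z Zk hind t
    set c := (t * Real.exp t - Real.exp t + 1) / (2 * Real.exp t - 1) with hc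
    have hc0 : 0 ≤ c := by
      have h2 := Real.add_one_le_exp (-t)
      have h3 : Real.exp t * Real.exp (-t) = 1 := by rw [← Real.exp_add]; simp
      refine div_nonneg (by nlinarith [Real.exp_pos t]) (by linarith [Real.add_one_le_exp t])
    refine h.trans ?_
    have hk : ∀ k, expect (piWeight p n) (fun x => Real.exp (t * Z x) *
          (Real.exp (-(t * (Z x - Zk k x))) - 1 + t * (Z x - Zk k x))) ≤
        c * (2 * expect (piWeight p n) (fun x => (Z x - Zk k x) * Real.exp (t * Z x)) + ν * M t) := by
      intro k
      have h2 : ∀ x, Real.exp (t * Z x) *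
          (Real.exp (-(t * (Z x - Zk k x))) - 1 + t * (Z x - Zk k x)) ≤
          c * (2 * ((Z x - Zk k x) * Real.exp (t * Z x)) + (Real.exp (t * Zk k x) * Y k x ^ 2 -
            2 * (Real.exp (t * Zk k x) * Y k x))) := by
        intro x
        have h3 : Real.exp (t * Z x) = Real.exp (t * Zk k x) * Real.exp (t * (Z x - Zk k x)) := by
          rw [← Real.exp_add]; congr 1; ring
        have h4 := exp_mul_sub_le_bousquet ht (hVone k x)
        rw [← hc] at h4
        set V := Z x - Zk k x with hV
        have h5 : Real.exp (t * V) * Real.exp (-(t * V)) = 1 := by rw [← Real.exp_add]; simp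
        -- `t ↦ t² - 2 t` decreases on `(-∞, 1]` and `Y k x ≤ V ≤ 1`; this is why the pointwise
        -- inequality was arranged with `v² - 2 v`.
        have h6 : V ^ 2 - 2 * V ≤ Y k x ^ 2 - 2 * Y k x := by
          nlinarith [hYle k x, hVone k x]
        have h7 : c * (2 * V * Real.exp (t * V) + V ^ 2 - 2 * V) ≤
            c * (2 * V * Real.exp (t * V) + (Y k x ^ 2 - 2 * Y k x)) :=
          mul_le_mul_of_nonneg_left (by linarith) hc0
        have h8 := mul_le_mul_of_nonneg_left (h4.trans h7) (Real.exp_pos (t * Zk k x)).le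
        rw [h3]
        have h9 : Real.exp (t * Zk k x) * Real.exp (t * V) * (Real.exp (-(t * V)) - 1 + t * V) =
            Real.exp (t * Zk k x) * (1 - Real.exp (t * V) + t * V * Real.exp (t * V)) := by
          linear_combination Real.exp (t * Zk k x) * h5
        rw [h9]
        refine h8.trans_eq (by ring)
      refine (expect_mono hpn h2).trans ?_
      rw [expect_const_mul, expect_add, expect_const_mul, expect_sub, expect_const_mul, hEY]
      refine mul_le_mul_of_nonneg_left ?_ hc0
      have h10 := (hEY2 k t).trans (mul_le_mul_of_nonneg_left (hEZk k t ht) hν0)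
      simp only [hM]
      linarith
    refine (Finset.sum_le_sum fun k _ => hk k).trans ?_
    rw [← Finset.mul_sum, Finset.sum_add_distrib, ← Finset.mul_sum, ← expect_sum]
    refine mul_le_mul_of_nonneg_left ?_ hc0
    have h11 : expect (piWeight p n) (fun x => ∑ k, (Z x - Zk k x) * Real.exp (t * Z x)) ≤ M' t :=
      expect_mono hpn fun x => by
        rw [← Finset.sum_mul]
        exact mul_le_mul_of_nonneg_right (hVsum x) (Real.exp_pos _).le
    simp only [Finset.sum_const, Finset.card_univ, Fintype.card_fin, nsmul_eq_mul]
    linarith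
  -- Multiplying the entropy inequality by `2 exp t - 1` leaves the coefficient `2 exp t - 2 - t` on
  -- `M' / M`. This is an antiderivative of `2 exp t - 1`, hence the choice of `y`.
  have hcmp := nonpos_of_deriv_mul_le
    (H := fun s => Real.log (M s) - (s * μ + (n * ν + 2 * μ) * (Real.exp s - 1 - s)))
    (H' := fun s => M' s / M s - (μ + (n * ν + 2 * μ) * (Real.exp s - 1)))
    (y := fun s => 2 * Real.exp s - 2 - s) (y' := fun s => 2 * Real.exp s - 1) (b := l)
    (fun s _ => by
      have h2 := ((hasDerivAt_id s).mul_const μ).fun_add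
        ((((Real.hasDerivAt_exp s).sub_const 1).fun_sub (hasDerivAt_id s)).const_mul (n * ν + 2 * μ))
      refine (((hMd s).log (hMpos s).ne').fun_sub h2).congr_deriv ?_
      simp)
    (fun s _ => (((Real.hasDerivAt_exp s).const_mul 2).sub_const 2).fun_sub (hasDerivAt_id s))
    (by simp [hM0]) (by simp [hM0, hM'0]) (by simp) (by norm_num)
    (fun t ht _ => by linarith [Real.add_one_le_exp t])
    (fun t ht _ => by
      have hE := Real.add_one_le_exp t
      have hden : 0 < 2 * Real.exp t - 1 := by linarith
      have h2 := hent t ht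
      set c := (t * Real.exp t - Real.exp t + 1) / (2 * Real.exp t - 1) with hc
      have hc' : c * (2 * Real.exp t - 1) = t * Real.exp t - Real.exp t + 1 :=
        div_mul_cancel₀ _ hden.ne'
      have h3 : t * (M' t / M t) - Real.log (M t) ≤ c * (2 * (M' t / M t) + n * ν) := by
        have h4 := div_le_div_of_nonneg_right h2 (hMpos t).le
        have h5 : (t * M' t - M t * Real.log (M t)) / M t = t * (M' t / M t) - Real.log (M t) := by
          field_simp [(hMpos t).ne']
        have h6 : c * (2 * M' t + n * ν * M t) / M t = c * (2 * (M' t / M t) + n * ν) := by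
          field_simp [(hMpos t).ne']
        rwa [h5, h6] at h4
      have h7 := mul_le_mul_of_nonneg_right h3 hden.le
      have h8 : c * (2 * (M' t / M t) + n * ν) * (2 * Real.exp t - 1) =
          (t * Real.exp t - Real.exp t + 1) * (2 * (M' t / M t) + n * ν) := by
        rw [← hc']; ring
      rw [h8] at h7
      nlinarith)
    hl le_rfl
  exact (Real.log_le_iff_le_exp (hMpos l)).1 (by linarith)

/-- **Bousquet's inequality**, tail form. -/
theorem pr_iSup_gt_le (hp : IsWeight p) (n : ℕ) (h0 : ∀ v, expect p (X v) = 0)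
    (h1 : ∀ v a, X v a ≤ 1) (hν : ∀ v, expect p (fun a => X v a ^ 2) ≤ ν) {L : ℝ} (hL : 0 < L) :
    pr (piWeight p n) (fun x => expect (piWeight p n) (fun x => ⨆ v, ∑ k, X v (x k)) +
        √(2 * (n * ν + 2 * expect (piWeight p n) (fun x => ⨆ v, ∑ k, X v (x k))) * L) + L / 3 <
      ⨆ v, ∑ k, X v (x k)) ≤ Real.exp (-L) := by
  set μ := expect (piWeight p n) fun x => ⨆ v, ∑ k, X v (x k) with hμ
  have hμ0 : 0 ≤ μ := expect_iSup_sum_nonneg hp n h0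
  have hν0 : 0 ≤ ν := by
    obtain ⟨v⟩ := ‹Nonempty ι›
    exact (expect_nonneg hp fun a => sq_nonneg _).trans (hν v)
  obtain ⟨l, hl, hle⟩ := exists_bernstein_exponent (v := n * ν + 2 * μ) (by positivity) hL
  refine (pr_le_exp (hp.piWeight n) (expect_exp_iSup_le hp n h0 h1 hν hl)
    (l * (μ + √(2 * (n * ν + 2 * μ) * L) + L / 3)) fun x hx =>
      mul_le_mul_of_nonneg_left hx.le hl.le).trans (Real.exp_le_exp.2 ?_)
  rw [← hμ]
  linarith


end bousquet

/-- Bennett's bound for the moment generating function of a sum. -/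
theorem expect_exp_sum_le {Ω : Type*} [Fintype Ω] {p : Ω → ℝ} (hp : IsWeight p) (n : ℕ)
    {X : Ω → ℝ} {ν : ℝ} (h0 : expect p X = 0) (h1 : ∀ a, X a ≤ 1)
    (hν : expect p (fun a => X a ^ 2) ≤ ν) {l : ℝ} (hl : 0 < l) :
    expect (piWeight p n) (fun x => Real.exp (l * ∑ k, X (x k))) ≤
      Real.exp (n * ν * (Real.exp l - 1 - l)) := by
  have h := expect_exp_iSup_le (ι := Unit) (X := fun _ => X) hp n (fun _ => h0) (fun _ => h1)
    (fun _ => hν) hl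
  simpa [expect_piWeight_sum_apply hp, h0] using h

/-- Bernstein's inequality. -/
theorem pr_sum_gt_le {Ω : Type*} [Fintype Ω] {p : Ω → ℝ} (hp : IsWeight p) (n : ℕ)
    {X : Ω → ℝ} {ν : ℝ} (h0 : expect p X = 0) (h1 : ∀ a, X a ≤ 1)
    (hν : expect p (fun a => X a ^ 2) ≤ ν) {L : ℝ} (hL : 0 < L) :
    pr (piWeight p n) (fun x => √(2 * (n * ν) * L) + L / 3 < ∑ k, X (x k)) ≤ Real.exp (-L) := by
  have h := pr_iSup_gt_le (ι := Unit) (X := fun _ => X) hp n (fun _ => h0) (fun _ => h1)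
    (fun _ => hν) hL
  simpa [expect_piWeight_sum_apply hp, h0] using h


/-! ### Lower tails of Rademacher averages -/

/-- The uniform weight on the two signs. -/
def boolWeight (_ : Bool) : ℝ := 1 / 2

theorem isWeight_boolWeight : IsWeight boolWeight where
  nonneg _ := by norm_num [boolWeight]
  sum_eq_one := by norm_num [boolWeight]

theorem expect_boolWeight (F : Bool → ℝ) : expect boolWeight F = (F true + F false) / 2 := by
  simp [expect, boolWeight]
  ring

theorem sign_not (b : Bool) : sign (!b) = -sign b := by cases b <;> simp [sign]

theorem sign_sq (b : Bool) : sign b ^ 2 = 1 := by cases b <;> simp [sign]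

theorem sign_mem_Icc (b : Bool) : sign b ∈ Set.Icc (-1 : ℝ) 1 := by cases b <;> simp [sign]

/-- The one-coordinate step of the transport inequality. For `A ≤ B` and `d = B - A ≤ 2`, the
choices `θ = 0` and `θ = d / 2` give `P + Q ≤ A + B - d² / 4`, and `cosh (d / 2) ≤ exp (d² / 8)`
concludes. For `d > 2`, `θ = 1` gives `Q ≤ A + 1`, and the numerical fact `(1 + exp (-2)) / 2 ≤ exp
(-1 / 2)` suffices. -/
theorem exp_neg_add_exp_neg_le {A B P Q : ℝ}
    (hP : ∀ θ, 0 ≤ θ → θ ≤ 1 → P ≤ (1 - θ) * A + θ * B + θ ^ 2)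
    (hQ : ∀ θ, 0 ≤ θ → θ ≤ 1 → Q ≤ (1 - θ) * B + θ * A + θ ^ 2) :
    (Real.exp (-A) + Real.exp (-B)) / 2 ≤ Real.exp (-((P + Q) / 2)) := by
  wlog hAB : A ≤ B generalizing A B P Q
  · have := this hQ hP (by linarith)
    rwa [add_comm (Real.exp (-B)), add_comm Q] at this
  have hP0 := hP 0 le_rfl zero_le_one
  rcases le_or_gt (B - A) 2 with hd | hd
  · have h1 := hQ ((B - A) / 2) (by linarith) (by linarith)
    have h2 := Real.cosh_le_exp_half_sq ((B - A) / 2)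
    rw [Real.cosh_eq] at h2
    have h3 := mul_le_mul_of_nonneg_left h2 (Real.exp_pos (-((A + B) / 2))).le
    rw [mul_div_assoc', mul_add, ← Real.exp_add, ← Real.exp_add, ← Real.exp_add] at h3
    rw [show -((A + B) / 2) + (B - A) / 2 = -A by ring,
      show -((A + B) / 2) + -((B - A) / 2) = -B by ring] at h3
    refine h3.trans (Real.exp_le_exp.2 ?_)
    nlinarith
  · have h1 := hQ 1 zero_le_one le_rfl
    have h2 : Real.exp (-B) ≤ Real.exp (-A) * Real.exp (-2) := by
      rw [← Real.exp_add]
      exact Real.exp_le_exp.2 (by linarith)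
    have h3 : Real.exp (-A) * Real.exp (-1 / 2) ≤ Real.exp (-((P + Q) / 2)) := by
      rw [← Real.exp_add]
      exact Real.exp_le_exp.2 (by linarith)
    have h4 : Real.exp (-2) = Real.exp (-1 / 2) ^ 4 := by
      rw [← Real.exp_nat_mul]; norm_num
    have h5 : (1 + Real.exp (-2)) / 2 ≤ Real.exp (-1 / 2) := by
      rw [h4]
      have h6 : (3 / 5 : ℝ) ≤ Real.exp (-1 / 2) := by
        have : Real.exp (-1 / 2) ^ 2 = Real.exp (-1) := by
          rw [← Real.exp_nat_mul]; norm_num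
        have h7 : (0.36 : ℝ) ≤ Real.exp (-1) := by
          have := Real.exp_neg_one_gt_d9
          linarith
        nlinarith [Real.exp_pos (-1 / 2)]
      have h8 : Real.exp (-1 / 2) ≤ 5 / 8 := by
        have : Real.exp (-1 / 2) ^ 2 = Real.exp (-1) := by
          rw [← Real.exp_nat_mul]; norm_num
        have h7 : Real.exp (-1) < 0.3679 := by
          have := Real.exp_neg_one_lt_d9
          linarith
        nlinarith [Real.exp_pos (-1 / 2)]
      set e := Real.exp (-1 / 2)
      have h9 : e ^ 2 ≤ 25 / 64 := by nlinarith
      nlinarith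
    nlinarith [mul_le_mul_of_nonneg_left h5 (Real.exp_pos (-A)).le]

theorem le_mul_iInf_add_mul_iInf {ι : Type*} [Nonempty ι] {g h : ι → ℝ} {a s t r : ℝ}
    (hs : 0 ≤ s) (ht : 0 ≤ t) (H : ∀ y z, a ≤ s * g y + t * h z + r) :
    a ≤ s * (⨅ y, g y) + t * (⨅ z, h z) + r := by
  rw [Real.mul_iInf_of_nonneg hs, Real.mul_iInf_of_nonneg ht]
  have h1 : a - r - (⨅ z, t * h z) ≤ ⨅ y, s * g y := by
    refine le_ciInf fun y => ?_
    have : a - r - s * g y ≤ ⨅ z, t * h z := le_ciInf fun z => by linarith [H y z]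
    linarith
  linarith

/-- A transport inequality on the cube: `q` lies below the infimum convolution of the convex
function `f` with the quadratic cost. -/
theorem expect_exp_neg_le_of_infConvolution : ∀ (n : ℕ) (f : (Fin n → ℝ) → ℝ)
    (q : (Fin n → Bool) → ℝ),
    (∀ y z θ, 0 ≤ θ → θ ≤ 1 → f (fun i => (1 - θ) * y i + θ * z i) ≤ (1 - θ) * f y + θ * f z) →
    (∃ b, ∀ y : Fin n → ℝ, (∀ i, y i ∈ Set.Icc (-1 : ℝ) 1) → b ≤ f y) →
    (∀ x y, (∀ i, y i ∈ Set.Icc (-1 : ℝ) 1) → q x ≤ f y + 1 / 4 * ∑ i, (sign (x i) - y i) ^ 2) →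
    expect (piWeight boolWeight n) (fun x => Real.exp (-f fun i => sign (x i))) ≤
      Real.exp (-expect (piWeight boolWeight n) q) := by
  intro n
  induction n with
  | zero =>
    intro f q _ _ hq
    rw [expect_piWeight_zero, expect_piWeight_zero]
    refine Real.exp_le_exp.2 (neg_le_neg ?_)
    simpa using hq _ (fun i => sign ((Unique.instInhabited.default : Fin 0 → Bool) i)) fun i => i.elim0
  | succ n ih =>
    intro f q hf hb hq
    obtain ⟨b, hb⟩ := hb
    have hwn := isWeight_boolWeight.piWeight n
    -- The infimum is taken over the solid cube only, where `f` is bounded below; an unbounded real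
    -- infimum would take the default value `0`.
    let C := {y : Fin n → ℝ // ∀ i, y i ∈ Set.Icc (-1 : ℝ) 1}
    have : Nonempty C := ⟨⟨fun _ => 0, fun _ => by simp⟩⟩
    have hcons : ∀ (s : ℝ), s ∈ Set.Icc (-1 : ℝ) 1 → ∀ y : Fin n → ℝ,
        (∀ i, y i ∈ Set.Icc (-1 : ℝ) 1) →
        ∀ i, (Fin.cons s y : Fin (n + 1) → ℝ) i ∈ Set.Icc (-1 : ℝ) 1 := by
      intro s hs y hy i
      refine Fin.cases ?_ (fun j => ?_) i
      · simpa using hs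
      · simpa using hy j
    have hconv : ∀ (s t θ : ℝ) (y z : Fin n → ℝ),
        (fun i => (1 - θ) * (Fin.cons s y : Fin (n + 1) → ℝ) i +
          θ * (Fin.cons t z : Fin (n + 1) → ℝ) i) =
        Fin.cons ((1 - θ) * s + θ * t) fun i => (1 - θ) * y i + θ * z i := by
      intro s t θ y z
      funext i
      refine Fin.cases ?_ (fun j => ?_) i <;> simp
    let g : Bool → (Fin n → Bool) → C → ℝ := fun t x y =>
      f (Fin.cons (sign t) y.1) + 1 / 4 * ∑ i, (sign (x i) - y.1 i) ^ 2
    let Q : Bool → (Fin n → Bool) → ℝ := fun t x => ⨅ y, g t x y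
    have hgb : ∀ t x, BddBelow (Set.range (g t x)) := by
      intro t x
      refine ⟨b, ?_⟩
      rintro _ ⟨y, rfl⟩
      have h1 := hb _ (hcons _ (sign_mem_Icc t) y.1 y.2)
      have h2 : 0 ≤ ∑ i, (sign (x i) - y.1 i) ^ 2 := Finset.sum_nonneg fun i _ => sq_nonneg _
      simp only [g]
      linarith
    have hih : ∀ t, expect (piWeight boolWeight n) (fun x =>
        Real.exp (-f (Fin.cons (sign t) fun i => sign (x i)))) ≤
        Real.exp (-expect (piWeight boolWeight n) (Q t)) := by
      intro t
      refine ih (fun y => f (Fin.cons (sign t) y)) (Q t) ?_ ⟨b, fun y hy => ?_⟩ fun x y hy => ?_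
      · intro y z θ h0 h1
        have := hf (Fin.cons (sign t) y) (Fin.cons (sign t) z) θ h0 h1
        rw [hconv] at this
        convert this using 3
        ring
      · exact hb _ (hcons _ (sign_mem_Icc t) y hy)
      · exact ciInf_le (hgb t x) ⟨y, hy⟩
    have hB : ∀ t θ, 0 ≤ θ → θ ≤ 1 →
        expect (piWeight boolWeight n) (fun x => q (Fin.cons t x)) ≤
          (1 - θ) * expect (piWeight boolWeight n) (Q t) +
            θ * expect (piWeight boolWeight n) (Q (!t)) + θ ^ 2 := by
      intro t θ h0 h1
      rw [← expect_const_mul, ← expect_const_mul, ← expect_add, ← expect_const hwn (θ ^ 2),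
        ← expect_add]
      refine expect_mono hwn fun x => ?_
      refine le_mul_iInf_add_mul_iInf (by linarith) h0 fun y z => ?_
      have hmem : ∀ i, (1 - θ) * (Fin.cons (sign t) y.1 : Fin (n + 1) → ℝ) i +
          θ * (Fin.cons (sign (!t)) z.1 : Fin (n + 1) → ℝ) i ∈ Set.Icc (-1 : ℝ) 1 := fun i =>
        (convex_Icc (-1 : ℝ) 1) (hcons _ (sign_mem_Icc t) y.1 y.2 i)
          (hcons _ (sign_mem_Icc (!t)) z.1 z.2 i) (by linarith) h0 (by ring)
      have h2 := hq (Fin.cons t x) _ hmem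
      have h3 := hf (Fin.cons (sign t) y.1) (Fin.cons (sign (!t)) z.1) θ h0 h1
      rw [Fin.sum_univ_succ] at h2
      simp only [Fin.cons_zero, Fin.cons_succ, sign_not] at h2
      -- Moving a fraction `θ` from one sign to the opposite one costs `(2 θ)² / 4 = θ²`, the term
      -- required by the two-point inequality.
      have h4 : (sign t - ((1 - θ) * sign t + θ * -sign t)) ^ 2 = 4 * θ ^ 2 := by
        have := sign_sq t
        linear_combination 4 * θ ^ 2 * this
      have h5 : ∑ i, (sign (x i) - ((1 - θ) * y.1 i + θ * z.1 i)) ^ 2 ≤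
          (1 - θ) * ∑ i, (sign (x i) - y.1 i) ^ 2 + θ * ∑ i, (sign (x i) - z.1 i) ^ 2 := by
        rw [Finset.mul_sum, Finset.mul_sum, ← Finset.sum_add_distrib]
        refine Finset.sum_le_sum fun i _ => ?_
        nlinarith [mul_nonneg (mul_nonneg h0 (by linarith : 0 ≤ 1 - θ)) (sq_nonneg (y.1 i - z.1 i))]
      rw [sign_not] at h3
      simp only [g, sign_not]
      linarith
    rw [expect_piWeight_cons, expect_piWeight_cons, expect_boolWeight, expect_boolWeight]
    have hsign : ∀ (t : Bool) (x : Fin n → Bool),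
        (fun i => sign ((Fin.cons t x : Fin (n + 1) → Bool) i)) =
          Fin.cons (sign t) fun i => sign (x i) := by
      intro t x
      funext i
      refine Fin.cases ?_ (fun j => ?_) i <;> simp
    simp only [hsign]
    refine le_trans ?_ (exp_neg_add_exp_neg_le (hB true) (hB false))
    have h6 := hih true
    have h7 := hih false
    simp only [Bool.not_true] at h6 h7 ⊢
    linarith

section rademacher

variable {ι : Type*} [Finite ι] [Nonempty ι] {m : ℕ} {a : ι → Fin m → ℝ} {W : ℝ}

/-- The supremum is convex in the sign vector. Using a maximizer at `x` and `l a (x - y) ≤ l² a² +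
(x - y)² / 4` coordinatewise shows that `l sup - l² W` lies below the infimum convolution. The
variance proxy is thus the largest `∑ a²`, not the sum of coordinatewise maxima that bounded
differences would give. -/
theorem expect_exp_neg_rademacher_le (hW : ∀ v, ∑ k, a v k ^ 2 ≤ W) {l : ℝ} (hl : 0 ≤ l) :
    expect (piWeight boolWeight m) (fun s => Real.exp (-(l * ⨆ v, ∑ k, sign (s k) * a v k))) ≤
      Real.exp (-(l * expect (piWeight boolWeight m) fun s => ⨆ v, ∑ k, sign (s k) * a v k) +
        l ^ 2 * W) := by
  have hwm := isWeight_boolWeight.piWeight m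
  have hbdd : ∀ g : ι → ℝ, BddAbove (Set.range g) := fun g => (Set.finite_range g).bddAbove
  have h := expect_exp_neg_le_of_infConvolution m (fun y => l * ⨆ v, ∑ k, y k * a v k)
    (fun s => l * (⨆ v, ∑ k, sign (s k) * a v k) - l ^ 2 * W)
    (fun y z θ h0 h1 => by
      have h2 : ⨆ v, ∑ k, ((1 - θ) * y k + θ * z k) * a v k ≤
          (1 - θ) * (⨆ v, ∑ k, y k * a v k) + θ * ⨆ v, ∑ k, z k * a v k := by
        refine ciSup_le fun v => ?_
        have h3 := mul_le_mul_of_nonneg_left (le_ciSup (hbdd fun v => ∑ k, y k * a v k) v)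
          (by linarith : 0 ≤ 1 - θ)
        have h4 := mul_le_mul_of_nonneg_left (le_ciSup (hbdd fun v => ∑ k, z k * a v k) v) h0
        refine le_trans (le_of_eq ?_) (add_le_add h3 h4)
        rw [Finset.mul_sum, Finset.mul_sum, ← Finset.sum_add_distrib]
        exact Finset.sum_congr rfl fun k _ => by ring
      have := mul_le_mul_of_nonneg_left h2 hl
      linarith)
    (by
      obtain ⟨v⟩ := ‹Nonempty ι›
      refine ⟨l * ∑ k, -|a v k|, fun y hy => mul_le_mul_of_nonneg_left ?_ hl⟩
      refine le_trans (Finset.sum_le_sum fun k _ => ?_) (le_ciSup (hbdd fun v => ∑ k, y k * a v k) v)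
      have h2 : |y k * a v k| ≤ |a v k| := by
        rw [abs_mul]
        exact mul_le_of_le_one_left (abs_nonneg _) (abs_le.2 (hy k))
      linarith [neg_abs_le (y k * a v k)])
    (fun x y _ => by
      obtain ⟨v, hv⟩ := exists_eq_ciSup_of_finite (f := fun v => ∑ k, sign (x k) * a v k)
      rw [← hv]
      have h2 := mul_le_mul_of_nonneg_left (le_ciSup (hbdd fun v => ∑ k, y k * a v k) v) hl
      have h3 : l * ∑ k, sign (x k) * a v k ≤ l * (∑ k, y k * a v k) +
          (l ^ 2 * ∑ k, a v k ^ 2 + 1 / 4 * ∑ k, (sign (x k) - y k) ^ 2) := by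
        simp only [Finset.mul_sum]
        rw [← Finset.sum_add_distrib, ← Finset.sum_add_distrib]
        refine Finset.sum_le_sum fun k _ => ?_
        nlinarith [sq_nonneg (l * a v k - (sign (x k) - y k) / 2)]
      have h4 := mul_le_mul_of_nonneg_left (hW v) (sq_nonneg l)
      linarith)
  rw [expect_sub, expect_const_mul, expect_const hwm] at h
  refine h.trans_eq ?_
  congr 1
  ring

/-- An upper confidence bound for a Rademacher average from `c` independent rows of signs. -/
theorem pr_rademacher_lt_le (hW : ∀ v, ∑ k, a v k ^ 2 ≤ W) (c : ℕ) {L : ℝ} (hL : 0 < L) :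
    pr (piWeight (piWeight boolWeight m) c) (fun s =>
      ∑ r, (⨆ v, ∑ k, sign (s r k) * a v k) + √(4 * (c * W) * L) <
        c * expect (piWeight boolWeight m) fun s => ⨆ v, ∑ k, sign (s k) * a v k) ≤
      Real.exp (-L) := by
  have hwm := isWeight_boolWeight.piWeight m
  set μ := expect (piWeight boolWeight m) fun s => ⨆ v, ∑ k, sign (s k) * a v k with hμ
  have hW0 : 0 ≤ W := by
    obtain ⟨v⟩ := ‹Nonempty ι›
    exact (Finset.sum_nonneg fun k _ => sq_nonneg _).trans (hW v)
  -- If `c = 0` or `W = 0`, both sides of the strict inequality vanish and the event is empty;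
  -- otherwise the optimal exponent can be formed.
  rcases (by positivity : 0 ≤ c * W).eq_or_lt with h0 | hcW
  · rw [pr_eq_zero]
    · positivity
    · intro s _ hs
      rcases mul_eq_zero.1 h0.symm with hc | hW'
      · have : c = 0 := by exact_mod_cast hc
        subst this
        simp at hs
      · have ha : ∀ v k, a v k = 0 := by
          intro v k
          have h1 := hW v
          rw [hW'] at h1
          have h2 := (Finset.sum_eq_zero_iff_of_nonneg fun k _ => sq_nonneg (a v k)).1
            (le_antisymm h1 (Finset.sum_nonneg fun k _ => sq_nonneg _)) k (Finset.mem_univ k)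
          exact pow_eq_zero_iff (two_ne_zero) |>.1 h2
        simp [ha, hW', hμ, expect_const hwm] at hs
  · set l := √(L / (c * W)) with hl
    have hl0 : 0 < l := Real.sqrt_pos.2 (by positivity)
    have hl2 : l ^ 2 = L / (c * W) := Real.sq_sqrt (by positivity)
    have hsq : √(4 * (c * W) * L) = 2 * l * (c * W) := by
      rw [Real.sqrt_eq_iff_mul_self_eq (by positivity) (by positivity)]
      have : 2 * l * (c * W) * (2 * l * (c * W)) = 4 * l ^ 2 * (c * W) ^ 2 := by ring
      rw [this, hl2]
      field_simp
    have hmgf : expect (piWeight (piWeight boolWeight m) c) (fun s =>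
        Real.exp (∑ r, -(l * ⨆ v, ∑ k, sign (s r k) * a v k))) ≤
        Real.exp (c * (-(l * μ) + l ^ 2 * W)) := by
      simp only [Real.exp_sum]
      rw [expect_piWeight_prod c fun s : Fin m → Bool =>
          Real.exp (-(l * ⨆ v, ∑ k, sign (s k) * a v k)),
        Real.exp_nat_mul]
      exact pow_le_pow_left₀ (expect_nonneg hwm fun s => (Real.exp_pos _).le)
        (expect_exp_neg_rademacher_le hW hl0.le) c
    refine (pr_le_exp (hwm.piWeight c) hmgf (-(l * (c * μ - √(4 * (c * W) * L)))) fun s hs => ?_).trans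
      (Real.exp_le_exp.2 (le_of_eq ?_))
    · rw [Finset.sum_neg_distrib, ← Finset.mul_sum]
      refine neg_le_neg (mul_le_mul_of_nonneg_left ?_ hl0.le)
      linarith
    · rw [hsq]
      have : c * (-(l * μ) + l ^ 2 * W) - -(l * (c * μ - 2 * l * (c * W))) = -(l ^ 2 * (c * W)) := by
        ring
      rw [this, hl2, div_mul_cancel₀ _ hcW.ne']

end rademacher


/-! ### Rademacher averages and symmetrization -/

theorem expect_comp_equiv {Ω : Type*} [Fintype Ω] {p : Ω → ℝ} (e : Ω ≃ Ω) (he : ∀ a, p (e a) = p a)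
    (F : Ω → ℝ) : expect p (fun a => F (e a)) = expect p F := by
  unfold expect
  rw [← e.sum_comp fun a => p a * F a]
  simp only [he]

theorem pr_prodWeight {Ω Ω' : Type*} [Fintype Ω] [Fintype Ω'] {p : Ω → ℝ} (q : Ω' → ℝ)
    (A : Ω × Ω' → Prop) : pr (prodWeight p q) A = expect p fun a => pr q fun b => A (a, b) :=
  expect_prodWeight q _

theorem pr_prodWeight_fst {Ω Ω' : Type*} [Fintype Ω] [Fintype Ω'] {p : Ω → ℝ} {q : Ω' → ℝ}
    (hq : IsWeight q) (A : Ω → Prop) : pr (prodWeight p q) (fun z => A z.1) = pr p A := by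
  rw [pr_prodWeight]
  unfold pr
  congr 1
  funext a
  exact expect_const hq (@ite ℝ (A a) (Classical.propDecidable _) 1 0)

section rademacher

variable {Ω : Type*} {ι : Type*} {m : ℕ}

/-- The (unnormalized) empirical Rademacher average of the functions `f v` on the sample `x`. -/
def radAvg (f : ι → Ω → ℝ) (x : Fin m → Ω) : ℝ :=
  expect (piWeight boolWeight m) fun s => ⨆ v, ∑ k, sign (s k) * f v (x k)

theorem radAvg_neg (f : ι → Ω → ℝ) (x : Fin m → Ω) : radAvg (fun v a => -f v a) x = radAvg f x := by
  unfold radAvg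
  rw [← expect_comp_equiv (Equiv.piCongrRight fun _ : Fin m => Equiv.boolNot)
    (fun s => by simp [piWeight, boolWeight])]
  simp [sign_not]

variable [Finite ι] [Nonempty ι] {f : ι → Ω → ℝ}

theorem bddAbove_range_of_finite {ι : Type*} [Finite ι] (g : ι → ℝ) : BddAbove (Set.range g) := (Set.finite_range g).bddAbove

/-- Averaging over the sign of the `k`-th term alone kills that term, and a supremum of averages is
at most the average of suprema. -/
theorem radAvg_sub_erase_nonneg (f : ι → Ω → ℝ) (x : Fin m → Ω) (k : Fin m) :
    0 ≤ radAvg f x - expect (piWeight boolWeight m)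
      fun s => ⨆ v, ∑ i ∈ Finset.univ.erase k, sign (s i) * f v (x i) := by
  rw [radAvg, expect_piWeight_update isWeight_boolWeight k, ← expect_sub]
  refine expect_nonneg (isWeight_boolWeight.piWeight m) fun s => ?_
  have h := ciSup_expect_le isWeight_boolWeight fun v (b : Bool) =>
    ∑ i, sign (Function.update s k b i) * f v (x i)
  have h2 : ∀ v, expect boolWeight (fun b => ∑ i, sign (Function.update s k b i) * f v (x i)) =
      ∑ i ∈ Finset.univ.erase k, sign (s i) * f v (x i) := by
    intro v
    have h3 : ∀ b, ∑ i, sign (Function.update s k b i) * f v (x i) =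
        ∑ i ∈ Finset.univ.erase k, sign (s i) * f v (x i) + sign b * f v (x k) := by
      intro b
      rw [← Finset.sum_erase_add _ _ (Finset.mem_univ k), Function.update_self]
      congr 1
      exact Finset.sum_congr rfl fun i hi => by
        rw [Function.update_of_ne (Finset.ne_of_mem_erase hi)]
    rw [expect_boolWeight, h3, h3]
    simp only [sign]
    norm_num
    ring
  simp only [h2] at h
  linarith

theorem radAvg_nonneg (f : ι → Ω → ℝ) (x : Fin m → Ω) : 0 ≤ radAvg f x := by
  have h := ciSup_expect_le (isWeight_boolWeight.piWeight m) fun v (s : Fin m → Bool) =>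
    ∑ k, sign (s k) * f v (x k)
  have h2 : ∀ v, expect (piWeight boolWeight m) (fun s => ∑ k, sign (s k) * f v (x k)) = 0 := by
    intro v
    rw [expect_sum]
    refine Finset.sum_eq_zero fun k _ => ?_
    rw [expect_mul_const, expect_piWeight_apply isWeight_boolWeight k sign, expect_boolWeight]
    simp [sign]
  simpa [h2, radAvg] using h

variable [Fintype Ω] {p : Ω → ℝ}

/-- An upper confidence bound for the Rademacher complexity. -/
theorem pr_radAvg_add_sqrt_lt_le (hp : IsWeight p) (m : ℕ) (hf0 : ∀ v a, 0 ≤ f v a)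
    (hf1 : ∀ v a, f v a ≤ 1) {L : ℝ} (hL : 0 < L) :
    pr (piWeight p m) (fun x => radAvg f x + L + √(L ^ 2 + 2 * L * radAvg f x) <
      expect (piWeight p m) (radAvg f)) ≤ Real.exp (-L) := by
  have hwm := isWeight_boolWeight.piWeight m
  -- For each sign vector, a maximizer of the full sum bounds the `k`-th decrement by its own `k`-th
  -- term. Summing over `k` gives back the full supremum, which is self-boundedness with `a = 1`.
  have hVle : ∀ (x : Fin m → Ω) (s : Fin m → Bool), ∃ v,
      (⨆ v, ∑ k, sign (s k) * f v (x k)) = ∑ k, sign (s k) * f v (x k) ∧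
      ∀ k, (⨆ v, ∑ k, sign (s k) * f v (x k)) -
        (⨆ v, ∑ i ∈ Finset.univ.erase k, sign (s i) * f v (x i)) ≤ sign (s k) * f v (x k) := by
    intro x s
    obtain ⟨v, hv⟩ := exists_eq_ciSup_of_finite (f := fun v => ∑ k, sign (s k) * f v (x k))
    refine ⟨v, hv.symm, fun k => ?_⟩
    rw [← hv, ← Finset.sum_erase_add _ _ (Finset.mem_univ k)]
    have := le_ciSup (bddAbove_range_of_finite
      fun v => ∑ i ∈ Finset.univ.erase k, sign (s i) * f v (x i)) v
    linarith
  have hV1 : ∀ (k : Fin m) (x : Fin m → Ω), radAvg f x - (expect (piWeight boolWeight m)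
      fun s => ⨆ v, ∑ i ∈ Finset.univ.erase k, sign (s i) * f v (x i)) ≤ 1 := by
    intro k x
    rw [radAvg, ← expect_sub, ← expect_const hwm 1]
    refine expect_mono hwm fun s => ?_
    obtain ⟨v, -, hv⟩ := hVle x s
    refine (hv k).trans ?_
    have h1 := hf0 v (x k)
    have h2 := hf1 v (x k)
    cases s k <;> simp [sign] <;> linarith
  have h := pr_add_sqrt_lt_le_of_selfBounding (n := m) (Z := fun x => radAvg f x)
    (Zk := fun k x => expect (piWeight boolWeight m)
      fun s => ⨆ v, ∑ i ∈ Finset.univ.erase k, sign (s i) * f v (x i)) (a := 1) hp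
    (fun k x b => by
      have : ∀ (s : Fin m → Bool) v,
          ∑ i ∈ Finset.univ.erase k, sign (s i) * f v (Function.update x k b i) =
          ∑ i ∈ Finset.univ.erase k, sign (s i) * f v (x i) := fun s v =>
        Finset.sum_congr rfl fun i hi => by rw [Function.update_of_ne (Finset.ne_of_mem_erase hi)]
      simp only [this])
    (fun x => radAvg_nonneg f x) (fun k x => radAvg_sub_erase_nonneg f x k) hV1 le_rfl
    (fun x => by
      rw [one_mul]
      calc _ ≤ ∑ k, (radAvg f x - expect (piWeight boolWeight m)
            fun s => ⨆ v, ∑ i ∈ Finset.univ.erase k, sign (s i) * f v (x i)) :=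
            Finset.sum_le_sum fun k _ => by
              have h1 := hV1 k x
              have h2 := radAvg_sub_erase_nonneg f x k
              nlinarith
        _ ≤ radAvg f x := by
            simp only [radAvg, ← expect_sub]
            rw [← expect_sum]
            refine expect_mono hwm fun s => ?_
            obtain ⟨v, hv, hv'⟩ := hVle x s
            exact (Finset.sum_le_sum fun k _ => hv' k).trans_eq hv.symm) hL
  simpa only [one_mul] using h

/-- The symmetrization inequality. -/
theorem expect_iSup_le_two_mul_radAvg (hp : IsWeight p) (m : ℕ) (f : ι → Ω → ℝ) :
    expect (piWeight p m) (fun x => ⨆ v, ∑ k, (f v (x k) - expect p (f v))) ≤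
      2 * expect (piWeight p m) (radAvg f) := by
  have hpm := hp.piWeight m
  have hwm := isWeight_boolWeight.piWeight m
  have h1 : expect (piWeight p m) (fun x => ⨆ v, ∑ k, (f v (x k) - expect p (f v))) ≤
      expect (piWeight p m) fun x => expect (piWeight p m) fun y =>
        ⨆ v, ∑ k, (f v (x k) - f v (y k)) := by
    refine expect_mono hpm fun x => ?_
    have := ciSup_expect_le hpm fun v (y : Fin m → Ω) => ∑ k, (f v (x k) - f v (y k))
    refine le_trans (le_of_eq ?_) this
    congr 1
    funext v
    rw [expect_sum]
    refine Finset.sum_congr rfl fun k _ => ?_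
    rw [expect_sub, expect_const hpm, expect_piWeight_apply hp k (f v)]
  -- Swapping `x k` and `y k` where the sign is negative preserves the product weight.
  have h2 : ∀ s : Fin m → Bool, (expect (piWeight p m) fun x => expect (piWeight p m) fun y =>
        ⨆ v, ∑ k, (f v (x k) - f v (y k))) =
      expect (piWeight p m) fun x => expect (piWeight p m) fun y =>
        ⨆ v, ∑ k, sign (s k) * (f v (x k) - f v (y k)) := by
    intro s
    let e : (Fin m → Ω) × (Fin m → Ω) → (Fin m → Ω) × (Fin m → Ω) := fun z =>
      (fun k => if s k then z.1 k else z.2 k, fun k => if s k then z.2 k else z.1 k)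
    have hinv : Function.Involutive e := by
      intro z
      simp only [e]
      ext k
      · by_cases h : s k <;> simp [h]
      · by_cases h : s k <;> simp [h]
    have h3 := expect_comp_equiv (p := prodWeight (piWeight p m) (piWeight p m)) hinv.toPerm
      (fun z => by
        simp only [Function.Involutive.coe_toPerm, prodWeight, piWeight, e]
        rw [← Finset.prod_mul_distrib, ← Finset.prod_mul_distrib]
        refine Finset.prod_congr rfl fun k _ => ?_
        by_cases h : s k <;> simp [h, mul_comm])
      (fun z => ⨆ v, ∑ k, (f v (z.1 k) - f v (z.2 k)))
    rw [expect_prodWeight, expect_prodWeight] at h3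
    rw [← h3]
    congr 1
    funext x
    congr 1
    funext y
    congr 1
    funext v
    refine Finset.sum_congr rfl fun k _ => ?_
    by_cases h : s k <;> simp [e, h, sign]
  have h3 : (expect (piWeight p m) fun x => expect (piWeight p m) fun y =>
        ⨆ v, ∑ k, (f v (x k) - f v (y k))) =
      expect (piWeight p m) fun x => expect (piWeight p m) fun y =>
        expect (piWeight boolWeight m) fun s => ⨆ v, ∑ k, sign (s k) * (f v (x k) - f v (y k)) := by
    rw [← expect_const hwm (expect (piWeight p m) fun x => expect (piWeight p m) fun y =>
        ⨆ v, ∑ k, (f v (x k) - f v (y k)))]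
    calc _ = expect (piWeight boolWeight m) fun s =>
          expect (piWeight p m) fun x => expect (piWeight p m) fun y =>
            ⨆ v, ∑ k, sign (s k) * (f v (x k) - f v (y k)) := by
          congr 1
          funext s
          exact h2 s
      _ = _ := by
          rw [expect_comm]
          congr 1
          funext x
          rw [expect_comm]
  have h4 : ∀ x y : Fin m → Ω, (expect (piWeight boolWeight m) fun s =>
      ⨆ v, ∑ k, sign (s k) * (f v (x k) - f v (y k))) ≤ radAvg f x + radAvg f y := by
    intro x y
    rw [← radAvg_neg f y, radAvg, radAvg, ← expect_add]
    refine expect_mono hwm fun s => ciSup_le fun v => ?_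
    refine le_trans (le_of_eq ?_) (add_le_add
      (le_ciSup (bddAbove_range_of_finite fun v => ∑ k, sign (s k) * f v (x k)) v)
      (le_ciSup (bddAbove_range_of_finite fun v => ∑ k, sign (s k) * -f v (y k)) v))
    rw [← Finset.sum_add_distrib]
    exact Finset.sum_congr rfl fun k _ => by ring
  refine h1.trans ?_
  rw [h3]
  refine (expect_mono hpm fun x => expect_mono hpm fun y => h4 x y).trans_eq ?_
  simp only [expect_add, expect_const hpm]
  ring

/-! ### The non-uniform deviation bound -/

/-- The (unnormalized) upper bound on the maximum variance. -/
def varSum (f : ι → Ω → ℝ) (x : Fin m → Ω) (L : ℝ) : ℝ :=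
  (⨆ v, ∑ k, f v (x k) ^ 2) + L + √(L ^ 2 + 2 * L * ⨆ v, ∑ k, f v (x k) ^ 2)

/-- The (unnormalized) Monte Carlo upper bound on the empirical Rademacher average. -/
def radMC {c : ℕ} (f : ι → Ω → ℝ) (x : Fin m → Ω) (s : Fin c → Fin m → Bool) (L : ℝ) : ℝ :=
  1 / (c : ℝ) * (∑ r, ⨆ v, ∑ k, sign (s r k) * f v (x k)) +
    √(4 * (⨆ v, ∑ k, f v (x k) ^ 2) * L / c)

/-- The (unnormalized) upper bound on the Rademacher complexity. -/
def radSum {c : ℕ} (f : ι → Ω → ℝ) (x : Fin m → Ω) (s : Fin c → Fin m → Bool) (L : ℝ) : ℝ :=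
  radMC f x s L + L + √(L ^ 2 + 2 * L * radMC f x s L)

/-- The (unnormalized) upper bound on the supremum deviation. -/
def devSum {c : ℕ} (f : ι → Ω → ℝ) (x : Fin m → Ω) (s : Fin c → Fin m → Bool) (L : ℝ) : ℝ :=
  2 * radSum f x s L + √(2 * L * (varSum f x L + 4 * radSum f x s L)) + L / 3

/-- No union bound is needed: the supremum of the sums dominates the sum of the one function whose
second moment is maximal. -/
theorem pr_varSum_lt_le (hp : IsWeight p) (m : ℕ) (hf0 : ∀ v a, 0 ≤ f v a)
    (hf1 : ∀ v a, f v a ≤ 1) {L : ℝ} (hL : 0 < L) :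
    pr (piWeight p m) (fun x => varSum f x L < m * ⨆ v, expect p fun a => f v a ^ 2) ≤
      Real.exp (-L) := by
  obtain ⟨v, hv⟩ := exists_eq_ciSup_of_finite (f := fun v => expect p fun a => f v a ^ 2)
  refine (pr_mono (hp.piWeight m) fun x hx => ?_).trans (pr_sum_add_sqrt_lt_le hp m
    (g := fun a => f v a ^ 2) (fun a => sq_nonneg _)
    (fun a => pow_le_one₀ (hf0 v a) (hf1 v a)) hL)
  rw [hv]
  refine lt_of_le_of_lt ?_ hx
  unfold varSum
  have := le_ciSup (bddAbove_range_of_finite fun v => ∑ k, f v (x k) ^ 2) v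
  gcongr

/-- Here the sample is fixed and only the signs are random. The variance proxy `W` is the observed
supremum of the squared sums. -/
theorem pr_radMC_lt_le {Ω : Type*} {c : ℕ} (hc : 1 ≤ c) (f : ι → Ω → ℝ) (x : Fin m → Ω) {L : ℝ} (hL : 0 < L) :
    pr (piWeight (piWeight boolWeight m) c) (fun s => radMC f x s L < radAvg f x) ≤
      Real.exp (-L) := by
  have hc0 : (0 : ℝ) < c := by exact_mod_cast hc
  refine (pr_mono ((isWeight_boolWeight.piWeight m).piWeight c) fun s hs => ?_).trans
    (pr_rademacher_lt_le (a := fun v k => f v (x k)) (W := ⨆ v, ∑ k, f v (x k) ^ 2)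
      (fun v => le_ciSup (bddAbove_range_of_finite fun v => ∑ k, f v (x k) ^ 2) v) c hL)
  have h1 := mul_lt_mul_of_pos_left hs hc0
  refine lt_of_eq_of_lt ?_ h1
  rw [radMC, mul_add]
  congr 1
  · field_simp
  rw [show (c : ℝ) = √((c : ℝ) ^ 2) from (Real.sqrt_sq hc0.le).symm, ← Real.sqrt_mul (by positivity),
    Real.sqrt_sq hc0.le]
  congr 1
  field_simp

theorem expect_sq_sub_le (hp : IsWeight p) (g : Ω → ℝ) :
    expect p (fun a => (g a - expect p g) ^ 2) ≤ expect p fun a => g a ^ 2 := by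
  have h : ∀ a, (g a - expect p g) ^ 2 = g a ^ 2 - 2 * expect p g * g a + expect p g ^ 2 :=
    fun a => by ring
  simp only [h, expect_add, expect_sub, expect_const_mul, expect_const hp]
  nlinarith [sq_nonneg (expect p g)]

/-- Five events of probability at most `exp (-L)` are excluded: Bousquet's inequality fails for `f`
or for `-f`, `varSum` is below the true second moment, the expected Rademacher average exceeds its
empirical bound, or the empirical one exceeds its Monte Carlo bound. Outside them symmetrization
bounds both expected suprema by `2 * radSum`, since `-f` has the same Rademacher averages as `f`;
this explains the `4 * radSum` under the root. -/
theorem pr_devSum_lt_le (hp : IsWeight p) (m : ℕ) {c : ℕ} (hc : 1 ≤ c) (hf0 : ∀ v a, 0 ≤ f v a)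
    (hf1 : ∀ v a, f v a ≤ 1) {L : ℝ} (hL : 0 < L) :
    pr (prodWeight (piWeight p m) (piWeight (piWeight boolWeight m) c)) (fun z =>
      ∃ v, devSum f z.1 z.2 L < |m * expect p (f v) - ∑ k, f v (z.1 k)|) ≤
      5 * Real.exp (-L) := by
  have hpm := hp.piWeight m
  have hwc := (isWeight_boolWeight.piWeight m).piWeight c
  have hpw := hpm.prodWeight hwc
  set ν := ⨆ v, expect p fun a => f v a ^ 2 with hν
  have hle : ∀ v, expect p (fun a => f v a ^ 2) ≤ ν := fun v =>
    le_ciSup (bddAbove_range_of_finite fun v => expect p fun a => f v a ^ 2) v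
  have hEf0 : ∀ v, 0 ≤ expect p (f v) := fun v => expect_nonneg hp (hf0 v)
  have hEf1 : ∀ v, expect p (f v) ≤ 1 := fun v => by
    rw [← expect_const hp 1]; exact expect_mono hp (hf1 v)
  have hup := pr_iSup_gt_le (X := fun v a => f v a - expect p (f v)) hp m
    (fun v => by rw [expect_sub, expect_const hp, sub_self])
    (fun v a => by linarith [hf1 v a, hEf0 v])
    (fun v => (expect_sq_sub_le hp (f v)).trans (hle v)) hL
  have hlo := pr_iSup_gt_le (X := fun v a => -f v a - expect p (fun a => -f v a)) hp m
    (fun v => by rw [expect_sub, expect_const hp, sub_self])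
    (fun v a => by rw [expect_neg]; linarith [hf0 v a, hEf1 v])
    (fun v => (expect_sq_sub_le hp fun a => -f v a).trans (by simpa using hle v)) hL
  have hsup := expect_iSup_le_two_mul_radAvg hp m f
  have hsupn := expect_iSup_le_two_mul_radAvg hp m fun v a => -f v a
  rw [show (radAvg fun v a => -f v a) = (radAvg f : (Fin m → Ω) → ℝ) from
    funext fun x => radAvg_neg f x] at hsupn
  have hvar := pr_varSum_lt_le hp m hf0 hf1 hL
  have hrad := pr_radAvg_add_sqrt_lt_le hp m hf0 hf1 hL
  have hmc : pr (prodWeight (piWeight p m) (piWeight (piWeight boolWeight m) c))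
      (fun z => radMC f z.1 z.2 L < radAvg f z.1) ≤ Real.exp (-L) := by
    rw [pr_prodWeight, ← expect_const hpm (Real.exp (-L))]
    exact expect_mono hpm fun x => pr_radMC_lt_le hc f x hL
  rw [← pr_prodWeight_fst hwc] at hup hlo hvar hrad
  set RA := expect (piWeight p m) (radAvg f) with hRA
  refine (pr_mono hpw fun z hz => ?_).trans ((pr_or_le hpw _ _).trans (add_le_add ((pr_or_le hpw _ _).trans
    (add_le_add ((pr_or_le hpw _ _).trans (add_le_add ((pr_or_le hpw _ _).trans
      (add_le_add hup hlo)) hvar)) hrad)) hmc) |>.trans_eq (by ring))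
  by_contra hcon
  push Not at hcon
  obtain ⟨⟨⟨⟨h1, h2⟩, h3⟩, h4⟩, h5⟩ := hcon
  obtain ⟨v, hv⟩ := hz
  have h6 : RA ≤ radSum f z.1 z.2 L := by
    refine h4.trans ?_
    unfold radSum
    gcongr
  have h7 : ∀ E B : ℝ, E ≤ 2 * RA → B ≤ E + √(2 * (m * ν + 2 * E) * L) + L / 3 →
      B ≤ devSum f z.1 z.2 L := by
    intro E B hE hB
    refine hB.trans ?_
    unfold devSum
    have h8 : E ≤ 2 * radSum f z.1 z.2 L := by linarith
    have h9 : 2 * (m * ν + 2 * E) * L ≤ 2 * L * (varSum f z.1 L + 4 * radSum f z.1 z.2 L) := by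
      nlinarith
    have := Real.sqrt_le_sqrt h9
    linarith
  have h8 := h7 _ _ hsup h1
  have h9 := h7 _ _ hsupn h2
  have h10 := (le_ciSup (bddAbove_range_of_finite
    fun v => ∑ k, (f v (z.1 k) - expect p (f v))) v).trans h8
  have h11 := (le_ciSup (bddAbove_range_of_finite
    fun v => ∑ k, (-f v (z.1 k) - expect p fun a => -f v a)) v).trans h9
  simp only [expect_neg, Finset.sum_sub_distrib, Finset.sum_const, Finset.card_univ,
    Fintype.card_fin, nsmul_eq_mul, Finset.sum_neg_distrib] at h10 h11
  refine absurd hv (not_lt.2 (abs_le.2 ⟨?_, ?_⟩)) <;> linarith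

end rademacher


/-! ### The empirical Bernstein inequality -/

theorem sum_sum_lt_sq_sub {n : ℕ} (y : Fin n → ℝ) :
    ∑ i, ∑ j, (if i < j then (y i - y j) ^ 2 else 0) = n * ∑ i, y i ^ 2 - (∑ i, y i) ^ 2 := by
  have h1 : ∑ i, ∑ j, (y i - y j) ^ 2 = ∑ i, ∑ j, (if i < j then (y i - y j) ^ 2 else 0) +
      ∑ i, ∑ j, (if j < i then (y i - y j) ^ 2 else 0) := by
    rw [← Finset.sum_add_distrib]
    refine Finset.sum_congr rfl fun i _ => ?_
    rw [← Finset.sum_add_distrib]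
    refine Finset.sum_congr rfl fun j _ => ?_
    rcases lt_trichotomy i j with h | h | h
    · simp [h, h.not_gt]
    · simp [h]
    · simp [h, h.not_gt]
  have h2 : ∑ i, ∑ j, (if j < i then (y i - y j) ^ 2 else 0) =
      ∑ i, ∑ j, (if i < j then (y i - y j) ^ 2 else 0) := by
    rw [Finset.sum_comm]
    refine Finset.sum_congr rfl fun i _ => Finset.sum_congr rfl fun j _ => ?_
    split_ifs
    · ring
    · rfl
  have h3 : ∑ i, ∑ j, (y i - y j) ^ 2 = 2 * (n * ∑ i, y i ^ 2 - (∑ i, y i) ^ 2) := by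
    have : ∀ i j, (y i - y j) ^ 2 = y i ^ 2 + y j ^ 2 - 2 * (y i * y j) := fun i j => by ring
    simp only [this, Finset.sum_sub_distrib, Finset.sum_add_distrib, ← Finset.mul_sum,
      Finset.sum_const, Finset.card_univ, Fintype.card_fin, nsmul_eq_mul, ← Finset.sum_mul]
    ring
  linarith

section sampleVariance

variable {Ω : Type*} [Fintype Ω] {p : Ω → ℝ} {X : Ω → ℝ} {n : ℕ}

/-- The sample variance. -/
def sampleVar (X : Ω → ℝ) (x : Fin n → Ω) : ℝ :=
  1 / ((n : ℝ) * ((n : ℝ) - 1)) * ∑ i, ∑ j, if i < j then (X (x i) - X (x j)) ^ 2 else 0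

theorem nsmul_sampleVar {Ω : Type*} (hn : 2 ≤ n) (X : Ω → ℝ) (x : Fin n → Ω) :
    n * sampleVar X x = (n * ∑ k, X (x k) ^ 2 - (∑ k, X (x k)) ^ 2) / (n - 1) := by
  have hn' : (2 : ℝ) ≤ n := by exact_mod_cast hn
  have h1 : (n : ℝ) - 1 ≠ 0 := by linarith
  rw [sampleVar, sum_sum_lt_sq_sub fun i => X (x i)]
  field_simp

theorem sampleVar_nonneg {Ω : Type*} (hn : 2 ≤ n) (X : Ω → ℝ) (x : Fin n → Ω) : 0 ≤ sampleVar X x := by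
  have hn' : (2 : ℝ) ≤ n := by exact_mod_cast hn
  refine mul_nonneg (one_div_nonneg.2 (mul_nonneg (by linarith) (by linarith))) ?_
  exact Finset.sum_nonneg fun i _ => Finset.sum_nonneg fun j _ => by
    split_ifs
    · positivity
    · exact le_rfl

theorem expect_sq_sub (hp : IsWeight p) (X : Ω → ℝ) :
    expect p (fun a => (X a - expect p X) ^ 2) = expect p (fun a => X a ^ 2) - expect p X ^ 2 := by
  have h : ∀ a, (X a - expect p X) ^ 2 = X a ^ 2 - 2 * expect p X * X a + expect p X ^ 2 :=
    fun a => by ring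
  simp only [h, expect_add, expect_sub, expect_const_mul, expect_const hp]
  ring

theorem expect_nsmul_sampleVar (hp : IsWeight p) (hn : 2 ≤ n) (X : Ω → ℝ) :
    expect (piWeight p n) (fun x => n * sampleVar X x) =
      n * expect p (fun a => (X a - expect p X) ^ 2) := by
  have hn' : (2 : ℝ) ≤ n := by exact_mod_cast hn
  have h1 : (n : ℝ) - 1 ≠ 0 := by linarith
  simp only [nsmul_sampleVar hn, div_eq_mul_inv, expect_mul_const, expect_sub, expect_const_mul]
  rw [expect_piWeight_sum_apply hp n fun a => X a ^ 2, expect_sq_sub hp]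
  have h2 : expect (piWeight p n) (fun x => (∑ k, X (x k)) ^ 2) =
      n * expect p (fun a => X a ^ 2) + n * (n - 1) * expect p X ^ 2 := by
    have h3 : ∀ i j : Fin n, expect (piWeight p n) (fun x => X (x i) * X (x j)) =
        expect p X ^ 2 + if i = j then expect p (fun a => X a ^ 2) - expect p X ^ 2 else 0 := by
      intro i j
      by_cases h : i = j
      · subst h
        simp only [if_true]
        rw [← expect_piWeight_apply hp i fun a => X a ^ 2]
        simp only [pow_two]
        ring
      · rw [expect_piWeight_apply_mul_apply hp h, if_neg h]
        ring
    simp only [pow_two (∑ k, X _), Finset.sum_mul_sum, expect_sum, h3]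
    simp only [Finset.sum_add_distrib, Finset.sum_ite_eq, Finset.mem_univ, if_true,
      Finset.sum_const, Finset.card_univ, Fintype.card_fin, nsmul_eq_mul]
    ring
  rw [h2]
  field_simp
  ring

/-- `n * sampleVar` is self-bounding with `a = n / (n - 1)`. The reference value `Zk` is its minimum
over a free value in place of `X (x k)`, so the decrement is the squared distance of `X (x k)` from
the mean of the others. These lie in `[0, 1]` and sum exactly to `a * (n * sampleVar)`. -/
theorem pr_sqrt_sampleVar_lt_le (hp : IsWeight p) (hn : 2 ≤ n) (h0 : ∀ a, 0 ≤ X a)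
    (h1 : ∀ a, X a ≤ 1) {L : ℝ} (hL : 0 < L) :
    pr (piWeight p n) (fun x => √(sampleVar X x) + √(2 * L / (n - 1)) <
      √(expect p fun a => (X a - expect p X) ^ 2)) ≤ Real.exp (-L) := by
  have hn' : (2 : ℝ) ≤ n := by exact_mod_cast hn
  have hn1 : (0 : ℝ) < n - 1 := by linarith
  have hV : ∀ (k : Fin n) (x : Fin n → Ω), n * sampleVar X x -
      ((n * ∑ i ∈ Finset.univ.erase k, X (x i) ^ 2 - (∑ i ∈ Finset.univ.erase k, X (x i)) ^ 2) / (n - 1)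
        - (∑ i ∈ Finset.univ.erase k, X (x i)) ^ 2 / (n - 1) ^ 2) =
      (X (x k) - (∑ i ∈ Finset.univ.erase k, X (x i)) / (n - 1)) ^ 2 := by
    intro k x
    rw [nsmul_sampleVar hn, ← Finset.sum_erase_add _ _ (Finset.mem_univ k),
      ← Finset.sum_erase_add _ (fun k => X (x k)) (Finset.mem_univ k)]
    field_simp
    ring
  have hVle : ∀ (k : Fin n) (x : Fin n → Ω),
      (X (x k) - (∑ i ∈ Finset.univ.erase k, X (x i)) / (n - 1)) ^ 2 ≤ 1 := by
    intro k x
    have h2 : 0 ≤ (∑ i ∈ Finset.univ.erase k, X (x i)) / ((n : ℝ) - 1) :=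
      div_nonneg (Finset.sum_nonneg fun i _ => h0 _) hn1.le
    have h3 : (∑ i ∈ Finset.univ.erase k, X (x i)) / ((n : ℝ) - 1) ≤ 1 := by
      rw [div_le_one hn1]
      refine (Finset.sum_le_sum fun i _ => h1 _).trans_eq ?_
      simp [Finset.card_erase_of_mem, Nat.cast_sub (by omega : 1 ≤ n)]
    rw [sq_le_one_iff_abs_le_one, abs_le]
    constructor <;> linarith [h0 (x k), h1 (x k)]
  have h := pr_lt_sub_sqrt_le_of_selfBounding (n := n) (Z := fun x => n * sampleVar X x)
    (Zk := fun k x => (n * ∑ i ∈ Finset.univ.erase k, X (x i) ^ 2 -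
        (∑ i ∈ Finset.univ.erase k, X (x i)) ^ 2) / (n - 1)
        - (∑ i ∈ Finset.univ.erase k, X (x i)) ^ 2 / (n - 1) ^ 2) (a := n / (n - 1)) hp
    (fun k x b => by
      have : ∀ g : Ω → ℝ, ∑ i ∈ Finset.univ.erase k, g (Function.update x k b i) =
          ∑ i ∈ Finset.univ.erase k, g (x i) := fun g =>
        Finset.sum_congr rfl fun i hi => by rw [Function.update_of_ne (Finset.ne_of_mem_erase hi)]
      rw [this X, this fun a => X a ^ 2])
    (fun x => mul_nonneg (by linarith) (sampleVar_nonneg hn X x))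
    (fun k x => by rw [hV]; positivity) (fun k x => by rw [hV]; exact hVle k x)
    (by rw [le_div_iff₀ hn1]; linarith)
    (fun x => by
      simp only [hV]
      calc _ ≤ ∑ k, (X (x k) - (∑ i ∈ Finset.univ.erase k, X (x i)) / ((n : ℝ) - 1)) ^ 2 :=
            Finset.sum_le_sum fun k _ => by
              nlinarith [hVle k x, sq_nonneg (X (x k) - (∑ i ∈ Finset.univ.erase k, X (x i)) / ((n : ℝ) - 1))]
        _ = ∑ k, (n ^ 2 * X (x k) ^ 2 - 2 * n * (∑ i, X (x i)) * X (x k) + (∑ i, X (x i)) ^ 2) /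
              ((n : ℝ) - 1) ^ 2 := by
            refine Finset.sum_congr rfl fun k _ => ?_
            rw [Finset.sum_erase_eq_sub (Finset.mem_univ k)]
            field_simp
            ring
        _ = n / (n - 1) * (n * sampleVar X x) := by
            rw [nsmul_sampleVar hn, ← Finset.sum_div, Finset.sum_add_distrib,
              Finset.sum_sub_distrib, ← Finset.mul_sum, ← Finset.mul_sum]
            simp only [Finset.sum_const, Finset.card_univ, Fintype.card_fin, nsmul_eq_mul]
            field_simp
            ring
        _ ≤ _ := le_rfl) hL
  rw [expect_nsmul_sampleVar hp hn] at h
  refine (pr_mono (hp.piWeight n) fun x hx => ?_).trans h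
  set σ := √(expect p fun a => (X a - expect p X) ^ 2) with hσ
  have hσ0 : 0 ≤ σ := Real.sqrt_nonneg _
  have hσ2 : expect p (fun a => (X a - expect p X) ^ 2) = σ ^ 2 :=
    (Real.sq_sqrt (expect_nonneg hp fun a => sq_nonneg _)).symm
  have hl2 : sampleVar X x = √(sampleVar X x) ^ 2 := (Real.sq_sqrt (sampleVar_nonneg hn X x)).symm
  have hl0 : 0 ≤ √(sampleVar X x) := Real.sqrt_nonneg _
  set r := √(2 * L / (n - 1)) with hr
  have hr0 : 0 ≤ r := Real.sqrt_nonneg _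
  have hr2 : r ^ 2 = 2 * L / (n - 1) := Real.sq_sqrt (by positivity)
  have hs : √(2 * (n / (n - 1) * L) * (n * σ ^ 2)) = n * (r * σ) := by
    rw [Real.sqrt_eq_iff_mul_self_eq (by positivity) (by positivity)]
    have : n * (r * σ) * (n * (r * σ)) = n ^ 2 * σ ^ 2 * r ^ 2 := by ring
    rw [this, hr2]
    field_simp
  rw [hσ2, hs, hl2]
  have h3 : √(sampleVar X x) ^ 2 < σ ^ 2 - r * σ := by nlinarith
  nlinarith

/-- The **empirical Bernstein inequality** of Maurer and Pontil. -/
theorem pr_empiricalBernstein_le (hp : IsWeight p) (hn : 2 ≤ n) (h0 : ∀ a, 0 ≤ X a)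
    (h1 : ∀ a, X a ≤ 1) {L : ℝ} (hL : 0 < L) :
    pr (piWeight p n) (fun x => 1 / (n : ℝ) * ∑ k, X (x k) + √(2 * sampleVar X x * L / n) +
      7 * L / (3 * (n - 1)) < expect p X) ≤ 2 * Real.exp (-L) := by
  have hn' : (2 : ℝ) ≤ n := by exact_mod_cast hn
  have hn1 : (0 : ℝ) < n - 1 := by linarith
  have hE0 : 0 ≤ expect p X := expect_nonneg hp h0
  have hE1 : expect p X ≤ 1 := by rw [← expect_const hp 1]; exact expect_mono hp h1
  have hpn := hp.piWeight n
  have hvar := pr_sqrt_sampleVar_lt_le hp hn h0 h1 hL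
  have hbern := pr_sum_gt_le hp n (X := fun a => expect p X - X a)
    (ν := expect p fun a => (X a - expect p X) ^ 2)
    (by rw [expect_sub, expect_const hp, sub_self])
    (fun a => by linarith [h0 a])
    (le_of_eq (by congr 1; funext a; ring)) hL
  refine (pr_mono hpn fun x hx => ?_).trans ((pr_or_le hpn _ _).trans (add_le_add hvar hbern))
    |>.trans_eq (by ring)
  by_contra hcon
  push Not at hcon
  obtain ⟨h2, h3⟩ := hcon
  set σ := √(expect p fun a => (X a - expect p X) ^ 2) with hσ
  have hσ0 : 0 ≤ σ := Real.sqrt_nonneg _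
  have hσ2 : expect p (fun a => (X a - expect p X) ^ 2) = σ ^ 2 :=
    (Real.sq_sqrt (expect_nonneg hp fun a => sq_nonneg _)).symm
  have hΛ := sampleVar_nonneg hn X x
  have e1 : √(2 * (n * σ ^ 2) * L) = √(2 * n * L) * σ := by
    rw [show 2 * (n * σ ^ 2) * L = 2 * n * L * σ ^ 2 by ring, Real.sqrt_mul (by positivity),
      Real.sqrt_sq hσ0]
  have e2 : √(2 * n * L) * √(sampleVar X x) = n * √(2 * sampleVar X x * L / n) := by
    rw [← Real.sqrt_mul (by positivity), Real.sqrt_eq_iff_mul_self_eq (by positivity) (by positivity)]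
    have h4 := Real.mul_self_sqrt (show 0 ≤ 2 * sampleVar X x * L / n by positivity)
    have : n * √(2 * sampleVar X x * L / n) * (n * √(2 * sampleVar X x * L / n)) =
      n * n * (√(2 * sampleVar X x * L / n) * √(2 * sampleVar X x * L / n)) := by ring
    rw [this, h4]
    field_simp
  -- The constant `7 / 3` is `2 + 1 / 3`: `2` for replacing the true by the empirical standard
  -- deviation, `1 / 3` from Bernstein's linear term.
  have e3 : √(2 * n * L) * √(2 * L / (n - 1)) ≤ n * (2 * L / (n - 1)) := by
    rw [← Real.sqrt_mul (by positivity)]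
    refine Real.sqrt_le_iff.2 ⟨by positivity, ?_⟩
    have : 2 * n * L * (2 * L / (n - 1)) = (2 * L) ^ 2 * (n * (n - 1)) / (n - 1) ^ 2 := by
      field_simp
    rw [this]
    have h5 : (n * (2 * L / (n - 1))) ^ 2 = (2 * L) ^ 2 * (n * n) / ((n : ℝ) - 1) ^ 2 := by
      field_simp
    rw [h5]
    gcongr
    linarith
  have e4 : L / 3 ≤ n * (L / (3 * (n - 1))) := by
    rw [mul_div_assoc', div_le_div_iff₀ (by norm_num) (by positivity)]
    nlinarith
  rw [hσ2, e1] at h3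
  have e5 := mul_le_mul_of_nonneg_left h2 (Real.sqrt_nonneg (2 * n * L))
  rw [mul_add, e2] at e5
  simp only [Finset.sum_sub_distrib, Finset.sum_const, Finset.card_univ, Fintype.card_fin,
    nsmul_eq_mul] at h3
  have e6 := mul_lt_mul_of_pos_left hx (by linarith : (0 : ℝ) < n)
  have e7 : n * (1 / (n : ℝ) * ∑ k, X (x k)) = ∑ k, X (x k) := by field_simp
  have e8 : (n : ℝ) * (7 * L / (3 * (n - 1))) = n * (2 * L / (n - 1)) + n * (L / (3 * (n - 1))) := by
    field_simp
    ring
  rw [mul_add, mul_add, e7, e8] at e6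
  linarith

end sampleVariance


/-! ### The sufficient number of samples -/

theorem gFun_pos {x : ℝ} (h0 : 0 < x) (h1 : x ≤ 1 / 2) : 0 < gFun x :=
  mul_pos h0 (by linarith)

theorem gFun_le (x : ℝ) : gFun x ≤ 1 / 4 := by
  unfold gFun
  nlinarith [sq_nonneg (x - 1 / 2)]

/-- `g h(ε / g)` is the Legendre transform of `l ↦ g (exp l - 1 - l)` at `ε`, attained at `l = log
(1 + ε / g)`. -/
theorem le_mul_hFun_div {g ε : ℝ} (hg : 0 < g) (hε : 0 < ε) (l : ℝ) :
    l * ε - g * (Real.exp l - 1 - l) ≤ g * hFun (ε / g) := by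
  have hw : 0 < 1 + ε / g := by positivity
  have h := Real.log_le_sub_one_of_pos (div_pos (Real.exp_pos l) hw)
  rw [Real.log_div (Real.exp_pos l).ne' hw.ne', Real.log_exp] at h
  have h2 := mul_le_mul_of_nonneg_left h hw.le
  have h3 : (1 + ε / g) * (Real.exp l / (1 + ε / g) - 1) = Real.exp l - (1 + ε / g) := by
    field_simp
  rw [h3] at h2
  have h4 := mul_le_mul_of_nonneg_left h2 hg.le
  have h5 : g * (ε / g) = ε := mul_div_cancel₀ _ hg.ne'
  unfold hFun
  linear_combination h4 - l * h5

/-- At `x = 1 / 2` it gives `g h(ε / g) ≤ 2 ε²`, so the set defining `xHat1` is nonempty. -/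
theorem hFun_le {u : ℝ} (hu : 0 ≤ u) : hFun u ≤ u ^ 2 / 2 := by
  have hm : MonotoneOn (fun u : ℝ => u ^ 2 / 2 - hFun u) (Set.Ici 0) := by
    have hd : ∀ y, 0 ≤ y → HasDerivAt (fun u : ℝ => u ^ 2 / 2 - hFun u) (y - Real.log (1 + y)) y := by
      intro y hy
      have hid := hasDerivAt_id y
      have h1y : (1 + y) ≠ 0 := by linarith
      have hl := (hid.const_add 1).log h1y
      have h := ((hid.fun_pow 2).div_const 2).fun_sub (((hid.const_add 1).fun_mul hl).fun_sub hid)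
      refine h.congr_deriv ?_
      simp
      field_simp
      ring
    refine monotoneOn_of_deriv_nonneg (convex_Ici 0)
      (fun y hy => (hd y hy).continuousAt.continuousWithinAt)
      (fun y hy => (hd y (interior_subset hy)).differentiableAt.differentiableWithinAt)
      fun y hy => ?_
    have hy0 : 0 ≤ y := interior_subset hy
    rw [(hd y hy0).deriv]
    linarith [Real.log_le_sub_one_of_pos (by linarith : 0 < 1 + y)]
  have := hm Set.self_mem_Ici hu hu
  simp [hFun] at this
  unfold hFun
  linarith

/-- As a Legendre transform, `g h(ε / g)` decreases in `g`, and `g ≤ 1 / 4`. The denominators in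
`sampleBound` are thus bounded away from `0`. -/
theorem gFun_mul_hFun_ge {ε x : ℝ} (hε : 0 < ε) (h0 : 0 < x) (h1 : x ≤ 1 / 2) :
    1 / 4 * hFun (ε / (1 / 4)) ≤ gFun x * hFun (ε / gFun x) := by
  refine le_trans ?_ (le_mul_hFun_div (gFun_pos h0 h1) hε (Real.log (1 + ε / (1 / 4))))
  have h2 : 0 ≤ Real.log (1 + ε / (1 / 4)) := Real.log_nonneg (by
    have : 0 < ε / (1 / 4) := by positivity
    linarith)
  have h3 := Real.add_one_le_exp (Real.log (1 + ε / (1 / 4)))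
  have h4 : gFun x * (Real.exp (Real.log (1 + ε / (1 / 4))) - 1 - Real.log (1 + ε / (1 / 4))) ≤
      1 / 4 * (Real.exp (Real.log (1 + ε / (1 / 4))) - 1 - Real.log (1 + ε / (1 / 4))) :=
    mul_le_mul_of_nonneg_right (gFun_le x) (by linarith)
  refine le_trans (le_of_eq ?_) (sub_le_sub_left h4 _)
  rw [Real.exp_log (by positivity)]
  unfold hFun
  ring

theorem hFun_pos {u : ℝ} (hu : 0 < u) : 0 < hFun u := by
  have h := Real.add_one_lt_exp (x := -Real.log (1 + u))
    (neg_ne_zero.2 (Real.log_pos (by linarith)).ne')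
  rw [Real.exp_neg, Real.exp_log (by linarith)] at h
  have h2 := mul_lt_mul_of_pos_left h (by linarith : 0 < 1 + u)
  rw [mul_inv_cancel₀ (by linarith)] at h2
  unfold hFun
  linarith

theorem gFun_mul_hFun_pos {ε x : ℝ} (hε : 0 < ε) (h0 : 0 < x) (h1 : x ≤ 1 / 2) :
    0 < gFun x * hFun (ε / gFun x) :=
  mul_pos (gFun_pos h0 h1) (hFun_pos (div_pos hε (gFun_pos h0 h1)))

/-- As `x → 0`, `g h(ε / g)` grows like `ε log (1 / x)`, as fast as the numerator in `sampleBound`.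
-/
theorem neg_log_le {ε x : ℝ} (hε : 0 < ε) (h0 : 0 < x) (h1 : x ≤ 1 / 2) :
    -Real.log x ≤ gFun x * hFun (ε / gFun x) / ε + (1 - Real.log ε) := by
  have hg := gFun_pos h0 h1
  have hgx : gFun x ≤ x := by unfold gFun; nlinarith
  have h2 : Real.log ε - Real.log x ≤ Real.log (1 + ε / gFun x) := by
    rw [← Real.log_div hε.ne' h0.ne']
    refine Real.log_le_log (by positivity) ?_
    have : ε / x ≤ ε / gFun x := by gcongr
    linarith
  have h3 : 0 ≤ Real.log (1 + ε / gFun x) := Real.log_nonneg (by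
    have : 0 < ε / gFun x := by positivity
    linarith)
  have h4 : gFun x * hFun (ε / gFun x) = (gFun x + ε) * Real.log (1 + ε / gFun x) - ε := by
    unfold hFun
    field_simp
  rw [h4]
  have h5 : ε * (Real.log ε - Real.log x) ≤ (gFun x + ε) * Real.log (1 + ε / gFun x) := by
    nlinarith
  have h6 : -Real.log x - (1 - Real.log ε) ≤
      ((gFun x + ε) * Real.log (1 + ε / gFun x) - ε) / ε := by
    rw [le_div_iff₀ hε]
    linarith
  linarith

/-- Indispensable because `sSup` of an unbounded set of reals is `0`, which would make `sampleBound`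
meaningless. -/
theorem bddAbove_sampleBound {ε η ρ y : ℝ} (hε : 0 < ε) (hη : 0 < η) (hρ : 0 < ρ)
    (hy : y ≤ 1 / 2) :
    BddAbove ((fun x : ℝ => Real.log (2 * ρ / (x * η)) / (gFun x * hFun (ε / gFun x))) ''
      Set.Ioc 0 y) := by
  set d := 1 / 4 * hFun (ε / (1 / 4)) with hd
  have hd0 : 0 < d := mul_pos (by norm_num) (hFun_pos (by positivity))
  refine ⟨|Real.log (2 * ρ / η) + (1 - Real.log ε)| / d + 1 / ε, ?_⟩
  rintro _ ⟨x, ⟨h0, hxy⟩, rfl⟩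
  have h1 : x ≤ 1 / 2 := hxy.trans hy
  have hden := gFun_mul_hFun_ge hε h0 h1
  have hpos := gFun_mul_hFun_pos hε h0 h1
  rw [← hd] at hden
  have h2 : Real.log (2 * ρ / (x * η)) = Real.log (2 * ρ / η) + -Real.log x := by
    rw [← sub_eq_add_neg, ← Real.log_div (by positivity) h0.ne']
    congr 1
    field_simp
  simp only
  rw [div_le_iff₀ hpos, h2]
  have h3 := neg_log_le hε h0 h1
  set G := gFun x * hFun (ε / gFun x) with hG
  have h4 : |Real.log (2 * ρ / η) + (1 - Real.log ε)| ≤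
      |Real.log (2 * ρ / η) + (1 - Real.log ε)| / d * G := by
    rw [div_mul_eq_mul_div, le_div_iff₀ hd0]
    exact mul_le_mul_of_nonneg_left hden (abs_nonneg _)
  have h5 := le_abs_self (Real.log (2 * ρ / η) + (1 - Real.log ε))
  have h6 : (|Real.log (2 * ρ / η) + (1 - Real.log ε)| / d + 1 / ε) * G =
      |Real.log (2 * ρ / η) + (1 - Real.log ε)| / d * G + G / ε := by ring
  rw [h6]
  linarith

/-- The infimum runs over a nonempty closed set, so it is attained and satisfies the defining
inequality. Its left end is positive because `ε / 3 - ε² / 9 < 1 / 4`. -/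
theorem xHat1_mem {ε : ℝ} (hε : 0 < ε) (hε1 : ε < 1) :
    0 < xHat1 ε ∧ xHat1 ε ≤ 1 / 2 ∧
      gFun (xHat1 ε) * hFun (ε / gFun (xHat1 ε)) ≤ 2 * ε ^ 2 := by
  set lo := 1 / 2 - √(ε / 3 - ε ^ 2 / 9) with hlo
  have hlo0 : 0 < lo := by
    have : √(ε / 3 - ε ^ 2 / 9) < 1 / 2 := by
      rw [Real.sqrt_lt' (by norm_num)]
      nlinarith
    linarith
  have hcont : ContinuousOn (fun x => gFun x * hFun (ε / gFun x)) (Set.Icc lo (1 / 2)) := by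
    have hg : Continuous gFun := by unfold gFun; fun_prop
    have hgd : ContinuousOn (fun x => ε / gFun x) (Set.Icc lo (1 / 2)) :=
      continuousOn_const.div hg.continuousOn fun x hx =>
        (gFun_pos (hlo0.trans_le hx.1) hx.2).ne'
    refine hg.continuousOn.mul ?_
    unfold hFun
    refine ContinuousOn.sub (ContinuousOn.mul (continuousOn_const.add hgd)
      (ContinuousOn.log (continuousOn_const.add hgd) fun x hx => ?_)) hgd
    have : 0 < ε / gFun x := div_pos hε (gFun_pos (hlo0.trans_le hx.1) hx.2)
    linarith
  have hset : {x : ℝ | lo ≤ x ∧ x ≤ 1 / 2 ∧ gFun x * hFun (ε / gFun x) ≤ 2 * ε ^ 2} =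
      Set.Icc lo (1 / 2) ∩ (fun x => gFun x * hFun (ε / gFun x)) ⁻¹' Set.Iic (2 * ε ^ 2) := by
    ext x
    simp [and_assoc]
  have hclosed := hcont.preimage_isClosed_of_isClosed isClosed_Icc (isClosed_Iic (a := 2 * ε ^ 2))
  have hne : (Set.Icc lo (1 / 2) ∩
      (fun x => gFun x * hFun (ε / gFun x)) ⁻¹' Set.Iic (2 * ε ^ 2)).Nonempty := by
    refine ⟨1 / 2, ⟨by linarith [Real.sqrt_nonneg (ε / 3 - ε ^ 2 / 9)], le_rfl⟩, ?_⟩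
    have hg : gFun (1 / 2) = 1 / 4 := by norm_num [gFun]
    have := hFun_le (u := ε / (1 / 4)) (by positivity)
    simp only [Set.mem_preimage, Set.mem_Iic, hg]
    linarith
  have hmem := hclosed.csInf_mem hne ⟨lo, fun x hx => hx.1.1⟩
  rw [← hset] at hmem
  exact ⟨hlo0.trans_le hmem.1, hmem.2.1, hmem.2.2⟩

theorem xHat2_mem {ν : ℝ} (hν0 : 0 < ν) (hν : ν ≤ 1 / 4) :
    0 < xHat2 ν ∧ xHat2 ν ≤ 1 / 2 ∧ gFun (xHat2 ν) = ν := by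
  have h1 : √(1 / 4 - ν) < 1 / 2 := by
    rw [Real.sqrt_lt' (by norm_num)]
    linarith
  have h2 := Real.sqrt_nonneg (1 / 4 - ν)
  have h3 := Real.sq_sqrt (by linarith : 0 ≤ 1 / 4 - ν)
  refine ⟨?_, ?_, ?_⟩ <;> unfold xHat2
  · linarith
  · linarith
  · unfold gFun
    linear_combination -h3

/-- The numerator `log (2 ρ / (x η))` is chosen for exactly this: Bennett's bound for variance `g x`
is at most a budget proportional to `x`. -/
theorem two_mul_exp_le_of_sampleBound_le {ε η ν ρ : ℝ} (hε : 0 < ε) (hε1 : ε < 1) (hη : 0 < η)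
    (hρ : 0 < ρ) {m : ℕ} (hm : sampleBound ε η ν ρ ≤ m) {x : ℝ} (h0 : 0 < x)
    (hx : x ≤ min (xHat1 ε) (xHat2 ν)) :
    2 * Real.exp (-(m * (gFun x * hFun (ε / gFun x)))) ≤ x * η / ρ := by
  have hle : min (xHat1 ε) (xHat2 ν) ≤ 1 / 2 :=
    (min_le_left _ _).trans (xHat1_mem hε hε1).2.1
  have hpos := gFun_mul_hFun_pos hε h0 (hx.trans hle)
  have h1 : Real.log (2 * ρ / (x * η)) / (gFun x * hFun (ε / gFun x)) ≤ m := by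
    refine (le_csSup (bddAbove_sampleBound hε hη hρ hle) ⟨x, ⟨h0, hx⟩, rfl⟩).trans ?_
    refine (Nat.le_ceil _).trans ?_
    exact_mod_cast (le_max_right _ _).trans hm
  rw [div_le_iff₀ hpos] at h1
  have h2 : Real.exp (-(m * (gFun x * hFun (ε / gFun x)))) ≤ (2 * ρ / (x * η))⁻¹ := by
    rw [← Real.exp_log (by positivity : 0 < 2 * ρ / (x * η)), ← Real.exp_neg]
    exact Real.exp_le_exp.2 (by linarith)
  refine (mul_le_mul_of_nonneg_left h2 zero_le_two).trans_eq ?_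
  field_simp

/-! ### Bennett's and Hoeffding's inequalities for a single function -/

section concentration

variable {Ω : Type*} [Fintype Ω] {p : Ω → ℝ} {f : Ω → ℝ}

/-- Bennett's inequality. -/
theorem pr_abs_sub_gt_le_bennett (hp : IsWeight p) (m : ℕ) (hf0 : ∀ a, 0 ≤ f a)
    (hf1 : ∀ a, f a ≤ 1) {ε v : ℝ} (hε : 0 < ε) (hv0 : 0 < v)
    (hv : expect p (fun a => (f a - expect p f) ^ 2) ≤ v) :
    pr (piWeight p m) (fun x => m * ε < |m * expect p f - ∑ k, f (x k)|) ≤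
      2 * Real.exp (-(m * (v * hFun (ε / v)))) := by
  have hpm := hp.piWeight m
  have hE0 : 0 ≤ expect p f := expect_nonneg hp hf0
  have hE1 : expect p f ≤ 1 := by rw [← expect_const hp 1]; exact expect_mono hp hf1
  have hw : 1 < 1 + ε / v := by
    have : 0 < ε / v := by positivity
    linarith
  set l := Real.log (1 + ε / v) with hl
  have hl0 : 0 < l := Real.log_pos hw
  have hexp : Real.exp l = 1 + ε / v := Real.exp_log (by linarith)
  have hup := expect_exp_sum_le hp m (X := fun a => f a - expect p f)
    (by rw [expect_sub, expect_const hp, sub_self]) (fun a => by linarith [hf1 a]) hv hl0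
  have hlo := expect_exp_sum_le hp m (X := fun a => expect p f - f a)
    (by rw [expect_sub, expect_const hp, sub_self]) (fun a => by linarith [hf0 a])
    (le_trans (le_of_eq (by congr 1; funext a; ring)) hv) hl0
  have hexpo : m * v * (Real.exp l - 1 - l) - l * (m * ε) = -(m * (v * hFun (ε / v))) := by
    have h5 : v * (ε / v) = ε := mul_div_cancel₀ _ hv0.ne'
    rw [hexp]
    unfold hFun
    rw [← hl]
    linear_combination (m * l) * h5
  have h1 := pr_le_exp hpm (A := fun x => m * ε < ∑ k, (f (x k) - expect p f)) hup (l * (m * ε))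
    fun x hx => mul_le_mul_of_nonneg_left hx.le hl0.le
  have h2 := pr_le_exp hpm (A := fun x => m * ε < ∑ k, (expect p f - f (x k))) hlo (l * (m * ε))
    fun x hx => mul_le_mul_of_nonneg_left hx.le hl0.le
  rw [hexpo] at h1 h2
  refine (pr_mono hpm fun x hx => ?_).trans ((pr_or_le hpm _ _).trans (add_le_add h1 h2))
    |>.trans_eq (by ring)
  simp only [Finset.sum_sub_distrib, Finset.sum_const, Finset.card_univ, Fintype.card_fin,
    nsmul_eq_mul]
  rcases lt_abs.1 hx with h | h
  · exact Or.inr h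
  · exact Or.inl (by linarith)

/-- Hoeffding's lemma for a Bernoulli variable: the second derivative of its log moment generating
function is a Bernoulli variance, at most `1 / 4`. -/
theorem log_one_sub_add_mul_exp_le {b l : ℝ} (hb0 : 0 ≤ b) (hb1 : b ≤ 1) (hl : 0 ≤ l) :
    1 - b + b * Real.exp l ≤ Real.exp (l * b + l ^ 2 / 8) := by
  have hpos : ∀ x, 0 < 1 - b + b * Real.exp x := fun x => by
    rcases hb0.eq_or_lt with rfl | hb
    · simp
    · have := mul_pos hb (Real.exp_pos x)
      linarith
  have hd0 : ∀ x, HasDerivAt (fun x => 1 - b + b * Real.exp x) (b * Real.exp x) x := fun x =>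
    ((Real.hasDerivAt_exp x).const_mul b).const_add (1 - b)
  have hd1 : ∀ x, HasDerivAt (fun x => x * b + x ^ 2 / 8 - Real.log (1 - b + b * Real.exp x))
      (b + x / 4 - b * Real.exp x / (1 - b + b * Real.exp x)) x := by
    intro x
    have hid := hasDerivAt_id x
    refine (((hid.mul_const b).fun_add ((hid.fun_pow 2).div_const 8)).fun_sub
      ((hd0 x).log (hpos x).ne')).congr_deriv ?_
    simp
    ring
  have hd2 : ∀ x, HasDerivAt (fun x => b + x / 4 - b * Real.exp x / (1 - b + b * Real.exp x))
      (1 / 4 - (b * Real.exp x * (1 - b + b * Real.exp x) - b * Real.exp x * (b * Real.exp x)) /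
        (1 - b + b * Real.exp x) ^ 2) x := by
    intro x
    have hid := hasDerivAt_id x
    exact ((hid.div_const 4).const_add b).fun_sub
      (((Real.hasDerivAt_exp x).const_mul b).fun_div (hd0 x) (hpos x).ne')
  have h := nonneg_of_hasDerivAt_nonneg (by simp) hd1 (fun x hx =>
    nonneg_of_hasDerivAt_nonneg (by simp) hd2 (fun y _ => by
      have hp := hpos y
      rw [sub_nonneg, div_le_div_iff₀ (by positivity) (by norm_num)]
      nlinarith [sq_nonneg (1 - b - b * Real.exp y)]) hx.le) hl
  refine (Real.log_le_iff_le_exp (hpos l)).1 ?_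
  linarith

/-- By convexity of `exp`, a `[0, 1]`-valued function has no larger moment generating function than
the Bernoulli variable with the same mean. -/
theorem expect_exp_sum_le_hoeffding (hp : IsWeight p) (m : ℕ) (hf0 : ∀ a, 0 ≤ f a)
    (hf1 : ∀ a, f a ≤ 1) {l : ℝ} (hl : 0 ≤ l) :
    expect (piWeight p m) (fun x => Real.exp (l * ∑ k, (f (x k) - expect p f))) ≤
      Real.exp (m * (l ^ 2 / 8)) := by
  have hE0 : 0 ≤ expect p f := expect_nonneg hp hf0
  have hE1 : expect p f ≤ 1 := by rw [← expect_const hp 1]; exact expect_mono hp hf1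
  simp only [Finset.mul_sum, Real.exp_sum]
  rw [expect_piWeight_prod m fun a => Real.exp (l * (f a - expect p f)), Real.exp_nat_mul]
  refine pow_le_pow_left₀ (expect_nonneg hp fun a => (Real.exp_pos _).le) ?_ m
  have h1 : ∀ a, Real.exp (l * (f a - expect p f)) ≤
      Real.exp (-(l * expect p f)) * (1 + f a * (Real.exp l - 1)) := by
    intro a
    rw [mul_sub, sub_eq_add_neg, add_comm, Real.exp_add]
    refine mul_le_mul_of_nonneg_left ?_ (Real.exp_pos _).le
    have h2 := convexOn_exp.2 (Set.mem_univ l) (Set.mem_univ 0) (hf0 a)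
      (by linarith [hf1 a] : 0 ≤ 1 - f a) (by ring)
    simp only [smul_eq_mul, mul_zero, add_zero, Real.exp_zero, mul_one] at h2
    rw [mul_comm l]
    linarith
  refine (expect_mono hp h1).trans ?_
  rw [expect_const_mul, expect_add, expect_const hp, expect_mul_const]
  have h2 := log_one_sub_add_mul_exp_le hE0 hE1 hl
  have h3 := mul_le_mul_of_nonneg_left h2 (Real.exp_pos (-(l * expect p f))).le
  rw [← Real.exp_add] at h3
  refine le_trans (le_of_eq ?_) (h3.trans_eq ?_)
  · ring
  · congr 1
    ring

/-- Hoeffding's inequality. -/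
theorem pr_abs_sub_gt_le_hoeffding (hp : IsWeight p) (m : ℕ) (hf0 : ∀ a, 0 ≤ f a)
    (hf1 : ∀ a, f a ≤ 1) {ε : ℝ} (hε : 0 < ε) :
    pr (piWeight p m) (fun x => m * ε < |m * expect p f - ∑ k, f (x k)|) ≤
      2 * Real.exp (-(m * (2 * ε ^ 2))) := by
  have hpm := hp.piWeight m
  have hup := expect_exp_sum_le_hoeffding hp m hf0 hf1 (l := 4 * ε) (by positivity)
  have hlo := expect_exp_sum_le_hoeffding hp m (f := fun a => 1 - f a) (fun a => by linarith [hf1 a])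
    (fun a => by linarith [hf0 a]) (l := 4 * ε) (by positivity)
  have hexpo : m * ((4 * ε) ^ 2 / 8) - 4 * ε * (m * ε) = -(m * (2 * ε ^ 2)) := by ring
  have h1 := pr_le_exp hpm (A := fun x => m * ε < ∑ k, (f (x k) - expect p f)) hup
    (4 * ε * (m * ε)) fun x hx => mul_le_mul_of_nonneg_left hx.le (by positivity)
  have h2 := pr_le_exp hpm (A := fun x => m * ε < ∑ k, (1 - f (x k) - expect p fun a => 1 - f a))
    hlo (4 * ε * (m * ε)) fun x hx => mul_le_mul_of_nonneg_left hx.le (by positivity)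
  rw [hexpo] at h1 h2
  refine (pr_mono hpm fun x hx => ?_).trans ((pr_or_le hpm _ _).trans (add_le_add h1 h2))
    |>.trans_eq (by ring)
  simp only [expect_sub, expect_const hp, Finset.sum_sub_distrib, Finset.sum_const,
    Finset.card_univ, Fintype.card_fin, nsmul_eq_mul]
  rcases lt_abs.1 hx with h | h
  · exact Or.inr (by linarith)
  · exact Or.inl (by linarith)

end concentration

/-- A sample whose size is at least `sampleBound ε η ν ρ` approximates all the means. -/
theorem pr_exists_abs_sub_gt_le {Ω V : Type*} [Fintype Ω] [Fintype V] {p : Ω → ℝ}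
    (hp : IsWeight p) {f : V → Ω → ℝ} (hf0 : ∀ v a, 0 ≤ f v a) (hf1 : ∀ v a, f v a ≤ 1)
    {ε η ν ρ : ℝ} (hε : 0 < ε) (hε1 : ε < 1) (hη : 0 < η) (hν0 : 0 < ν) (hν : ν ≤ 1 / 4)
    (hvar : ∀ v, expect p (fun a => (f v a - expect p (f v)) ^ 2) ≤ ν)
    (hρ : ∑ v, expect p (f v) ≤ ρ) {m : ℕ} (hm : sampleBound ε η ν ρ ≤ m) :
    pr (piWeight p m) (fun x => ∃ v, m * ε < |m * expect p (f v) - ∑ k, f v (x k)|) ≤ η := by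
  have hpm := hp.piWeight m
  have hE0 : ∀ v, 0 ≤ expect p (f v) := fun v => expect_nonneg hp (hf0 v)
  have hρ0 : 0 ≤ ρ := (Finset.sum_nonneg fun v _ => hE0 v).trans hρ
  obtain ⟨h1pos, h1le, h1den⟩ := xHat1_mem hε hε1
  obtain ⟨h2pos, h2le, h2g⟩ := xHat2_mem hν0 hν
  -- The budget of `v` is proportional to its mean. A zero mean forces `f v = 0` on the support, so
  -- even budget `0` suffices.
  have hkey : ∀ v, pr (piWeight p m) (fun x => m * ε < |m * expect p (f v) - ∑ k, f v (x k)|) ≤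
      expect p (f v) * η / ρ := by
    intro v
    rcases (hE0 v).eq_or_lt with hb | hb
    · rw [← hb, zero_mul, zero_div, pr_eq_zero]
      intro x hx
      have h3 : ∀ k, f v (x k) = 0 := fun k =>
        eq_zero_of_expect_eq_zero hp (hf0 v) hb.symm (x k)
          (Finset.prod_ne_zero_iff.1 hx k (Finset.mem_univ k))
      simp only [h3, mul_zero, Finset.sum_const_zero, sub_zero, abs_zero, not_lt]
      positivity
    · have hρpos : 0 < ρ := hb.trans_le
        ((Finset.single_le_sum (fun v _ => hE0 v) (Finset.mem_univ v)).trans hρ)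
      rcases le_or_gt (expect p (f v)) (min (xHat1 ε) (xHat2 ν)) with hle | hgt
      · have hhalf := hle.trans ((min_le_left _ _).trans h1le)
        refine (pr_abs_sub_gt_le_bennett hp m (hf0 v) (hf1 v) hε (gFun_pos hb hhalf) ?_).trans
          (two_mul_exp_le_of_sampleBound_le hε hε1 hη hρpos hm hb hle)
        have h4 : ∀ a, (f v a - expect p (f v)) ^ 2 ≤
            f v a - 2 * expect p (f v) * f v a + expect p (f v) ^ 2 := fun a => by
          nlinarith [hf0 v a, hf1 v a]
        refine (expect_mono hp h4).trans ?_
        rw [expect_add, expect_sub, expect_const_mul, expect_const hp]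
        unfold gFun
        linarith
      -- Beyond `x̂` the budget is at least that of `x̂`. If `x̂ = x̂₁`, Hoeffding's exponent `2 ε²`
      -- is at least the one prescribed there; if `x̂ = x̂₂`, Bennett's inequality applies with
      -- variance `ν = g x̂₂`.
      · have hmono : min (xHat1 ε) (xHat2 ν) * η / ρ ≤ expect p (f v) * η / ρ := by
          gcongr
        refine le_trans ?_ hmono
        rcases le_or_gt (xHat1 ε) (xHat2 ν) with h12 | h12
        · have h5 := two_mul_exp_le_of_sampleBound_le hε hε1 hη hρpos hm h1pos
            (le_min le_rfl h12)
          rw [min_eq_left h12]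
          refine (pr_abs_sub_gt_le_hoeffding hp m (hf0 v) (hf1 v) hε).trans (le_trans ?_ h5)
          have h6 := mul_le_mul_of_nonneg_left h1den (Nat.cast_nonneg (α := ℝ) m)
          have := Real.exp_le_exp.2 (neg_le_neg h6)
          linarith
        · have h5 := two_mul_exp_le_of_sampleBound_le hε hε1 hη hρpos hm h2pos
            (le_min h12.le le_rfl)
          rw [min_eq_right h12.le]
          refine (pr_abs_sub_gt_le_bennett hp m (hf0 v) (hf1 v) hε (v := gFun (xHat2 ν))
            (by rw [h2g]; exact hν0) (by rw [h2g]; exact hvar v)).trans h5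
  refine (pr_exists_le hpm _).trans ((Finset.sum_le_sum fun v _ => hkey v).trans ?_)
  rw [← Finset.sum_div, ← Finset.sum_mul]
  rcases hρ0.eq_or_lt with h | h
  -- If `ρ = 0`, the summed budget is a division by zero, read as `0`.
  · rw [← h, div_zero]
    exact hη.le
  · rw [div_le_iff₀ h, mul_comm η]
    exact mul_le_mul_of_nonneg_right hρ hη.le


/-! ### Bags of shortest paths -/

section bags

variable {V : Type*} [Fintype V] [DecidableEq V] {G : Digraph V} {α : ℝ}

instance instFintypeBag (G : Digraph V) (α : ℝ) : Fintype (Bag G α) :=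
  inferInstanceAs (Fintype (Σ p : {p : V × V // p.1 ≠ p.2},
    Fin (bagSize G α p.1.1 p.1.2) → {π : List V // π ∈ shortestPaths G p.1.1 p.1.2}))

instance instMeasurableSingletonClassBag (G : Digraph V) (α : ℝ) :
    MeasurableSingletonClass (Bag G α) := ⟨fun _ => trivial⟩

theorem pathFrac_nonneg (v : V) (τ : Bag G α) : 0 ≤ pathFrac v τ :=
  mul_nonneg (by positivity) (Finset.sum_nonneg fun i _ => by split_ifs <;> norm_num)

theorem one_div_mul_sum_le {k : ℕ} {g : Fin k → ℝ} {d : ℝ} (hd : 0 ≤ d) (h : ∀ i, g i ≤ d) :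
    1 / (k : ℝ) * ∑ i, g i ≤ d := by
  rcases Nat.eq_zero_or_pos k with rfl | hk
  · simpa using hd
  · have hk' : (0 : ℝ) < k := by exact_mod_cast hk
    rw [one_div_mul_eq_div, div_le_iff₀ hk']
    refine (Finset.sum_le_sum fun i _ => h i).trans_eq ?_
    simp [mul_comm]

theorem pathFrac_le_one (v : V) (τ : Bag G α) : pathFrac v τ ≤ 1 :=
  one_div_mul_sum_le zero_le_one fun i => by split_ifs <;> norm_num

theorem length_le_vertexDiameter {V : Type*} [Fintype V] {G : Digraph V} {s t : V} {π : List V} (h : π ∈ shortestPaths G s t) :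
    π.length ≤ vertexDiameter G := by
  refine le_trans ?_ (Finset.le_sup (f := fun s : V => Finset.univ.sup fun t : V =>
    (shortestPaths G s t).sup List.length) (Finset.mem_univ s))
  refine le_trans ?_ (Finset.le_sup (f := fun t : V =>
    (shortestPaths G s t).sup List.length) (Finset.mem_univ t))
  exact Finset.le_sup (f := List.length) h

/-- Each path contributes at most its number of nodes. Dividing by `D` makes `∑ v, f_v` a `[0,
1]`-valued function. -/
theorem sum_pathFrac_le {D : ℕ} (hD : vertexDiameter G ≤ D) (τ : Bag G α) :
    ∑ v, pathFrac v τ ≤ D := by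
  unfold pathFrac
  rw [← Finset.mul_sum, Finset.sum_comm]
  refine one_div_mul_sum_le (Nat.cast_nonneg D) fun i => ?_
  have h1 : ∑ v : V, (if v ∈ (τ.2 i).1 ∧ v ≠ τ.1.1.1 ∧ v ≠ τ.1.1.2 then (1 : ℝ) else 0) ≤
      ∑ v : V, if v ∈ (τ.2 i).1.toFinset then (1 : ℝ) else 0 := by
    refine Finset.sum_le_sum fun v _ => ?_
    by_cases h : v ∈ (τ.2 i).1
    · simp only [h, true_and, List.mem_toFinset, if_true]
      split_ifs <;> norm_num
    · simp [h]
  refine h1.trans ?_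
  rw [Finset.sum_ite_mem, Finset.univ_inter, Finset.sum_const, nsmul_eq_mul, mul_one]
  exact_mod_cast (List.toFinset_card_le _).trans ((length_le_vertexDiameter (τ.2 i).2).trans hD)

theorem one_le_vertexDiameter {V : Type*} [Fintype V] [Nontrivial V] (G : Digraph V) : 1 ≤ vertexDiameter G := by
  obtain ⟨s⟩ := (inferInstance : Nonempty V)
  have h : [s] ∈ shortestPaths G s s := by
    rw [shortestPaths, Set.Finite.mem_toFinset]
    refine ⟨by simp [IsWalk], fun q hq => ?_⟩
    have : q ≠ [] := by
      rintro rfl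
      simp [IsWalk] at hq
    exact List.length_pos_iff.2 this
  simpa using length_le_vertexDiameter h

variable [Nontrivial V]

/-- The weight of the law of one sampled bag. -/
def bagWeight (G : Digraph V) (α : ℝ) (τ : Bag G α) : ℝ := (bagMeasure G α).real {τ}

theorem isWeight_bagWeight (G : Digraph V) (α : ℝ) : IsWeight (bagWeight G α) where
  nonneg _ := measureReal_nonneg
  sum_eq_one := by
    unfold bagWeight
    rw [sum_measureReal_singleton]
    simp

theorem bagWeight_eq (τ : Bag G α) : bagWeight G α τ = (bagPMF G α τ).toReal :=
  congrArg ENNReal.toReal (PMF.toMeasure_apply_singleton _ _ (measurableSet_singleton _))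

/-- The power exhibits the paths of a bag, given its pair, as independent coordinates, so the
results on `piWeight` apply to them. -/
theorem bagWeight_mk (p : {p : V × V // p.1 ≠ p.2})
    (d : Fin (bagSize G α p.1.1 p.1.2) → {π : List V // π ∈ shortestPaths G p.1.1 p.1.2}) :
    bagWeight G α ⟨p, d⟩ = 1 / (Fintype.card {p : V × V // p.1 ≠ p.2} : ℝ) *
      (1 / (numSP G p.1.1 p.1.2 : ℝ)) ^ bagSize G α p.1.1 p.1.2 := by
  have h : bagPMF G α ⟨p, d⟩ = (Fintype.card {p : V × V // p.1 ≠ p.2} : ENNReal)⁻¹ *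
      (Fintype.card (Fin (bagSize G α p.1.1 p.1.2) →
        {π : List V // π ∈ shortestPaths G p.1.1 p.1.2}) : ENNReal)⁻¹ := by
    refine (PMF.bind_apply _ _ _).trans ((tsum_eq_single p ?_).trans ?_)
    · intro p' hp'
      refine mul_eq_zero_of_right _ ((PMF.map_apply _ _ _).trans (ENNReal.tsum_eq_zero.2 ?_))
      intro d'
      rw [if_neg]
      intro heq
      exact hp' (Sigma.mk.inj heq).1.symm
    · refine congrArg₂ (· * ·) (PMF.uniformOfFintype_apply _)
        ((PMF.map_apply _ _ _).trans ((tsum_eq_single d ?_).trans ?_))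
      · intro d' hd'
        rw [if_neg]
        intro heq
        exact hd' (eq_of_heq (Sigma.mk.inj heq).2).symm
      · exact (if_pos rfl).trans (PMF.uniformOfFintype_apply _)
  refine (bagWeight_eq _).trans ?_
  rw [h, ENNReal.toReal_mul, ENNReal.toReal_inv, ENNReal.toReal_inv, ENNReal.toReal_natCast,
    ENNReal.toReal_natCast, one_div]
  congr 1
  simp [numSP]

theorem expect_bagWeight (F : Bag G α → ℝ) :
    expect (bagWeight G α) F = 1 / (Fintype.card {p : V × V // p.1 ≠ p.2} : ℝ) *
      ∑ p : {p : V × V // p.1 ≠ p.2},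
        expect (piWeight (fun _ : {π : List V // π ∈ shortestPaths G p.1.1 p.1.2} =>
          1 / (numSP G p.1.1 p.1.2 : ℝ)) (bagSize G α p.1.1 p.1.2)) fun d => F ⟨p, d⟩ := by
  have h : expect (bagWeight G α) F = ∑ p : {p : V × V // p.1 ≠ p.2},
      ∑ d : Fin (bagSize G α p.1.1 p.1.2) → {π : List V // π ∈ shortestPaths G p.1.1 p.1.2},
        bagWeight G α ⟨p, d⟩ * F ⟨p, d⟩ := Fintype.sum_sigma _
  rw [h, Finset.mul_sum]
  refine Finset.sum_congr rfl fun p _ => ?_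
  rw [expect, Finset.mul_sum]
  refine Finset.sum_congr rfl fun d _ => ?_
  rw [bagWeight_mk, piWeight, Finset.prod_const, Finset.card_univ, Fintype.card_fin, mul_assoc]

theorem card_pairs (V : Type*) [Fintype V] [DecidableEq V] : (Fintype.card {p : V × V // p.1 ≠ p.2} : ℝ) =
    (Fintype.card V : ℝ) * ((Fintype.card V : ℝ) - 1) := by
  have h : Fintype.card {p : V × V // p.1 ≠ p.2} = (Finset.univ : Finset V).offDiag.card :=
    Fintype.card_of_subtype _ fun p => by simp
  rw [h, Finset.offDiag_card, Finset.card_univ, Nat.cast_sub (Nat.le_mul_self _), Nat.cast_mul]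
  ring

/-- The functions `f_v` are unbiased estimators of the betweenness centralities. -/
theorem expect_pathFrac (hα : 1 ≤ α) (v : V) :
    expect (bagWeight G α) (pathFrac v) = betweenness G v := by
  rw [expect_bagWeight, card_pairs, betweenness, ← Fintype.sum_prod_type'
    (f := fun s t : V => if s ≠ t ∧ s ≠ v ∧ v ≠ t then (numSPThrough G s t v : ℝ) / (numSP G s t : ℝ) else 0)]
  congr 1
  have hsplit : ∑ x : V × V, (if x.1 ≠ x.2 ∧ x.1 ≠ v ∧ v ≠ x.2 then
        (numSPThrough G x.1 x.2 v : ℝ) / (numSP G x.1 x.2 : ℝ) else 0) =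
      ∑ p : {p : V × V // p.1 ≠ p.2}, if p.1.1 ≠ v ∧ v ≠ p.1.2 then
        (numSPThrough G p.1.1 p.1.2 v : ℝ) / (numSP G p.1.1 p.1.2 : ℝ) else 0 := by
    rw [← Finset.sum_subtype (Finset.univ.filter fun p : V × V => p.1 ≠ p.2) (by simp)
      (fun x : V × V => if x.1 ≠ v ∧ v ≠ x.2 then
        (numSPThrough G x.1 x.2 v : ℝ) / (numSP G x.1 x.2 : ℝ) else 0), Finset.sum_filter]
    refine Finset.sum_congr rfl fun x _ => ?_
    by_cases h : x.1 ≠ x.2 <;> simp [h]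
  rw [hsplit]
  refine Finset.sum_congr rfl fun p _ => ?_
  obtain ⟨⟨s, t⟩, hst⟩ := p
  simp only [pathFrac]
  -- For an unreachable pair the bag is empty, and both sides are `0` by the convention `0 / 0 = 0`.
  rcases Nat.eq_zero_or_pos (numSP G s t) with h0 | hpos
  · have hb : bagSize G α s t = 0 := by simp [bagSize, h0]
    have : (bagSize G α s t : ℝ) = 0 := by exact_mod_cast hb
    simp [this, h0, expect]
  · have hpos' : (0 : ℝ) < numSP G s t := by exact_mod_cast hpos
    have hb : 0 < bagSize G α s t := Nat.ceil_pos.2 (by positivity)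
    have hb' : (bagSize G α s t : ℝ) ≠ 0 := by positivity
    have hu : IsWeight (fun _ : {π : List V // π ∈ shortestPaths G s t} => 1 / (numSP G s t : ℝ)) :=
      ⟨fun _ => by positivity, by simp [numSP] at hpos' ⊢; field_simp⟩
    rw [expect_const_mul, expect_piWeight_sum_apply hu _
      (fun π : {π : List V // π ∈ shortestPaths G s t} => if v ∈ π.1 ∧ v ≠ s ∧ v ≠ t then (1 : ℝ) else 0),
      ← mul_assoc, one_div_mul_cancel hb', one_mul, expect]
    by_cases hv : s ≠ v ∧ v ≠ t
    · rw [if_pos hv]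
      have h1 : ∀ π : {π : List V // π ∈ shortestPaths G s t},
          (if v ∈ π.1 ∧ v ≠ s ∧ v ≠ t then (1 : ℝ) else 0) = if v ∈ π.1 then 1 else 0 := fun π => by
        simp [hv.1.symm, hv.2]
      simp only [h1]
      rw [← Finset.mul_sum, numSPThrough, Finset.card_filter,
        Finset.sum_coe_sort (shortestPaths G s t) fun π => if v ∈ π then (1 : ℝ) else 0]
      push_cast
      ring
    · rw [if_neg hv]
      refine Finset.sum_eq_zero fun π _ => ?_
      rw [if_neg, mul_zero]
      rintro ⟨-, h1, h2⟩
      exact hv ⟨h1.symm, h2⟩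

end bags

/-! ### The computed bounds in terms of unnormalized sums -/

section scaling

variable {V : Type*} [Finite V] [DecidableEq V] {G : Digraph V} {α : ℝ} {c m : ℕ}

theorem mul_estimate (hm : 1 ≤ m) (S : Fin m → Bag G α) (v : V) :
    m * estimate S v = ∑ k, pathFrac v (S k) := by
  have hm' : (m : ℝ) ≠ 0 := by positivity
  unfold estimate
  field_simp

theorem mul_wimpy (hm : 1 ≤ m) (S : Fin m → Bag G α) (A : Set V) :
    m * wimpy S A = ⨆ v : A, ∑ k, pathFrac (v : V) (S k) ^ 2 := by
  have hm' : (m : ℝ) ≠ 0 := by positivity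
  unfold wimpy
  rw [Real.mul_iSup_of_nonneg (Nat.cast_nonneg m)]
  congr 1
  funext v
  field_simp

theorem mul_mcera (hm : 1 ≤ m) (S : Fin m → Bag G α) (σ : Fin c → Fin m → Bool) (A : Set V) :
    m * mcera S σ A =
      1 / (c : ℝ) * ∑ x, ⨆ v : A, ∑ k, sign (σ x k) * pathFrac (v : V) (S k) := by
  have hm' : (m : ℝ) ≠ 0 := by positivity
  unfold mcera
  rw [mul_left_comm, Finset.mul_sum]
  congr 1
  refine Finset.sum_congr rfl fun x _ => ?_
  rw [Real.mul_iSup_of_nonneg (Nat.cast_nonneg m)]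
  congr 1
  funext v
  field_simp

theorem mul_sqrt_eq {m a b : ℝ} (hm : 0 ≤ m) (h : m ^ 2 * a = b) : m * √a = √b := by
  rw [← h, Real.sqrt_mul (sq_nonneg m), Real.sqrt_sq hm]

theorem mul_varBound (hm : 1 ≤ m) (S : Fin m → Bag G α) (A : Set V) (L : ℝ) :
    m * varBound S A L = varSum (fun (v : A) τ => pathFrac (v : V) τ) S L := by
  have hm' : (m : ℝ) ≠ 0 := by positivity
  unfold varBound varSum
  rw [mul_add, mul_add, mul_wimpy hm, mul_div_cancel₀ _ hm', ← mul_wimpy hm]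
  congr 1
  refine mul_sqrt_eq (Nat.cast_nonneg m) ?_
  field_simp

theorem mul_radTilde (hm : 1 ≤ m) (S : Fin m → Bag G α) (σ : Fin c → Fin m → Bool) (A : Set V)
    (L : ℝ) : m * radTilde S σ A L = radMC (fun (v : A) τ => pathFrac (v : V) τ) S σ L := by
  have hm' : (m : ℝ) ≠ 0 := by positivity
  unfold radTilde radMC
  rw [mul_add, mul_mcera hm, ← mul_wimpy hm]
  congr 1
  refine mul_sqrt_eq (Nat.cast_nonneg m) ?_
  field_simp

theorem mul_radBound (hm : 1 ≤ m) (S : Fin m → Bag G α) (σ : Fin c → Fin m → Bool) (A : Set V)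
    (L : ℝ) : m * radBound S σ A L = radSum (fun (v : A) τ => pathFrac (v : V) τ) S σ L := by
  have hm' : (m : ℝ) ≠ 0 := by positivity
  unfold radBound radSum
  rw [← mul_radTilde hm, mul_add, mul_add, mul_div_cancel₀ _ hm']
  congr 1
  refine mul_sqrt_eq (Nat.cast_nonneg m) ?_
  field_simp

/-- The formulas are homogeneous of degree one under scaling by `m`, which turns every `L / m` into
`L` and yields the unnormalized sums of the concentration bounds. -/
theorem mul_epsBound (hm : 1 ≤ m) (S : Fin m → Bag G α) (σ : Fin c → Fin m → Bool) (A : Set V)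
    (L : ℝ) : m * epsBound S σ A L = devSum (fun (v : A) τ => pathFrac (v : V) τ) S σ L := by
  have hm' : (m : ℝ) ≠ 0 := by positivity
  unfold epsBound devSum
  rw [← mul_radBound hm, ← mul_varBound hm, mul_add, mul_add, mul_left_comm]
  congr 1
  · congr 1
    refine mul_sqrt_eq (Nat.cast_nonneg m) ?_
    field_simp
  · field_simp

end scaling

/-! ### The upper confidence bound for the sum of the betweenness centralities -/

/-- After division by `D`, the first formula dominates the self-bounding estimate, whose constants
`1` and `1` are replaced by the larger `5 / 3` (under the root) and `4 / 3`. The second is the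
empirical Bernstein inequality, whose failure probability `2 exp (-L)` explains `log (2 / η)`. -/
theorem pr_rhoBound_lt_le {V : Type*} [Fintype V] [DecidableEq V] [Nontrivial V] {G : Digraph V}
    {α : ℝ} {m : ℕ} (hm : 1 ≤ m) {D : ℕ} (hD : vertexDiameter G ≤ D) (meth : RhoMethod)
    (hmeth : meth = RhoMethod.empiricalBernstein → 2 ≤ m) {η : ℝ} (hη0 : 0 < η) (hη1 : η < 1) :
    pr (piWeight (bagWeight G α) m) (fun S => rhoBound S D η meth <
      ∑ v, expect (bagWeight G α) (pathFrac v)) ≤ η := by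
  have hp := isWeight_bagWeight G α
  have hm0 : (0 : ℝ) < m := by exact_mod_cast hm
  have hD0 : (0 : ℝ) < D := by exact_mod_cast (one_le_vertexDiameter G).trans hD
  let X : Bag G α → ℝ := fun τ => (∑ v, pathFrac v τ) / D
  have hX : ∀ τ, ∑ v, pathFrac v τ = D * X τ := fun τ => (mul_div_cancel₀ _ hD0.ne').symm
  have hX0 : ∀ τ, 0 ≤ X τ := fun τ =>
    div_nonneg (Finset.sum_nonneg fun v _ => pathFrac_nonneg v τ) hD0.le
  have hX1 : ∀ τ, X τ ≤ 1 := fun τ => (div_le_one hD0).2 (sum_pathFrac_le hD τ)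
  have hE : ∑ v, expect (bagWeight G α) (pathFrac v) = D * expect (bagWeight G α) X := by
    rw [← expect_sum, ← expect_const_mul]
    congr 1
    funext τ
    exact hX τ
  have htilde : ∀ S : Fin m → Bag G α, rhoTilde S = D * (1 / (m : ℝ) * ∑ k, X (S k)) := by
    intro S
    unfold rhoTilde estimate
    rw [← Finset.mul_sum, Finset.sum_comm]
    simp only [hX, ← Finset.mul_sum]
    ring
  rw [hE]
  cases meth with
  | bernstein =>
    have hL : 0 < Real.log (1 / η) := Real.log_pos (by rw [lt_div_iff₀ hη0]; linarith)
    have h := pr_sum_add_sqrt_lt_le hp m hX0 hX1 hL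
    rw [Real.exp_neg, Real.exp_log (by positivity), one_div, inv_inv] at h
    refine (pr_mono (hp.piWeight m) fun S hS => ?_).trans h
    rw [← one_div]
    simp only [rhoBound, htilde] at hS
    set L := Real.log (1 / η) with hLdef
    set T := ∑ k, X (S k) with hT
    have hT0 : 0 ≤ T := Finset.sum_nonneg fun k _ => hX0 _
    have h1 := mul_lt_mul_of_pos_left hS (div_pos hm0 hD0)
    refine lt_of_le_of_lt ?_ (h1.trans_eq (by field_simp))
    rw [mul_add, mul_add, mul_sqrt_eq (m := (m : ℝ) / D)
      (b := 5 / 3 * L ^ 2 + 2 * L * T) (by positivity) (by field_simp)]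
    have h2 : (m : ℝ) / D * (D * (1 / m * T)) = T := by field_simp
    have h3 : (m : ℝ) / D * (4 * D * L / (3 * m)) = 4 / 3 * L := by field_simp
    rw [h2, h3]
    have h4 : √(L ^ 2 + 2 * L * T) ≤ √(5 / 3 * L ^ 2 + 2 * L * T) :=
      Real.sqrt_le_sqrt (by nlinarith)
    linarith
  | empiricalBernstein =>
    have hm2 := hmeth rfl
    have hm2' : (2 : ℝ) ≤ m := by exact_mod_cast hm2
    have hL : 0 < Real.log (2 / η) := Real.log_pos (by rw [lt_div_iff₀ hη0]; linarith)
    have h := pr_empiricalBernstein_le hp hm2 hX0 hX1 hL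
    rw [Real.exp_neg, Real.exp_log (by positivity), inv_div, mul_div_cancel₀ _ two_ne_zero] at h
    refine (pr_mono (hp.piWeight m) fun S hS => ?_).trans h
    have hΛ : lambdaVar S = D ^ 2 * sampleVar X S := by
      unfold lambdaVar sampleVar
      simp only [hX, ← mul_sub, mul_pow]
      rw [mul_left_comm]
      congr 1
      rw [Finset.mul_sum]
      refine Finset.sum_congr rfl fun i _ => ?_
      rw [Finset.mul_sum]
      refine Finset.sum_congr rfl fun j _ => ?_
      rw [mul_ite, mul_zero]
    simp only [rhoBound, htilde, hΛ] at hS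
    rw [← mul_sqrt_eq (m := (D : ℝ)) (a := 2 * sampleVar X S * Real.log (2 / η) / m) hD0.le
      (by ring), show 7 * (D : ℝ) * Real.log (2 / η) / (3 * ((m : ℝ) - 1)) =
        D * (7 * Real.log (2 / η) / (3 * ((m : ℝ) - 1))) by ring, ← mul_add, ← mul_add] at hS
    exact lt_of_mul_lt_mul_left hS hD0.le


/-! ### The law of a run -/

/-- If the fibres of `φ` have at most the weight `p`, then so do the preimages of all events. -/
theorem measure_le_ofReal_pr {X Ω : Type*} [MeasurableSpace X] [Fintype Ω] (μ : Measure X)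
    (φ : X → Ω) {p : Ω → ℝ} (hp : ∀ a, 0 ≤ p a)
    (h : ∀ a, μ (φ ⁻¹' {a}) ≤ ENNReal.ofReal (p a)) (A : Ω → Prop) :
    μ {x | A (φ x)} ≤ ENNReal.ofReal (pr p A) := by
  classical
  have hset : {x | A (φ x)} ⊆ ⋃ a ∈ Finset.univ.filter A, φ ⁻¹' {a} := fun x hx => by
    simpa using hx
  refine (measure_mono hset).trans ((measure_biUnion_finset_le _ _).trans ?_)
  refine (Finset.sum_le_sum fun a _ => h a).trans (le_of_eq ?_)
  rw [← ENNReal.ofReal_sum_of_nonneg fun a _ => hp a]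
  congr 1
  rw [pr, expect, Finset.sum_filter]
  refine Finset.sum_congr rfl fun a _ => ?_
  by_cases ha : A a <;> simp [ha]

theorem signMeasure_singleton (b : Bool) : signMeasure {b} = ENNReal.ofReal (boolWeight b) := by
  rw [signMeasure, PMF.toMeasure_apply_singleton _ _ (measurableSet_singleton _),
    PMF.uniformOfFintype_apply]
  simp [boolWeight]

section run

variable {V : Type*} [Fintype V] [DecidableEq V] [Nontrivial V]

theorem bagMeasure_singleton (G : Digraph V) (α : ℝ) (τ : Bag G α) :
    bagMeasure G α {τ} = ENNReal.ofReal (bagWeight G α τ) :=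
  (ofReal_measureReal (measure_ne_top _ _)).symm

/-- The first `m` bags determine a cylinder, and the product measure of a cylinder is a finite
product; an upper bound is all that is needed later. -/
theorem infinitePi_bagMeasure_le (G : Digraph V) (α : ℝ) {m : ℕ} (x : Fin m → Bag G α) :
    Measure.infinitePi (fun _ : ℕ => bagMeasure G α) {τ | (fun k : Fin m => τ k) = x} ≤
      ENNReal.ofReal (piWeight (bagWeight G α) m x) := by
  let t : ℕ → Set (Bag G α) := fun i => if h : i < m then {x ⟨i, h⟩} else Set.univ
  have hsub : {τ : ℕ → Bag G α | (fun k : Fin m => τ k) = x} ⊆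
      Set.pi (Finset.range m : Set ℕ) t := by
    rintro τ rfl i hi
    have hi' : i < m := by simpa using hi
    simp [t, hi']
  refine (measure_mono hsub).trans ?_
  rw [Measure.infinitePi_pi (t := t) _ fun i _ => MeasurableSet.of_discrete, Finset.prod_range, piWeight,
    ENNReal.ofReal_prod_of_nonneg fun i _ => (isWeight_bagWeight G α).nonneg _]
  refine Finset.prod_le_prod' fun i _ => ?_
  simp [t, bagMeasure_singleton]

theorem infinitePi_signMeasure_le {c m : ℕ} (s : Fin c → Fin m → Bool) :
    Measure.infinitePi (fun _ : Fin c × ℕ => signMeasure)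
        {σ | (fun (r : Fin c) (k : Fin m) => σ (r, k)) = s} ≤
      ENNReal.ofReal (piWeight (piWeight boolWeight m) c s) := by
  let t : Fin c × ℕ → Set Bool := fun i => if h : i.2 < m then {s i.1 ⟨i.2, h⟩} else Set.univ
  have hsub : {σ : Fin c × ℕ → Bool | (fun (r : Fin c) (k : Fin m) => σ (r, k)) = s} ⊆
      Set.pi ((Finset.univ ×ˢ Finset.range m : Finset (Fin c × ℕ)) : Set (Fin c × ℕ)) t := by
    rintro σ rfl i hi
    have hi' : i.2 < m := by simpa using hi
    simp [t, hi']
  refine (measure_mono hsub).trans ?_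
  rw [Measure.infinitePi_pi (t := t) _ fun i _ => MeasurableSet.of_discrete, Finset.prod_product, piWeight,
    ENNReal.ofReal_prod_of_nonneg fun i _ => (isWeight_boolWeight.piWeight m).nonneg _]
  refine Finset.prod_le_prod' fun r _ => ?_
  rw [Finset.prod_range, piWeight,
    ENNReal.ofReal_prod_of_nonneg fun i _ => isWeight_boolWeight.nonneg _]
  refine Finset.prod_le_prod' fun k _ => ?_
  simp [t, signMeasure_singleton]

/-- The law of the randomness of the second phase. -/
def streamMeasure (G : Digraph V) (α : ℝ) (c : ℕ) :
    Measure ((ℕ → Bag G α) × (Fin c × ℕ → Bool)) :=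
  (Measure.infinitePi fun _ : ℕ => bagMeasure G α).prod
    (Measure.infinitePi fun _ : Fin c × ℕ => signMeasure)

instance instIsProbabilityMeasureStream (G : Digraph V) (α : ℝ) (c : ℕ) :
    IsProbabilityMeasure (streamMeasure G α c) := by
  unfold streamMeasure
  infer_instance

instance instIsProbabilityMeasureRun (G : Digraph V) (α : ℝ) (c m' : ℕ) :
    IsProbabilityMeasure (runMeasure G α c m') := by
  unfold runMeasure
  infer_instance

/-- An event on a finite window is a finite union of cylinder rectangles, so finite-sum estimates
carry over to the infinite streams. -/
theorem streamMeasure_le (G : Digraph V) (α : ℝ) (c m : ℕ)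
    (A : (Fin m → Bag G α) × (Fin c → Fin m → Bool) → Prop) :
    streamMeasure G α c {ω | A (fun k => ω.1 k, fun r k => ω.2 (r, k))} ≤ ENNReal.ofReal
      (pr (prodWeight (piWeight (bagWeight G α) m) (piWeight (piWeight boolWeight m) c)) A) := by
  have hw := ((isWeight_bagWeight G α).piWeight m)
  have hs := (isWeight_boolWeight.piWeight m).piWeight c
  refine measure_le_ofReal_pr _ (fun ω : (ℕ → Bag G α) × (Fin c × ℕ → Bool) =>
    ((fun k : Fin m => ω.1 k, fun (r : Fin c) (k : Fin m) => ω.2 (r, (k : ℕ))) :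
      (Fin m → Bag G α) × (Fin c → Fin m → Bool))) (hw.prodWeight hs).nonneg (fun z => ?_) A
  have hset : (fun ω : (ℕ → Bag G α) × (Fin c × ℕ → Bool) =>
      ((fun k : Fin m => ω.1 k, fun (r : Fin c) (k : Fin m) => ω.2 (r, (k : ℕ))) :
        (Fin m → Bag G α) × (Fin c → Fin m → Bool))) ⁻¹' {z} =
      {τ | (fun k : Fin m => τ k) = z.1} ×ˢ
        {σ | (fun (r : Fin c) (k : Fin m) => σ (r, (k : ℕ))) = z.2} := by
    ext ω
    simp [Prod.ext_iff]
  rw [hset, streamMeasure, Measure.prod_prod, prodWeight, ENNReal.ofReal_mul (hw.nonneg _)]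
  exact mul_le_mul' (infinitePi_bagMeasure_le G α z.1) (infinitePi_signMeasure_le z.2)

/-- Conditioning on `S'` by splitting into its finitely many values and using subadditivity, in
place of Fubini's theorem. Nothing is asked of how `B` depends on `S'`. -/
theorem runMeasure_le (G : Digraph V) (α : ℝ) (c m' : ℕ) (B : Set (Run G α c m'))
    (q : (Fin m' → Bag G α) → ℝ) (hq0 : ∀ S, 0 ≤ q S)
    (hq : ∀ S, streamMeasure G α c {ω | (S, ω) ∈ B} ≤ ENNReal.ofReal (q S)) :
    runMeasure G α c m' B ≤ ENNReal.ofReal (expect (piWeight (bagWeight G α) m') q) := by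
  have hw := ((isWeight_bagWeight G α).piWeight m')
  have hset : B ⊆ ⋃ S ∈ (Finset.univ : Finset (Fin m' → Bag G α)),
      {S} ×ˢ {ω | (S, ω) ∈ B} := fun ω hω => by simpa using hω
  refine (measure_mono hset).trans ((measure_biUnion_finset_le _ _).trans ?_)
  rw [expect, ENNReal.ofReal_sum_of_nonneg fun S _ => mul_nonneg (hw.nonneg S) (hq0 S)]
  refine Finset.sum_le_sum fun S _ => ?_
  rw [ENNReal.ofReal_mul (hw.nonneg S)]
  change ((Measure.pi fun _ : Fin m' => bagMeasure G α).prod (streamMeasure G α c)) _ ≤ _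
  rw [Measure.prod_prod, Measure.pi_singleton]
  refine mul_le_mul' (le_of_eq ?_) (hq S)
  rw [piWeight, ENNReal.ofReal_prod_of_nonneg fun i _ => (isWeight_bagWeight G α).nonneg _]
  exact Finset.prod_congr rfl fun i _ => bagMeasure_singleton G α _

end run

/-! ### Correctness of the two phases -/

section correctness

variable {V : Type*} [Fintype V] [DecidableEq V] [Nontrivial V] {G : Digraph V} {α : ℝ} {c : ℕ}

theorem pr_exists_epsBound_lt_le (hα : 1 ≤ α) (hc : 1 ≤ c) {m : ℕ} (hm : 1 ≤ m) (A : Set V) {L : ℝ}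
    (hL : 0 < L) :
    pr (prodWeight (piWeight (bagWeight G α) m) (piWeight (piWeight boolWeight m) c)) (fun z =>
      ∃ v ∈ A, epsBound z.1 z.2 A L < |betweenness G v - estimate z.1 v|) ≤ 5 * Real.exp (-L) := by
  have hp := isWeight_bagWeight G α
  have hpw := (hp.piWeight m).prodWeight ((isWeight_boolWeight.piWeight m).piWeight c)
  have hm0 : (0 : ℝ) < m := by exact_mod_cast hm
  rcases A.eq_empty_or_nonempty with hA | hA
  · rw [pr_eq_zero]
    · positivity
    · rintro z - ⟨v, hv, -⟩
      simp [hA] at hv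
  · have : Nonempty A := hA.to_subtype
    refine (pr_mono hpw ?_).trans (pr_devSum_lt_le (f := fun (v : A) τ => pathFrac (v : V) τ) hp m hc
      (fun v τ => pathFrac_nonneg _ τ) (fun v τ => pathFrac_le_one _ τ) hL)
    rintro z ⟨v, hv, hlt⟩
    refine ⟨⟨v, hv⟩, ?_⟩
    rw [← mul_epsBound hm]
    have h1 := mul_lt_mul_of_pos_left hlt hm0
    rw [← abs_of_pos hm0, ← abs_mul, abs_of_pos hm0, mul_sub, mul_estimate hm,
      ← expect_pathFrac hα] at h1
    exact h1

/-- The confidence of the deviation bounds of one iteration. -/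
theorem streamMeasure_iteration_le (hα : 1 ≤ α) (hc : 1 ≤ c) {δ : ℝ} (hδ0 : 0 < δ) (hδ1 : δ < 1)
    (P : Peeling V) {ms : ℕ → ℕ} (hms : IsSchedule ms) {i : ℕ} (hi : 1 ≤ i) :
    streamMeasure G α c {ω | ∃ v, epsAt δ P ms ω.1 ω.2 i (P.part v) <
      |betweenness G v - estimate (fun k : Fin (ms i) => ω.1 k) v|} ≤
      ENNReal.ofReal (δ / 2 ^ (i + 1)) := by
  have hpw := ((isWeight_bagWeight G α).piWeight (ms i)).prodWeight
    ((isWeight_boolWeight.piWeight (ms i)).piWeight c)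
  have hm : 1 ≤ ms i := hms.2.1.trans (hms.2.2.1 hi)
  have ht : 0 < P.t := by
    obtain ⟨v⟩ := (inferInstance : Nonempty V)
    exact (Nat.zero_le _).trans_lt (P.part v).2
  have ht' : (1 : ℝ) ≤ P.t := by exact_mod_cast ht
  have harg : 1 < 2 ^ (i + 1) * 5 * P.t / δ := by
    rw [lt_div_iff₀ hδ0]
    have : (1 : ℝ) ≤ 2 ^ (i + 1) := one_le_pow₀ (by norm_num)
    nlinarith
  have hL := Real.log_pos harg
  set L := Real.log (2 ^ (i + 1) * 5 * P.t / δ) with hLdef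
  have hexp : Real.exp (-L) = δ / (2 ^ (i + 1) * 5 * P.t) := by
    rw [Real.exp_neg, Real.exp_log (by linarith), inv_div]
  have h := streamMeasure_le G α c (ms i) fun z => ∃ j : Fin P.t, ∃ v ∈ {v | P.part v = j},
    epsBound z.1 z.2 {v | P.part v = j} L < |betweenness G v - estimate z.1 v|
  refine (measure_mono ?_).trans (h.trans (ENNReal.ofReal_le_ofReal ?_))
  · rintro ω ⟨v, hv⟩
    refine ⟨P.part v, v, rfl, ?_⟩
    rw [epsAt, if_neg (by omega)] at hv
    exact hv
  -- There are `t` classes, each failing with probability at most `5 exp (-L)`; the argument of the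
  -- logarithm is chosen so that the total is `δ / 2 ^ (i + 1)`.
  · refine (pr_exists_le hpw _).trans ((Finset.sum_le_sum fun j _ =>
      pr_exists_epsBound_lt_le hα hc hm _ hL).trans_eq ?_)
    rw [hexp]
    simp only [Finset.sum_const, Finset.card_univ, Fintype.card_fin, nsmul_eq_mul]
    field_simp

theorem streamMeasure_sample_le (hα : 1 ≤ α) {ε η ν ρ : ℝ} (hε : 0 < ε) (hε1 : ε < 1) (hη : 0 < η)
    (hν0 : 0 < ν) (hν : ν ≤ 1 / 4)
    (hvar : ∀ v, expect (bagWeight G α) (fun τ =>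
      (pathFrac v τ - expect (bagWeight G α) (pathFrac v)) ^ 2) ≤ ν)
    (hρ : ∑ v, expect (bagWeight G α) (pathFrac v) ≤ ρ) {m : ℕ} (hm : sampleBound ε η ν ρ ≤ m) :
    streamMeasure G α c {ω | ∃ v, ε < |betweenness G v - estimate (fun k : Fin m => ω.1 k) v|} ≤
      ENNReal.ofReal η := by
  have hp := isWeight_bagWeight G α
  have hm1 : 1 ≤ m := (le_max_left _ _).trans hm
  have hm0 : (0 : ℝ) < m := by exact_mod_cast hm1
  have h := streamMeasure_le G α c m fun z =>
    ∃ v, m * ε < |m * expect (bagWeight G α) (pathFrac v) - ∑ k, pathFrac v (z.1 k)|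
  refine (measure_mono ?_).trans (h.trans (ENNReal.ofReal_le_ofReal ?_))
  · rintro ω ⟨v, hv⟩
    refine ⟨v, ?_⟩
    have h1 := mul_lt_mul_of_pos_left hv hm0
    rw [← abs_of_pos hm0, ← abs_mul, abs_of_pos hm0, mul_sub, mul_estimate hm1,
      ← expect_pathFrac hα] at h1
    exact h1
  · rw [pr_prodWeight_fst ((isWeight_boolWeight.piWeight m).piWeight c) fun x : Fin m → Bag G α =>
      ∃ v, m * ε < |m * expect (bagWeight G α) (pathFrac v) - ∑ k, pathFrac v (x k)|]
    exact pr_exists_abs_sub_gt_le hp pathFrac_nonneg pathFrac_le_one hε hε1 hη hν0 hν hvar hρ hm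

/-- The second phase is correct whenever the deviation bounds of all the iterations hold and the
first sample of size at least `mHat` is sufficient. -/
theorem secondPhase_correct {V : Type*} [Fintype V] [DecidableEq V] {G : Digraph V} {ε δ : ℝ}
    (hε1 : ε < 1) {P : Peeling V} {mHat : ℕ} {ms : ℕ → ℕ} {iStar : ℕ} (hi : mHat ≤ ms iStar)
    (hmin : ∀ i, mHat ≤ ms i → iStar ≤ i) {τ : ℕ → Bag G α} {σ : Fin c × ℕ → Bool}
    (h1 : ∀ i, 1 ≤ i → ∀ v,
      |betweenness G v - estimate (fun k : Fin (ms i) => τ k) v| ≤ epsAt δ P ms τ σ i (P.part v))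
    (h2 : ∀ v, |betweenness G v - estimate (fun k : Fin (ms iStar) => τ k) v| ≤ ε) :
    ∃ bt : V → ℝ, secondPhase ε δ P mHat ms τ σ = some bt ∧ IsApprox G ε bt := by
  classical
  have hend : ∃ i, StopCond ε δ P mHat ms τ σ i := ⟨iStar, Or.inr hi⟩
  refine ⟨_, dif_pos hend, ?_⟩
  set i := Nat.find hend with hidef
  have hle : i ≤ iStar := Nat.find_min' hend (Or.inr hi)
  rcases Nat.find_spec hend with h | h
  · intro v
    -- The accuracy criterion cannot hold before the first iteration, since the initial values are
    -- `1 > ε`.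
    have hi1 : 1 ≤ i := by
      rw [Nat.one_le_iff_ne_zero]
      intro h0
      have := h (P.part v)
      rw [← hidef, h0] at this
      simp only [epsAt, if_true] at this
      linarith
    exact (h1 i hi1 v).trans (h _)
  · have : i = iStar := le_antisymm hle (hmin _ h)
    intro v
    rw [this]
    exact h2 v

/-- The index `iStar` depends only on the schedule and the sufficient sample size, not on the
stream. The bound `η` is thus paid for one sample size, and only the adaptive bounds need a union
over iterations, a geometric series of sum `δ / 2`. -/
theorem streamMeasure_secondPhase_le (hα : 1 ≤ α) (hc : 1 ≤ c) {ε δ η ν ρ : ℝ} (hε : 0 < ε)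
    (hε1 : ε < 1) (hδ0 : 0 < δ) (hδ1 : δ < 1) (hη : 0 < η) (hν0 : 0 < ν) (hν : ν ≤ 1 / 4)
    (hvar : ∀ v, expect (bagWeight G α) (fun τ =>
      (pathFrac v τ - expect (bagWeight G α) (pathFrac v)) ^ 2) ≤ ν)
    (hρ : ∑ v, expect (bagWeight G α) (pathFrac v) ≤ ρ) (P : Peeling V) {ms : ℕ → ℕ}
    (hms : IsSchedule ms) :
    streamMeasure G α c {ω | ¬ ∃ bt : V → ℝ,
      secondPhase ε δ P (sampleBound ε η ν ρ) ms ω.1 ω.2 = some bt ∧ IsApprox G ε bt} ≤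
      ENNReal.ofReal (η + δ / 2) := by
  classical
  have hex : ∃ i, sampleBound ε η ν ρ ≤ ms i :=
    (hms.2.2.2.eventually (Filter.eventually_ge_atTop (sampleBound ε η ν ρ))).exists
  set iStar := Nat.find hex with hiStar
  have hsub : {ω : (ℕ → Bag G α) × (Fin c × ℕ → Bool) | ¬ ∃ bt : V → ℝ,
      secondPhase ε δ P (sampleBound ε η ν ρ) ms ω.1 ω.2 = some bt ∧ IsApprox G ε bt} ⊆
      {ω | ∃ v, ε < |betweenness G v - estimate (fun k : Fin (ms iStar) => ω.1 k) v|} ∪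
      ⋃ i, {ω | ∃ v, epsAt δ P ms ω.1 ω.2 (i + 1) (P.part v) <
        |betweenness G v - estimate (fun k : Fin (ms (i + 1)) => ω.1 k) v|} := by
    intro ω hω
    by_contra hcon
    rw [Set.mem_union, Set.mem_iUnion] at hcon
    push Not at hcon
    obtain ⟨h1, h2⟩ := hcon
    refine hω (secondPhase_correct hε1 (Nat.find_spec hex)
      (fun i hi => Nat.find_min' hex hi) (fun i hi v => ?_) fun v => ?_)
    · obtain ⟨j, rfl⟩ : ∃ j, i = j + 1 := ⟨i - 1, by omega⟩
      exact not_lt.1 fun hlt => h2 j ⟨v, hlt⟩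
    · exact not_lt.1 fun hlt => h1 ⟨v, hlt⟩
  refine (measure_mono hsub).trans ((measure_union_le _ _).trans ?_)
  rw [ENNReal.ofReal_add hη.le (by positivity)]
  refine add_le_add (streamMeasure_sample_le hα hε hε1 hη hν0 hν hvar hρ (Nat.find_spec hex)) ?_
  refine (measure_iUnion_le _).trans ((ENNReal.tsum_le_tsum fun i =>
    streamMeasure_iteration_le hα hc hδ0 hδ1 P hms (Nat.le_add_left 1 i)).trans ?_)
  have hsum : HasSum (fun i : ℕ => δ / 2 ^ (i + 1 + 1)) (δ / 2) := by
    have heq : (fun i : ℕ => δ / 2 ^ (i + 1 + 1)) = fun i : ℕ => δ / 2 / 2 / 2 ^ i := by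
      funext i
      rw [pow_succ, pow_succ]
      field_simp
    rw [heq]
    exact hasSum_geometric_two' (δ / 2)
  rw [← ENNReal.ofReal_tsum_of_nonneg (fun i => by positivity) hsum.summable, hsum.tsum_eq]

theorem pr_varBound_lt_le {m : ℕ} (hm : 1 ≤ m) {η : ℝ} (hη0 : 0 < η) (hη1 : η < 1) :
    pr (piWeight (bagWeight G α) m) (fun S => ∃ v, varBound S Set.univ (Real.log (1 / η)) <
      expect (bagWeight G α) fun τ => pathFrac v τ ^ 2) ≤ η := by
  have hp := isWeight_bagWeight G α
  have hm0 : (0 : ℝ) < m := by exact_mod_cast hm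
  have hL : 0 < Real.log (1 / η) := Real.log_pos (by rw [lt_div_iff₀ hη0]; linarith)
  have h := pr_varSum_lt_le (f := fun (v : (Set.univ : Set V)) (τ : Bag G α) => pathFrac (v : V) τ)
    hp m (fun v τ => pathFrac_nonneg _ τ) (fun v τ => pathFrac_le_one _ τ) hL
  rw [Real.exp_neg, Real.exp_log (by positivity), one_div, inv_inv, ← one_div] at h
  refine (pr_mono (hp.piWeight m) ?_).trans h
  rintro S ⟨v, hv⟩
  rw [← mul_varBound hm]
  refine mul_lt_mul_of_pos_left (hv.trans_le ?_) hm0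
  exact le_ciSup (bddAbove_range_of_finite fun v : (Set.univ : Set V) =>
    expect (bagWeight G α) fun τ => pathFrac (v : V) τ ^ 2) ⟨v, trivial⟩

theorem varBound_pos {V : Type*} [Fintype V] [DecidableEq V] {G : Digraph V} {m : ℕ}
    (hm : 1 ≤ m) (S : Fin m → Bag G α) {L : ℝ} (hL : 0 < L) :
    0 < varBound S Set.univ L := by
  have hm0 : (0 : ℝ) < m := by exact_mod_cast hm
  have h1 : 0 ≤ wimpy S Set.univ := Real.iSup_nonneg fun v => by positivity
  unfold varBound
  positivity

/-- The second phase fails with probability at most `δm + δ / 2` when the bounds computed from the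
first sample hold. -/
theorem streamMeasure_silvan_le (hα : 1 ≤ α) (hc : 1 ≤ c) {m' : ℕ} (hm' : 1 ≤ m') {ε δ : ℝ}
    (hε0 : 0 < ε) (hε1 : ε < 1) (hδ0 : 0 < δ) (hδ1 : δ < 1) {D : ℕ} (meth : RhoMethod)
    {δρ δν δm : ℝ} (hδν : 0 < δν) (hδν1 : δν < 1) (hδm : 0 < δm)
    (peel : (Fin m' → Bag G α) → Peeling V) (sched : (Fin m' → Bag G α) → ℕ → ℕ)
    (hsched : ∀ S', IsSchedule (sched S')) (S : Fin m' → Bag G α)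
    (hρ : ∑ v, expect (bagWeight G α) (pathFrac v) ≤ rhoBound S D δρ meth)
    (hν : ∀ v, expect (bagWeight G α) (fun τ => pathFrac v τ ^ 2) ≤
      varBound S Set.univ (Real.log (1 / δν))) :
    streamMeasure G α c {ω | ¬ ∃ bt : V → ℝ,
      silvan ε δ D meth δρ δν δm peel sched (S, ω) = some bt ∧ IsApprox G ε bt} ≤
      ENNReal.ofReal (δm + δ / 2) := by
  have hp := isWeight_bagWeight G α
  have hLν : 0 < Real.log (1 / δν) := Real.log_pos (by rw [lt_div_iff₀ hδν]; linarith)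
  -- The variance is at most the second moment, and at most `b (1 - b) ≤ 1 / 4` because `f_v² ≤
  -- f_v`.
  have hvar : ∀ v, expect (bagWeight G α) (fun τ =>
      (pathFrac v τ - expect (bagWeight G α) (pathFrac v)) ^ 2) ≤
      min (1 / 4) (varBound S Set.univ (Real.log (1 / δν))) := fun v => by
    refine le_min ?_ ((expect_sq_sub_le hp _).trans (hν v))
    rw [expect_sq_sub hp]
    have : expect (bagWeight G α) (fun τ => pathFrac v τ ^ 2) ≤
        expect (bagWeight G α) (pathFrac v) := expect_mono hp fun τ => by
      nlinarith [pathFrac_nonneg v τ, pathFrac_le_one v τ]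
    nlinarith [sq_nonneg (expect (bagWeight G α) (pathFrac v) - 1 / 2)]
  have hν0 := lt_min (a := (0 : ℝ)) (b := 1 / 4) (by norm_num) (varBound_pos hm' S hLν)
  have h := streamMeasure_secondPhase_le hα hc hε0 hε1 hδ0 hδ1 hδm hν0 (min_le_left _ _) hvar hρ
    (peel S) (hsched S) (c := c)
  exact (measure_mono fun ω hω => hω).trans h

/-- The algorithm fails with probability at most `δ`. -/
theorem runMeasure_compl_le (hα : 1 ≤ α) (hc : 1 ≤ c) {m' : ℕ} (hm' : 1 ≤ m') {ε δ : ℝ}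
    (hε0 : 0 < ε) (hε1 : ε < 1) (hδ0 : 0 < δ) (hδ1 : δ < 1) {D : ℕ} (hD : vertexDiameter G ≤ D)
    (meth : RhoMethod) (hmeth : meth = RhoMethod.empiricalBernstein → 2 ≤ m') {δρ δν δm : ℝ}
    (hδρ : 0 < δρ) (hδν : 0 < δν) (hδm : 0 < δm) (hsplit : δρ + δν + δm ≤ δ / 2)
    (peel : (Fin m' → Bag G α) → Peeling V) (sched : (Fin m' → Bag G α) → ℕ → ℕ)
    (hsched : ∀ S', IsSchedule (sched S')) :
    runMeasure G α c m' {ω | ∃ bt : V → ℝ,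
      silvan ε δ D meth δρ δν δm peel sched ω = some bt ∧ IsApprox G ε bt}ᶜ ≤
      ENNReal.ofReal δ := by
  classical
  have hp := isWeight_bagWeight G α
  have hpm := hp.piWeight m'
  have hδρ1 : δρ < 1 := by linarith
  have hδν1 : δν < 1 := by linarith
  have hLν : 0 < Real.log (1 / δν) := Real.log_pos (by rw [lt_div_iff₀ hδν]; linarith)
  let bad : (Fin m' → Bag G α) → Prop := fun S =>
    (rhoBound S D δρ meth < ∑ v, expect (bagWeight G α) (pathFrac v)) ∨
      ∃ v, varBound S Set.univ (Real.log (1 / δν)) <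
        expect (bagWeight G α) fun τ => pathFrac v τ ^ 2
  have hpr : pr (piWeight (bagWeight G α) m') bad ≤ δρ + δν :=
    (pr_or_le hpm _ _).trans (add_le_add (pr_rhoBound_lt_le hm' hD meth hmeth hδρ hδρ1)
      (pr_varBound_lt_le hm' hδν hδν1))
  -- A bad first sample is charged the full probability `1`, a good one only the failure of the
  -- second phase.
  refine (runMeasure_le G α c m' _ (fun S => (if bad S then 1 else 0) + (δm + δ / 2))
    (fun S => ?_) fun S => ?_).trans (ENNReal.ofReal_le_ofReal ?_)
  · split_ifs <;> positivity
  · by_cases hS : bad S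
    · rw [if_pos hS]
      refine prob_le_one.trans ?_
      rw [← ENNReal.ofReal_one]
      exact ENNReal.ofReal_le_ofReal (by linarith)
    · rw [if_neg hS, zero_add]
      simp only [bad] at hS
      push Not at hS
      exact streamMeasure_silvan_le hα hc hm' hε0 hε1 hδ0 hδ1 meth hδν hδν1 hδm peel sched hsched
        S hS.1 hS.2
  · rw [expect_add, expect_const hpm]
    have : expect (piWeight (bagWeight G α) m') (fun S => if bad S then (1 : ℝ) else 0) =
        pr (piWeight (bagWeight G α) m') bad := by
      unfold pr
      congr! with S
    rw [this]
    linarith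

end correctness

end

end Silvan

theorem mainTheorem4 {V : Type*} [Fintype V] [DecidableEq V] [Nontrivial V] (G : Digraph V)
    (α : ℝ) (hα : 1 ≤ α) (c m' : ℕ) (hc : 1 ≤ c) (hm' : 1 ≤ m')
    (ε δ : ℝ) (hε0 : 0 < ε) (hε1 : ε < 1) (hδ0 : 0 < δ) (hδ1 : δ < 1)
    (D : ℕ) (hD : Silvan.vertexDiameter G ≤ D)
    (meth : Silvan.RhoMethod) (hmeth : meth = Silvan.RhoMethod.empiricalBernstein → 2 ≤ m')
    (δρ δν δm : ℝ) (hδρ : 0 < δρ) (hδν : 0 < δν) (hδm : 0 < δm) (hsplit : δρ + δν + δm ≤ δ / 2)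
    (peel : (Fin m' → Silvan.Bag G α) → Silvan.Peeling V)
    (sched : (Fin m' → Silvan.Bag G α) → ℕ → ℕ)
    (hsched : ∀ S', Silvan.IsSchedule (sched S')) :
    ENNReal.ofReal (1 - δ) ≤
      Silvan.runMeasure G α c m'
        {ω | ∃ bt : V → ℝ,
          Silvan.silvan ε δ D meth δρ δν δm peel sched ω = some bt ∧ Silvan.IsApprox G ε bt} := by
  rw [ENNReal.ofReal_sub _ hδ0.le, ENNReal.ofReal_one, tsub_le_iff_right]
  -- Subadditivity over a set and its complement holds for outer measures, so the success event need
  -- not be shown measurable.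
  refine (measure_univ (μ := Silvan.runMeasure G α c m')).symm.le.trans
    ((measure_univ_le_add_compl {ω | ∃ bt : V → ℝ,
      Silvan.silvan ε δ D meth δρ δν δm peel sched ω = some bt ∧ Silvan.IsApprox G ε bt}).trans ?_)
  gcongr
  exact Silvan.runMeasure_compl_le hα hc hm' hε0 hε1 hδ0 hδ1 hD meth hmeth hδρ hδν hδm hsplit
    peel sched hsched
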